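/- Fix a positive integer $a$. For a tuple $\boldsymbol\mu=(\mu_1,\dots,\mu_n)$ of positive integers, $n\ge 1$, write $S=\{1,\dots,n\}$, $|\boldsymbol\mu|=\mu_1+\cdots+\mu_n$, and, for $I\subseteq S$, let $\boldsymbol\mu_I$ be the subtuple with indices in $I$. Permutations are multiplied from left to right. For $g\ge 0$, a *monotone $a$-orbifold Hurwitz factorisation of type $(g,\boldsymbol\mu)$* is a tuple $(\sigma_0,\sigma_1,\dots,\sigma_m)$ of permutations in $S_{|\boldsymbol\mu|}$ with $m=2g-2+n+\frac{|\boldsymbol\mu|}{a}$ such that $\sigma_0$ has cycle type $(a,a,\dots,a)$; $\sigma_i=(r_i\ s_i)$ with $r_i<s_i$ for $1\le i\le m$, and $s_1\le\cdots\le s_m$; $\sigma_0,\dots,\sigma_m$ generate a transitive subgroup; together with a labelling of the cycles (including fixed points) of $\sigma_0\sigma_1\cdots\sigma_m$ by $1,\dots,n$ such that cycle $i$ has length $\mu_i$. The *monotone orbifold Hurwitz number* $\vec H_{g,n}^{[a]}(\boldsymbol\mu)$ is $\frac{1}{|\boldsymbol\mu|!}$ times the number of these factorisations (it is $0$ if $a\nmid|\boldsymbol\mu|$).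 For $1\le\ell\le a$ and $|\boldsymbol\mu|=ak$, let $N_g^\ell(\mu_1\,|\,\boldsymbol\mu_{S\setminus\{1\}})$ be the number of those factorisations for which $\sigma_0=(1\,2\cdots a)(a+1\cdots 2a)\cdots(ak-a+1\cdots ak)$, $s_m=ak-a+\ell$, and the numbers $ak-a+\ell,\dots,ak$ all lie in the cycle labelled $1$; if $m=0$, the condition on $s_m$ is replaced by $\ell=1$. The *refined count* is $\vec H_{g,n}^{[a],\ell}(\mu_1\,|\,\boldsymbol\mu_{S\setminus\{1\}})=\frac{1}{a^k k!}N_g^\ell(\mu_1\,|\,\boldsymbol\mu_{S\setminus\{1\}})$ (and $0$ if $a\nmid|\boldsymbol\mu|$). Let $\Theta(x)=1$ for $x\ge0$ and $\Theta(x)=0$ for $x<0$. **Theorem (Cut-and-join recursion).** For all $g\ge0$, all $n\geq 1$ and all tuples $\boldsymbol\mu=(\mu_1,\dots,\mu_n)$ of positive integers, \[ \vec H_{g,n}^{[a]}(\boldsymbol\mu)=\sum_{i=1}^n\sum_{\ell=1}^a \vec H_{g,n}^{[a],\ell}(\mu_i\,|\,\boldsymbol\mu_{S\setminus\{i\}}),\tag{1}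 \] for $1\le\ell\le a$, \[ \vec H_{0,1}^{[a],\ell}(a\,|\,)=\tfrac1a\,\delta_{\ell,1},\tag{2} \] and, for $1\le\ell\le a$ and every $(g,\boldsymbol\mu)\neq(0,(a))$, \[ \begin{aligned} \vec H_{g,n}^{[a],\ell}(\mu_1\,|\,\boldsymbol\mu_{S\setminus\{1\}})={}&\Theta(\mu_1+\ell-a-1)\sum_{p=1}^{\ell}\sum_{i=2}^n\vec H_{g,n-1}^{[a],p}(\mu_1+\mu_i\,|\,\boldsymbol\mu_{S\setminus\{1,i\}})\\ &+\sum_{\alpha+\beta=\mu_1}\sum_{p=1}^{\ell}\beta\,\vec H_{g-1,n+1}^{[a],p}(\alpha\,|\,\boldsymbol\mu_{S\setminus\{1\}},\beta)\\ &+\sum_{\alpha+\beta=\mu_1}\ \sum_{\substack{g_1+g_2=g\\ I\sqcup J=S\setminus\{1\}}}\ \sum_{p=1}^{\ell}\frac{|\boldsymbol\mu_J|+\alpha}{|\boldsymbol\mu|}\,\beta\,\vec H_{g_1,|I|+1}^{[a]}(\boldsymbol\mu_I,\beta)\,\vec H_{g_2,|J|+1}^{[a],p}(\alpha\,|\,\boldsymbol\mu_J),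 \end{aligned}\tag{3} \] where $\alpha,\beta\ge1$, $g_1,g_2\ge0$, and the second line is absent for $g=0$. Moreover these three pieces of data determine all the numbers: if rational-valued families $F_{g,n}(\boldsymbol\mu)$ and $R^{\ell}_{g,n}(\mu_1\,|\,\boldsymbol\mu_{S\setminus\{1\}})$, defined for all $g\ge0$, $n\ge1$, $1\le\ell\le a$ and all tuples of positive integers, satisfy (1), (2) and (3) in place of $\vec H^{[a]}_{g,n}$ and $\vec H^{[a],\ell}_{g,n}$, then $F_{g,n}=\vec H^{[a]}_{g,n}$ and $R^{\ell}_{g,n}=\vec H^{[a],\ell}_{g,n}$ for all $g$, $n$, $\ell$. -/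

import Mathlib

namespace MonotoneOrbifold

/-- The product `σ₀ σ₁ ⋯ σ_m`, permutations being multiplied from left to right: first apply `σ₀`,
then `σ₁`, and so on up to `σ_m`. (Mathlib composes from right to left, hence the reversal.) -/
def leftToRightProd {d m : ℕ} (σ₀ : Equiv.Perm (Fin d)) (σ : Fin m → Equiv.Perm (Fin d)) :
    Equiv.Perm (Fin d) :=
  (List.ofFn σ).reverse.prod * σ₀

/-- `σ₁, …, σ_m` is a monotone sequence of transpositions: `σᵢ = (rᵢ sᵢ)` with `rᵢ < sᵢ` and
`s₁ ≤ ⋯ ≤ s_m`. -/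
def IsMonotoneSeq {d m : ℕ} (σ : Fin m → Equiv.Perm (Fin d)) : Prop :=
  ∃ r s : Fin m → Fin d, (∀ i, r i < s i ∧ σ i = Equiv.swap (r i) (s i)) ∧ Monotone s

/-- `lab` labels the cycles of `τ` (fixed points included) by the positions of the tuple `μ`, in such
a way that cycle `i` has length `μᵢ`: the point `x` lies in the cycle with label `lab x`. -/
structure IsCycleLabelling {d : ℕ} (μ : List ℕ) (τ : Equiv.Perm (Fin d))
    (lab : Fin d → Fin μ.length) : Prop where
  same_iff : ∀ x y, lab x = lab y ↔ τ.SameCycle x y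
  surjective : Function.Surjective lab
  length_eq : ∀ i, Nat.card {x // lab x = i} = μ.get i

/-- The conditions on a monotone `a`-orbifold factorisation `(σ₀, σ₁, …, σ_m)` in `S_d` whose product
has cycles labelled so that cycle `i` has length `μᵢ`. -/
structure IsFactorisation (a : ℕ) {d m : ℕ} (μ : List ℕ) (σ₀ : Equiv.Perm (Fin d))
    (σ : Fin m → Equiv.Perm (Fin d)) (lab : Fin d → Fin μ.length) : Prop where
  cycleType_zero : σ₀.partition.parts = Multiset.replicate (d / a) a
  monotone : IsMonotoneSeq σ
  labelling : IsCycleLabelling μ (leftToRightProd σ₀ σ) lab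
  transitive :
    MulAction.IsPretransitive (Subgroup.closure (insert σ₀ (Set.range σ))) (Fin d)

/-- `m = 2g - 2 + n + |μ| / a`. -/
def numTranspositions (a g : ℕ) (μ : List ℕ) : ℕ :=
  2 * g + μ.length + μ.sum / a - 2

/-- The monotone orbifold Hurwitz number of genus `g` and type `μ = (μ₁, …, μ_n)`: the number of
monotone `a`-orbifold Hurwitz factorisations (with labelled cycles), divided by `|μ|!`. -/
noncomputable def H (a g : ℕ) (μ : List ℕ) : ℚ :=
  (Nat.card {x : Equiv.Perm (Fin μ.sum) ×
      (Fin (numTranspositions a g μ) → Equiv.Perm (Fin μ.sum)) × (Fin μ.sum → Fin μ.length) //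
    IsFactorisation a μ x.1 x.2.1 x.2.2} : ℚ) / (μ.sum.factorial : ℚ)

/-- `σ₀` is the special permutation `(1 2 ⋯ a)(a+1 ⋯ 2a) ⋯ (ak-a+1 ⋯ ak)`. The number `j` of
`{1, …, ak}` is the element `j - 1` of `Fin (ak)`. -/
def IsSpecial (a : ℕ) {d : ℕ} (σ₀ : Equiv.Perm (Fin d)) : Prop :=
  ∀ x : Fin d, (σ₀ x : ℕ) = if a ∣ (x : ℕ) + 1 then (x : ℕ) + 1 - a else (x : ℕ) + 1

/-- Refined Hurwitz factorisations with counter `ℓ` in `S_d`, `d = ak`: `σ₀` is special,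
`σ_m = (r_m  ak-a+ℓ)` with `r_m < ak-a+ℓ`, and `ak-a+ℓ, …, ak` all lie in the first cycle of the
product. If `m = 0` there is no last transposition and the counter is `1`. -/
structure IsRefinedFactorisation (a ℓ : ℕ) {d m : ℕ} (μ : List ℕ) (σ₀ : Equiv.Perm (Fin d))
    (σ : Fin m → Equiv.Perm (Fin d)) (lab : Fin d → Fin μ.length) : Prop
    extends IsFactorisation a μ σ₀ σ lab where
  special : IsSpecial a σ₀
  counter_zero : m = 0 → ℓ = 1
  counter_last : ∀ i : Fin m, (i : ℕ) + 1 = m →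
    ∃ r s : Fin d, r < s ∧ (s : ℕ) + 1 + a = d + ℓ ∧ σ i = Equiv.swap r s
  first_cycle : ∀ x : Fin d, d + ℓ ≤ (x : ℕ) + 1 + a → (lab x : ℕ) = 0

/-- The number `N_g^ℓ(μ₁ | μ₂, …, μ_n)` of refined factorisations; `ν = (μ₂, …, μ_n)`. -/
noncomputable def N (a ℓ g μ₁ : ℕ) (ν : List ℕ) : ℕ :=
  Nat.card {x : Equiv.Perm (Fin (μ₁ :: ν).sum) ×
      (Fin (numTranspositions a g (μ₁ :: ν)) → Equiv.Perm (Fin (μ₁ :: ν).sum)) ×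
      (Fin (μ₁ :: ν).sum → Fin (μ₁ :: ν).length) //
    IsRefinedFactorisation a ℓ (μ₁ :: ν) x.1 x.2.1 x.2.2}

/-- The refined count `H_{g,n}^{[a],ℓ}(μ₁ | μ₂, …, μ_n) = N_g^ℓ(μ₁ | μ₂, …, μ_n) / (a^k k!)`, where
`k = |μ| / a` and `ν = (μ₂, …, μ_n)`. -/
noncomputable def Href (a ℓ g μ₁ : ℕ) (ν : List ℕ) : ℚ :=
  (N a ℓ g μ₁ ν : ℚ) /
    ((a : ℚ) ^ ((μ₁ :: ν).sum / a) * (((μ₁ :: ν).sum / a).factorial : ℚ))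

/-- The Heaviside step function, with value `1` at `0`. -/
def heaviside (x : ℤ) : ℚ := if 0 ≤ x then 1 else 0

/-- The subtuple `ν_I`, in increasing order of positions. -/
def subtuple (ν : List ℕ) (I : Finset (Fin ν.length)) : List ℕ :=
  ((List.finRange ν.length).filter (· ∈ I)).map ν.get

/-- The pairs `(α, β)` of positive integers with `α + β = n`. -/
def splittings (n : ℕ) : Finset (ℕ × ℕ) :=
  (Finset.HasAntidiagonal.antidiagonal n).filter fun q => 0 < q.1 ∧ 0 < q.2

/-- The right-hand side of the cut-and-join recursion, for a family `F g μ` and a refined family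
`R ℓ g μ₁ ν`: cut term, redundant join term (absent in genus `0`), essential join term. -/
def cutJoinRHS (a : ℕ) (F : ℕ → List ℕ → ℚ) (R : ℕ → ℕ → ℕ → List ℕ → ℚ)
    (ℓ g μ₁ : ℕ) (ν : List ℕ) : ℚ :=
  heaviside ((μ₁ : ℤ) + ℓ - a - 1) *
      ∑ p ∈ Finset.Icc 1 ℓ, ∑ i : Fin ν.length, R p g (μ₁ + ν.get i) (ν.eraseIdx i)
  + (if g = 0 then 0 else
      ∑ q ∈ splittings μ₁, ∑ p ∈ Finset.Icc 1 ℓ, (q.2 : ℚ) * R p (g - 1) q.1 (ν ++ [q.2]))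
  + ∑ q ∈ splittings μ₁, ∑ h ∈ Finset.HasAntidiagonal.antidiagonal g, ∑ I : Finset (Fin ν.length),
      ∑ p ∈ Finset.Icc 1 ℓ,
        (((subtuple ν Iᶜ).sum : ℚ) + q.1) / ((μ₁ :: ν).sum : ℚ) * q.2 *
          F h.1 (subtuple ν I ++ [q.2]) * R p h.2 q.1 (subtuple ν Iᶜ)

/-- The three pieces of data: the decomposition into refined counts, the base case, and the
cut-and-join recursion (for every argument other than that of the base case). -/
structure CutJoinSystem (a : ℕ) (F : ℕ → List ℕ → ℚ) (R : ℕ → ℕ → ℕ → List ℕ → ℚ) : Prop where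
  decomposition : ∀ (g : ℕ) (μ : List ℕ), μ ≠ [] → (∀ x ∈ μ, 0 < x) →
    F g μ = ∑ i : Fin μ.length, ∑ ℓ ∈ Finset.Icc 1 a, R ℓ g (μ.get i) (μ.eraseIdx i)
  base : ∀ ℓ ∈ Finset.Icc 1 a, R ℓ 0 a [] = if ℓ = 1 then 1 / (a : ℚ) else 0
  recursion : ∀ ℓ ∈ Finset.Icc 1 a, ∀ (g μ₁ : ℕ) (ν : List ℕ), 0 < μ₁ → (∀ x ∈ ν, 0 < x) →
    ¬ (g = 0 ∧ μ₁ = a ∧ ν = []) →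
    R ℓ g μ₁ ν = cutJoinRHS a F R ℓ g μ₁ ν

end MonotoneOrbifold

/-!
A sequence of transpositions `σ₁, …, σ_m` is encoded by its *word*, the list of the pairs `(r, s)`
with the last transposition first; `countWith` counts the words whose second entries are weakly
decreasing along the list, which are transitive together with a fixed `σ₀`, with labelled cycles of
the product.

**Cut and join.** Removing the last transposition `(r s)` is the first step of the recursion
(`countWith_succ`). Since `s` is maximal, the points after `s` are moved by `σ₀` only, so that with
`σ₀` special the cycle of `s` in the product of the remaining factors runs through `s, …, ak`
consecutively, and `r < s` is outside this stretch. If `(r s)` cuts that cycle, the possible `r`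
correspond to the possible lengths of the piece that stays with `s`, as long as this piece contains
the `a - ℓ + 1` points of the stretch: this is where the Heaviside function comes from. If `(r s)`
joins two cycles of lengths `α` and `β`, there are `β` choices of `r`, and the remaining factors
have one orbit or two.

**Two orbits.** For a set of blocks of `σ₀` and its complement, the monotone words with these two
orbits are the shuffles of a transitive word on each orbit. As the words are sorted by `s` and the
entries `s` of different orbits are different points, the shuffle is unique (`exists_merge`,
`eq_of_lefts_rights`), so there is no binomial coefficient in the number of transpositions
(`card_two_orbits`, `countSplit_blockRot`). The choice of the blocks of the orbit without the last
point gives the binomial coefficient `(k - 1).choose j`, which the normalisation by `a ^ k * k!`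
turns into the factor `(|μ_J| + α) / |μ|` (`sum_choose_mul_countA_mul_countC`).

**Counters.** The last transposition is the one with the greatest `s`. Hence the sum of the refined
counts over the counters `p ≤ ℓ` counts the words in which no transposition involves the last `a -
ℓ` points (`sum_countB`); for a transitive word, the greatest `s` belongs to the last block of `σ₀`,
so that there is always a counter (`isTop_head`). For `ℓ = a` this gives the decomposition into
refined counts, according to the label of the last point (`countA_eq_sum`).

**The initial permutation.** The Hurwitz numbers allow all `σ₀` of cycle type `(a, …, a)`, whereas
monotonicity is not invariant under conjugation. However, the sum of all monotone words is the
complete homogeneous symmetric polynomial in the Jucys–Murphy elements. It is fixed by relabelling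
the points, because a relabelling by an adjacent transposition fixes the elementary symmetric
polynomials in two neighbouring Jucys–Murphy elements (`map_completeHom_jucysMurphy`). This is
carried out in the monoid algebra of `TrackMonoid`, which keeps track of the invariant sets of a
word besides its product, so that transitivity is respected. Consequently the number of
factorisations depends only on the conjugacy class of `σ₀` (`countWith_conj`), and there are `(ak)!
/ (a ^ k * k!)` permutations in the class.

**Genus.** The recursion is proved with the number `m` of transpositions in place of the genus. It
shows that factorisations exist only for `m + 2 = 2 g + n + k` with `g ≥ 0`
(`hasGenus_of_numB_ne_zero`), so that the distributions of the transpositions to the two orbits are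
the distributions of the genus (`sum_genus`).

**Uniqueness.** The right-hand side of the recursion contains only numbers with smaller `|μ|`, or
with the same `|μ|` and smaller `2 g + n` (`CutJoinSystem.refined_unique`).
-/

namespace MonotoneOrbifold

open Equiv Equiv.Perm Finset
open scoped Classical

set_option linter.unusedSectionVars false

/-! ### Cycles of a permutation multiplied by a transposition -/

section Cycles

variable {X : Type*} [Finite X] [DecidableEq X]

/-- In a finite set, forward invariance suffices for a set to contain the whole cycle of each of
its points. -/
lemma mem_of_sameCycle {τ : Perm X} {P : Set X} (hP : ∀ x ∈ P, τ x ∈ P) {x y : X}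
    (h : SameCycle τ x y) (hx : x ∈ P) : y ∈ P := by
  obtain ⟨i, -, rfl⟩ := h.exists_pow_eq'
  induction i with
  | zero => simpa using hx
  | succ i ih =>
    rw [pow_succ', Perm.mul_apply]
    exact hP _ (ih ⟨i, by simp⟩)

lemma sameCycle_apply (τ : Perm X) (x : X) : SameCycle τ x (τ x) := ⟨1, by simp⟩

lemma sameCycle_swap_mul_cases {τ : Perm X} {r s x y : X}
    (h : SameCycle (swap r s * τ) x y) :
    SameCycle τ x y ∨ (SameCycle τ x r ∧ SameCycle τ s y) ∨
      (SameCycle τ x s ∧ SameCycle τ r y) := by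
  refine mem_of_sameCycle (P := {y | SameCycle τ x y ∨ (SameCycle τ x r ∧ SameCycle τ s y) ∨
      (SameCycle τ x s ∧ SameCycle τ r y)}) ?_ h (Or.inl (SameCycle.refl _ _))
  intro z hz
  simp only [Set.mem_ofPred_eq, Perm.mul_apply] at hz ⊢
  have hz' := sameCycle_apply τ z
  rcases eq_or_ne (τ z) r with h1 | h1
  · rw [h1, swap_apply_left]
    rw [h1] at hz'
    rcases hz with h | ⟨h, h'⟩ | ⟨h, h'⟩
    · exact Or.inr (Or.inl ⟨h.trans hz', SameCycle.refl _ _⟩)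
    · exact Or.inr (Or.inl ⟨h, SameCycle.refl _ _⟩)
    · exact Or.inl h
  · rcases eq_or_ne (τ z) s with h2 | h2
    · rw [h2, swap_apply_right]
      rw [h2] at hz'
      rcases hz with h | ⟨h, h'⟩ | ⟨h, h'⟩
      · exact Or.inr (Or.inr ⟨h.trans hz', SameCycle.refl _ _⟩)
      · exact Or.inl h
      · exact Or.inr (Or.inr ⟨h, SameCycle.refl _ _⟩)
    · rw [swap_apply_of_ne_of_ne h1 h2]
      rcases hz with h | ⟨h, h'⟩ | ⟨h, h'⟩
      · exact Or.inl (h.trans hz')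
      · exact Or.inr (Or.inl ⟨h, h'.trans hz'⟩)
      · exact Or.inr (Or.inr ⟨h, h'.trans hz'⟩)

/-- A transposition of points in different cycles joins these cycles. -/
lemma sameCycle_swap_mul_of_not {τ : Perm X} {r s : X} (h : ¬ SameCycle τ r s) :
    SameCycle (swap r s * τ) r s := by
  by_contra hn
  -- The points of the `τ`-cycle of `s` that stay in the new cycle of `s` are closed under `τ`:
  -- the only way out is through `τ⁻¹ s`, which is now sent to `r`.
  have key : τ⁻¹ s ∈ {x | SameCycle τ s x ∧ SameCycle (swap r s * τ) s x} := by
    refine mem_of_sameCycle (τ := τ) (x := s) ?_ ⟨-1, by simp⟩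
      ⟨SameCycle.refl _ _, SameCycle.refl _ _⟩
    rintro x ⟨hx1, hx2⟩
    have h1 : SameCycle τ s (τ x) := hx1.trans (sameCycle_apply τ x)
    have h2 : SameCycle (swap r s * τ) s ((swap r s * τ) x) := hx2.trans (sameCycle_apply _ x)
    refine ⟨h1, ?_⟩
    rcases eq_or_ne (τ x) s with e | e
    · rw [e]
    · have : τ x ≠ r := by
        intro e'
        exact h (e' ▸ h1).symm
      rwa [Perm.mul_apply, swap_apply_of_ne_of_ne this e] at h2
  have := key.2.trans (sameCycle_apply _ (τ⁻¹ s))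
  rw [Perm.mul_apply, show τ (τ⁻¹ s) = s by simp, swap_apply_right] at this
  exact hn this.symm

lemma sameCycle_swap_mul_mono {τ : Perm X} {r s x y : X}
    (h : SameCycle (swap r s * τ) r s) (hxy : SameCycle τ x y) :
    SameCycle (swap r s * τ) x y := by
  refine mem_of_sameCycle (P := {y | SameCycle (swap r s * τ) x y}) ?_ hxy (SameCycle.refl _ _)
  intro z hz
  have h2 : SameCycle (swap r s * τ) x ((swap r s * τ) z) :=
    SameCycle.trans hz (sameCycle_apply _ z)
  rw [Perm.mul_apply] at h2
  simp only [Set.mem_ofPred_eq]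
  rcases eq_or_ne (τ z) r with e | e
  · rw [e, swap_apply_left] at h2
    rw [e]; exact h2.trans h.symm
  · rcases eq_or_ne (τ z) s with e' | e'
    · rw [e', swap_apply_right] at h2
      rw [e']; exact h2.trans h
    · rwa [swap_apply_of_ne_of_ne e e'] at h2

/-- Multiplying by a transposition of points in distinct cycles joins these two cycles. -/
lemma sameCycle_swap_mul_iff {τ : Perm X} {r s : X} (h : ¬ SameCycle τ r s) (x y : X) :
    SameCycle (swap r s * τ) x y ↔ SameCycle τ x y ∨ (SameCycle τ x r ∧ SameCycle τ s y) ∨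
      (SameCycle τ x s ∧ SameCycle τ r y) := by
  have h1 := sameCycle_swap_mul_of_not h
  refine ⟨sameCycle_swap_mul_cases, ?_⟩
  rintro (h | ⟨h, h'⟩ | ⟨h, h'⟩)
  · exact sameCycle_swap_mul_mono h1 h
  · exact (sameCycle_swap_mul_mono h1 h).trans (h1.trans (sameCycle_swap_mul_mono h1 h'))
  · exact (sameCycle_swap_mul_mono h1 h).trans (h1.symm.trans (sameCycle_swap_mul_mono h1 h'))

end Cycles

section CycleSize

variable {X : Type*} [Fintype X] [DecidableEq X]

/-- The number of points in the cycle of `x`. -/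
noncomputable def cycleSize (τ : Perm X) (x : X) : ℕ := (univ.filter fun y => SameCycle τ x y).card

lemma filter_sameCycle_eq_image (τ : Perm X) (x : X) :
    (univ.filter fun y => SameCycle τ x y) =
      (range (Function.minimalPeriod τ x)).image fun i => (τ ^ i) x := by
  have hper : x ∈ Function.periodicPts τ := by
    refine ⟨orderOf τ, orderOf_pos τ, ?_⟩
    rw [Function.IsPeriodicPt, Function.IsFixedPt, ← Perm.coe_pow, pow_orderOf_eq_one]; rfl
  ext y
  simp only [mem_filter, mem_univ, true_and, mem_image, mem_range]
  constructor
  · intro h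
    obtain ⟨i, -, rfl⟩ := h.exists_pow_eq'
    refine ⟨i % Function.minimalPeriod τ x,
      Nat.mod_lt _ (Function.minimalPeriod_pos_of_mem_periodicPts hper), ?_⟩
    rw [Perm.coe_pow, Perm.coe_pow, Function.iterate_mod_minimalPeriod_eq]
  · rintro ⟨i, -, rfl⟩
    exact ⟨i, by simp⟩

lemma pow_injOn (τ : Perm X) (x : X) :
    Set.InjOn (fun i : ℕ => (τ ^ i) x) (range (Function.minimalPeriod τ x)) := by
  intro i hi j hj h
  simp only [Perm.coe_pow] at h
  rw [coe_range] at hi hj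
  exact Function.iterate_injOn_Iio_minimalPeriod hi hj h

lemma cycleSize_eq_minimalPeriod (τ : Perm X) (x : X) :
    cycleSize τ x = Function.minimalPeriod τ x := by
  rw [cycleSize, filter_sameCycle_eq_image, card_image_of_injOn (pow_injOn τ x), card_range]

lemma pow_inj_of_lt {τ : Perm X} {x : X} {i j : ℕ} (hi : i < cycleSize τ x)
    (hj : j < cycleSize τ x) (h : (τ ^ i) x = (τ ^ j) x) : i = j := by
  rw [cycleSize_eq_minimalPeriod] at hi hj
  exact pow_injOn τ x (by simpa using hi) (by simpa using hj) h

lemma exists_pow_of_sameCycle {τ : Perm X} {x y : X} (h : SameCycle τ x y) :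
    ∃ i < cycleSize τ x, (τ ^ i) x = y := by
  have : y ∈ (univ.filter fun y => SameCycle τ x y) := by simpa using h
  rw [filter_sameCycle_eq_image] at this
  rw [cycleSize_eq_minimalPeriod]
  simpa using this

lemma sameCycle_pow (τ : Perm X) (x : X) (i : ℕ) : SameCycle τ x ((τ ^ i) x) := ⟨i, by simp⟩

/-- Cutting the cycle of `s` at `τ ^ j s` leaves the cycle `(s, τ s, …, τ ^ (j - 1) s)`. -/
lemma filter_sameCycle_cut {τ : Perm X} {s : X} {j : ℕ} (hj0 : 0 < j) (hj : j < cycleSize τ s) :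
    (univ.filter fun y => SameCycle (swap ((τ ^ j) s) s * τ) s y) =
      (range j).image fun i => (τ ^ i) s := by
  have step : ∀ i, i + 1 < j → (swap ((τ ^ j) s) s * τ) ((τ ^ i) s) = (τ ^ (i + 1)) s := by
    intro i hi
    rw [Perm.mul_apply, ← Perm.mul_apply τ, ← pow_succ', swap_apply_of_ne_of_ne]
    · intro e
      have := pow_inj_of_lt (by omega) hj e
      omega
    · intro e
      have := pow_inj_of_lt (j := 0) (by omega) (by omega) (e.trans (by simp))
      omega
  have last : (swap ((τ ^ j) s) s * τ) ((τ ^ (j - 1)) s) = s := by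
    rw [Perm.mul_apply, ← Perm.mul_apply τ, ← pow_succ', Nat.sub_add_cancel hj0, swap_apply_left]
  ext y
  simp only [mem_filter, mem_univ, true_and]
  constructor
  · intro h
    refine mem_of_sameCycle (P := {y | y ∈ (range j).image fun i => (τ ^ i) s}) ?_ h ?_
    · intro x hx
      simp only [Set.mem_ofPred_eq, mem_image, mem_range] at hx ⊢
      obtain ⟨i, hi, rfl⟩ := hx
      rcases Nat.lt_or_ge (i + 1) j with h1 | h1
      · exact ⟨i + 1, h1, (step i h1).symm⟩
      · obtain rfl : i = j - 1 := by omega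
        exact ⟨0, hj0, by rw [last]; simp⟩
    · simp only [Set.mem_ofPred_eq, mem_image, mem_range]
      exact ⟨0, hj0, by simp⟩
  · intro h
    simp only [mem_image, mem_range] at h
    obtain ⟨i, hi, rfl⟩ := h
    induction i with
    | zero => exact SameCycle.refl _ _
    | succ i ih =>
      rw [← step i hi]
      exact (ih (by omega)).trans (sameCycle_apply _ _)

lemma cycleSize_cut {τ : Perm X} {s : X} {j : ℕ} (hj0 : 0 < j) (hj : j < cycleSize τ s) :
    cycleSize (swap ((τ ^ j) s) s * τ) s = j := by
  rw [cycleSize, filter_sameCycle_cut hj0 hj, card_image_of_injOn, card_range]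
  intro i hi k hk h
  simp only [coe_range, Set.mem_Iio] at hi hk
  exact pow_inj_of_lt (by omega) (by omega) h

lemma not_sameCycle_cut {τ : Perm X} {s : X} {j : ℕ} (hj0 : 0 < j) (hj : j < cycleSize τ s) :
    ¬ SameCycle (swap ((τ ^ j) s) s * τ) ((τ ^ j) s) s := by
  intro h
  have : (τ ^ j) s ∈ univ.filter fun y => SameCycle (swap ((τ ^ j) s) s * τ) s y := by
    simpa using h.symm
  rw [filter_sameCycle_cut hj0 hj] at this
  simp only [mem_image, mem_range] at this
  obtain ⟨i, hi, e⟩ := this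
  have := pow_inj_of_lt (by omega) hj e
  omega

end CycleSize

/-! ### Cycle labellings -/

section Labellings

variable {X : Type*} [Fintype X] [DecidableEq X] {ι : Type*} [Fintype ι]

/-- `lab` labels the cycles of `τ` in such a way that cycle `i` has `len i` points. In contrast to
`IsCycleLabelling`, a label `i` with `len i = 0` is allowed: it is not used. -/
structure IsLab (τ : Perm X) (len : ι → ℕ) (lab : X → ι) : Prop where
  same_iff : ∀ x y, lab x = lab y ↔ SameCycle τ x y
  card_eq : ∀ i, (univ.filter fun x => lab x = i).card = len i

lemma IsLab.len_ne_zero {τ : Perm X} {len : ι → ℕ} {lab : X → ι} (h : IsLab τ len lab) (x : X) :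
    len (lab x) ≠ 0 := by
  rw [← h.card_eq, Finset.card_ne_zero]
  exact ⟨x, by simp⟩

lemma IsLab.len_eq_cycleSize {τ : Perm X} {len : ι → ℕ} {lab : X → ι} (h : IsLab τ len lab)
    (x : X) : len (lab x) = cycleSize τ x := by
  rw [← h.card_eq, cycleSize]
  congr 1
  ext y
  simp only [mem_filter, mem_univ, true_and, ← h.same_iff]
  exact eq_comm

/-- The lengths after the cycle with label `b` has been absorbed by the cycle with label `i₀`. -/
noncomputable def mergeLen (len : ι → ℕ) (i₀ b : ι) : ι → ℕ :=
  Function.update (Function.update len i₀ (len i₀ + len b)) b 0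

/-- Labellings before and after the cycles of `r` and `s` are joined correspond to each other. -/
lemma card_labellings_join {τ : Perm X} {r s : X} (h : ¬ SameCycle τ r s) {i₀ b : ι} (hb : i₀ ≠ b)
    {len : ι → ℕ} (hs : cycleSize τ s = len i₀) :
    (univ.filter fun lab : X → ι => IsLab τ len lab ∧ lab s = i₀ ∧ lab r = b).card =
      (univ.filter fun lab : X → ι =>
        IsLab (swap r s * τ) (mergeLen len i₀ b) lab ∧ lab s = i₀).card := by
  have hJ := sameCycle_swap_mul_iff h
  have hrs : SameCycle (swap r s * τ) r s := sameCycle_swap_mul_of_not h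
  refine card_bij' (fun lab _ x => if lab x = b then i₀ else lab x)
    (fun lab _ x => if SameCycle τ r x then b else lab x) ?_ ?_ ?_ ?_
  · intro lab hlab
    simp only [mem_filter, mem_univ, true_and] at hlab ⊢
    obtain ⟨hl, ls, lr⟩ := hlab
    refine ⟨⟨?_, ?_⟩, by simp [ls]⟩
    · intro x y
      rw [hJ, ← hl.same_iff, ← hl.same_iff, ← hl.same_iff, ← hl.same_iff, ← hl.same_iff, ls, lr]
      grind
    · intro i
      unfold mergeLen
      rcases eq_or_ne i b with rfl | hib
      · rw [Function.update_self, Finset.card_eq_zero, filter_eq_empty_iff]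
        intro x _
        split_ifs with h1 <;> grind
      · rw [Function.update_of_ne hib]
        rcases eq_or_ne i i₀ with rfl | hi0
        · rw [Function.update_self, ← hl.card_eq, ← hl.card_eq, ← card_union_of_disjoint]
          · congr 1
            ext x
            simp only [mem_filter, mem_univ, true_and, mem_union]
            grind
          · rw [disjoint_filter]; grind
        · rw [Function.update_of_ne hi0, ← hl.card_eq]
          congr 1
          ext x
          simp only [mem_filter, mem_univ, true_and]
          grind
  · intro lab hlab
    simp only [mem_filter, mem_univ, true_and] at hlab ⊢
    obtain ⟨hl, ls⟩ := hlab
    have hnb : ∀ x, lab x ≠ b := by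
      intro x hx
      apply hl.len_ne_zero x
      rw [hx, mergeLen, Function.update_self]
    have hP : ∀ x, SameCycle τ r x → lab x = i₀ := by
      intro x hx
      rw [← ls, hl.same_iff]
      exact (sameCycle_swap_mul_mono hrs hx).symm.trans hrs
    have hS : ∀ x, (lab x = i₀ ∧ ¬ SameCycle τ r x) ↔ SameCycle τ s x := by
      intro x
      constructor
      · rintro ⟨h1, h2⟩
        rw [← ls, hl.same_iff, hJ] at h1
        rcases h1 with h1 | ⟨h1, -⟩ | ⟨h1, -⟩
        · exact h1.symm
        · exact absurd h1.symm h2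
        · exact h1.symm
      · intro h1
        refine ⟨?_, fun h2 => h (h2.trans h1.symm)⟩
        rw [← ls, hl.same_iff, hJ]
        exact Or.inl h1.symm
    have hcs : (univ.filter fun x => lab x = i₀ ∧ ¬ SameCycle τ r x).card = len i₀ := by
      rw [← hs, cycleSize]; congr 1; ext x; simp [hS]
    have htot : (univ.filter fun x => lab x = i₀).card = len i₀ + len b := by
      rw [hl.card_eq, mergeLen, Function.update_of_ne hb, Function.update_self]
    refine ⟨⟨?_, ?_⟩, ?_, if_pos (SameCycle.refl _ _)⟩
    · intro x y
      by_cases hx : SameCycle τ r x <;> by_cases hy : SameCycle τ r y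
      · simp only [hx, hy, if_true, true_iff]; exact hx.symm.trans hy
      · simp only [hx, hy, if_true, if_false]
        exact ⟨fun e => absurd e.symm (hnb y), fun e => absurd (hx.trans e) hy⟩
      · simp only [hx, hy, if_true, if_false]
        exact ⟨fun e => absurd e (hnb x), fun e => absurd (hy.trans e.symm) hx⟩
      · simp only [hx, hy, if_false]
        rw [hl.same_iff, hJ]
        refine ⟨?_, Or.inl⟩
        rintro (h1 | ⟨h1, -⟩ | ⟨-, h1⟩)
        · exact h1
        · exact absurd h1.symm hx
        · exact absurd h1 hy
    · intro i
      rcases eq_or_ne i b with rfl | hib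
      · have h1 := card_filter_add_card_filter_not (s := univ.filter fun x => lab x = i₀)
          (fun x => SameCycle τ r x)
        rw [filter_filter, filter_filter, hcs, htot] at h1
        have h2 : (univ.filter fun x => (if SameCycle τ r x then i else lab x) = i) =
            univ.filter fun x => lab x = i₀ ∧ SameCycle τ r x := by
          ext x
          simp only [mem_filter, mem_univ, true_and]
          have := hnb x
          have := hP x
          grind
        rw [h2]; omega
      · rcases eq_or_ne i i₀ with rfl | hi0
        · rw [← hcs]
          congr 1
          ext x
          simp only [mem_filter, mem_univ, true_and]
          grind
        · have h3 := hl.card_eq i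
          rw [mergeLen, Function.update_of_ne hib, Function.update_of_ne hi0] at h3
          rw [← h3]
          congr 1
          ext x
          simp only [mem_filter, mem_univ, true_and]
          have := hP x
          grind
    · have : ¬ SameCycle τ r s := h
      simp [this, ls]
  · intro lab hlab
    simp only [mem_filter, mem_univ, true_and] at hlab
    obtain ⟨hl, ls, lr⟩ := hlab
    funext x
    have := hl.same_iff r x
    grind
  · intro lab hlab
    simp only [mem_filter, mem_univ, true_and] at hlab
    obtain ⟨hl, ls⟩ := hlab
    funext x
    have hnb : lab x ≠ b := by
      intro hx
      apply hl.len_ne_zero x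
      rw [hx, mergeLen, Function.update_self]
    have hP : SameCycle τ r x → lab x = i₀ := by
      intro hx
      rw [← ls, hl.same_iff]
      exact (sameCycle_swap_mul_mono hrs hx).symm.trans hrs
    grind

/-- There is no labelling that gives `s` a label of the wrong length; this leaves a single term in
sums over the possible lengths. -/
lemma card_labellings_eq_zero {τ : Perm X} {s : X} {i₀ : ι} {len : ι → ℕ}
    (Q : (X → ι) → Prop) (hs : cycleSize τ s ≠ len i₀) :
    (univ.filter fun lab : X → ι => IsLab τ len lab ∧ lab s = i₀ ∧ Q lab).card = 0 := by
  rw [Finset.card_eq_zero, filter_eq_empty_iff]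
  rintro lab - ⟨h1, h2, -⟩
  rw [← h1.len_eq_cycleSize, h2] at hs
  exact hs rfl

end Labellings

section CutJoinLabellings

variable {X : Type*} [Fintype X] [DecidableEq X] {ι : Type*} [Fintype ι]

/-- The lengths after the cycle with label `i₀` has been cut into a cycle of length `α`, which keeps
the label, and a cycle of length `β`, which receives the so far unused label `b`. -/
noncomputable def splitLen (len : ι → ℕ) (i₀ b : ι) (q : ℕ × ℕ) : ι → ℕ :=
  Function.update (Function.update len i₀ q.1) b q.2

lemma splitLen_left (len : ι → ℕ) {i₀ b : ι} (hb : i₀ ≠ b) (q : ℕ × ℕ) :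
    splitLen len i₀ b q i₀ = q.1 := by
  rw [splitLen, Function.update_of_ne hb, Function.update_self]

lemma mergeLen_splitLen {len : ι → ℕ} {i₀ b : ι} (hb : i₀ ≠ b) (hlen : len b = 0) {q : ℕ × ℕ}
    (hq : q.1 + q.2 = len i₀) : mergeLen (splitLen len i₀ b q) i₀ b = len := by
  funext i
  unfold mergeLen splitLen
  rcases eq_or_ne i b with rfl | h1
  · simp [hlen]
  · rcases eq_or_ne i i₀ with rfl | h2
    · simp [h1, hq]
    · simp [h1, h2]

lemma mem_splittings {n : ℕ} {q : ℕ × ℕ} :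
    q ∈ splittings n ↔ q.1 + q.2 = n ∧ 0 < q.1 ∧ 0 < q.2 := by
  simp [splittings]

lemma cycleSize_pos (τ : Perm X) (x : X) : 0 < cycleSize τ x := by
  rw [cycleSize, Finset.card_pos]
  exact ⟨x, by simp [SameCycle.refl]⟩

/-- Labellings after two cycles have been joined: such a labelling arises from a labelling before
the joining, in which the cycle of `r` has the spare label `b`, and from exactly one splitting of
the length of the joined cycle, the one that the two cycles prescribe. -/
lemma card_labellings_swap_of_not_sameCycle {τ : Perm X} {r s : X} (h : ¬ SameCycle τ r s)
    {i₀ b : ι} (hb : i₀ ≠ b) {len : ι → ℕ} (hlen : len b = 0) :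
    (univ.filter fun lab : X → ι => IsLab (swap r s * τ) len lab ∧ lab s = i₀).card =
      ∑ q ∈ splittings (len i₀), (univ.filter fun lab : X → ι =>
        IsLab τ (splitLen len i₀ b q) lab ∧ lab s = i₀ ∧ lab r = b).card := by
  have hz : ∀ q ∈ splittings (len i₀), q.1 ≠ cycleSize τ s →
      (univ.filter fun lab : X → ι =>
        IsLab τ (splitLen len i₀ b q) lab ∧ lab s = i₀ ∧ lab r = b).card = 0 := by
    intro q _ hq
    apply card_labellings_eq_zero (Q := fun lab => lab r = b)
    rw [splitLen_left _ hb]; exact hq.symm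
  by_cases hc : cycleSize τ s < len i₀
  · rw [Finset.sum_eq_single (cycleSize τ s, len i₀ - cycleSize τ s)]
    · rw [card_labellings_join h hb, mergeLen_splitLen hb hlen]
      · simp; omega
      · rw [splitLen_left _ hb]
    · rintro ⟨q1, q2⟩ hq hne
      apply hz _ hq
      rintro rfl
      rw [mem_splittings] at hq
      apply hne
      ext
      · rfl
      · simp; omega
    · intro hn
      exfalso
      apply hn
      rw [mem_splittings]
      have := cycleSize_pos τ s
      refine ⟨?_, ?_, ?_⟩ <;> simp <;> omega
  · rw [Finset.sum_eq_zero, Finset.card_eq_zero, filter_eq_empty_iff]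
    · rintro lab - ⟨hl, ls⟩
      -- the joined cycle is longer than the cycle of `s`
      have h1 := hl.len_eq_cycleSize s
      rw [ls] at h1
      apply hc
      rw [h1, cycleSize, cycleSize]
      apply Finset.card_lt_card
      rw [Finset.ssubset_iff_of_subset]
      · refine ⟨r, ?_, ?_⟩
        · simpa using (sameCycle_swap_mul_of_not h).symm
        · simpa using fun h' : SameCycle τ s r => h h'.symm
      · intro x hx
        simp only [mem_filter, mem_univ, true_and] at hx ⊢
        rw [sameCycle_swap_mul_iff h]
        exact Or.inl hx
    · intro q hq
      apply hz q hq
      rw [mem_splittings] at hq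
      omega

/-- Labellings after a cycle has been cut, summed over the points `r < s` of the cycle of `s`. The
`q` points `s, …, t` stay together, hence the condition on the length of their cycle; the cut
piece has a label `i`, whose length determines `r`. -/
lemma sum_card_labellings_cut {X : Type*} [Fintype X] [LinearOrder X] {τ : Perm X}
    {s t : X} {q : ℕ} (hq0 : 0 < q)
    (hq1 : ∀ i < q, s ≤ (τ ^ i) s) (hq2 : ∀ x, s ≤ x → ∃ i < q, (τ ^ i) s = x)
    (ht : t = (τ ^ (q - 1)) s) (i₀ : ι) (len : ι → ℕ) :
    ∑ r ∈ univ.filter (fun r => r < s ∧ SameCycle τ r s),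
        (univ.filter fun lab : X → ι => IsLab (swap r s * τ) len lab ∧ lab t = i₀).card =
      if q ≤ len i₀ then ∑ i ∈ univ.filter (fun i => i ≠ i₀ ∧ len i ≠ 0),
        (univ.filter fun lab : X → ι => IsLab τ (mergeLen len i₀ i) lab ∧ lab t = i₀).card
      else 0 := by
  set F := univ.filter (fun i => i ≠ i₀ ∧ len i ≠ 0)
  set W : ι → ℕ := fun i =>
    (univ.filter fun lab : X → ι => IsLab τ (mergeLen len i₀ i) lab ∧ lab s = i₀).card with hW
  have hst : SameCycle τ t s := by rw [ht]; exact (sameCycle_pow τ s _).symm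
  have hWt : ∀ i, (univ.filter fun lab : X → ι =>
      IsLab τ (mergeLen len i₀ i) lab ∧ lab t = i₀).card = W i := by
    intro i
    rw [hW]
    congr 1
    ext lab
    simp only [mem_filter, mem_univ, true_and, and_congr_right_iff]
    intro hl
    rw [(hl.same_iff t s).2 hst]
  simp only [hWt]
  have hr : ∀ r ∈ univ.filter (fun r => r < s ∧ SameCycle τ r s),
      ∃ j, q ≤ j ∧ j < cycleSize τ s ∧ r = (τ ^ j) s := by
    intro r hr
    simp only [mem_filter, mem_univ, true_and] at hr
    obtain ⟨j, hj, rfl⟩ := exists_pow_of_sameCycle hr.2.symm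
    refine ⟨j, ?_, hj, rfl⟩
    by_contra h
    exact absurd (hq1 j (by omega)) (not_le.2 hr.1)
  have h1 : ∀ r ∈ univ.filter (fun r => r < s ∧ SameCycle τ r s),
      (univ.filter fun lab : X → ι => IsLab (swap r s * τ) len lab ∧ lab t = i₀).card =
        ∑ i ∈ F, if cycleSize (swap r s * τ) s = len i₀ then W i else 0 := by
    intro r hr'
    obtain ⟨j, hqj, hjc, rfl⟩ := hr r hr'
    have hj0 : 0 < j := by omega
    have hns := not_sameCycle_cut hj0 hjc
    have hts : SameCycle (swap ((τ ^ j) s) s * τ) s t := by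
      have : t ∈ univ.filter fun y => SameCycle (swap ((τ ^ j) s) s * τ) s y := by
        rw [filter_sameCycle_cut hj0 hjc, ht]
        exact mem_image_of_mem _ (by simp; omega)
      simpa using this
    rw [Finset.card_eq_sum_card_fiberwise (f := fun lab => lab ((τ ^ j) s)) (t := F)]
    · apply Finset.sum_congr rfl
      intro i hi
      simp only [F, mem_filter, mem_univ, true_and] at hi
      have e1 : (univ.filter fun lab : X → ι => IsLab (swap ((τ ^ j) s) s * τ) len lab ∧
          lab t = i₀).filter (fun lab => lab ((τ ^ j) s) = i) =
          univ.filter fun lab : X → ι => IsLab (swap ((τ ^ j) s) s * τ) len lab ∧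
          lab s = i₀ ∧ lab ((τ ^ j) s) = i := by
        ext lab
        simp only [mem_filter, mem_univ, true_and, and_assoc, and_congr_right_iff]
        intro hl
        rw [(hl.same_iff s t).2 hts]
      rw [e1]
      split_ifs with hs
      · rw [card_labellings_join hns (Ne.symm hi.1) hs, ← mul_assoc, swap_mul_self, one_mul]
      · exact card_labellings_eq_zero (Q := fun lab => lab ((τ ^ j) s) = i) hs
    · intro lab hlab
      simp only [coe_filter, mem_univ, true_and, Set.mem_ofPred_eq] at hlab
      obtain ⟨hl, hlt⟩ := hlab
      simp only [F, coe_filter, mem_univ, true_and, Set.mem_ofPred_eq]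
      refine ⟨fun e => hns ?_, hl.len_ne_zero _⟩
      rw [← hl.same_iff, e, ← hlt, hl.same_iff]
      exact hts.symm
  rw [Finset.sum_congr rfl h1, Finset.sum_comm]
  have h2 : ∀ i ∈ F, (∑ r ∈ univ.filter (fun r => r < s ∧ SameCycle τ r s),
      if cycleSize (swap r s * τ) s = len i₀ then W i else 0) =
        if q ≤ len i₀ then W i else 0 := by
    intro i hi
    simp only [F, mem_filter, mem_univ, true_and] at hi
    rcases Nat.eq_zero_or_pos (W i) with h0 | h0
    · simp [h0]
    · rw [hW] at h0
      obtain ⟨lab, hlab⟩ := Finset.card_pos.1 h0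
      simp only [mem_filter, mem_univ, true_and] at hlab
      have hc := hlab.1.len_eq_cycleSize s
      rw [hlab.2, mergeLen, Function.update_of_ne hi.1.symm, Function.update_self] at hc
      split_ifs with hq
      · rw [Finset.sum_eq_single ((τ ^ (len i₀)) s), if_pos (cycleSize_cut (by omega) (by omega))]
        · intro r hr' hne
          obtain ⟨j, hqj, hjc, rfl⟩ := hr r hr'
          rw [if_neg]
          rw [cycleSize_cut (by omega) hjc]
          rintro rfl
          exact hne rfl
        · intro hn
          exfalso
          apply hn
          simp only [mem_filter, mem_univ, true_and]
          refine ⟨?_, (sameCycle_pow τ s _).symm⟩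
          by_contra hle
          obtain ⟨k, hk, e⟩ := hq2 _ (not_lt.1 hle)
          have := pow_inj_of_lt (by omega) (by omega) e
          omega
      · apply Finset.sum_eq_zero
        intro r hr'
        obtain ⟨j, hqj, hjc, rfl⟩ := hr r hr'
        rw [if_neg]
        rw [cycleSize_cut (by omega) hjc]
        omega
  rw [Finset.sum_congr rfl h2]
  split_ifs <;> simp

end CutJoinLabellings

/-! ### Monotone words and connectedness -/

section Words

/-- A monotone sequence of transpositions `(r₁ s₁), …, (r_m s_m)` is encoded by the reversed word
`[(r_m, s_m), …, (r₁, s₁)]`, so that the last transposition is the head of the word. -/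
def IsMonoWord {X : Type*} [LinearOrder X] (L : List (X × X)) : Prop :=
  (∀ p ∈ L, p.1 < p.2) ∧ L.Pairwise fun p q => q.2 ≤ p.2

/-- The monotone words of length `m`. -/
noncomputable def monoWords (X : Type*) [Fintype X] [LinearOrder X] (m : ℕ) :
    Finset (List (X × X)) :=
  ((List.finite_length_eq (X × X) m).subset
    (fun _ h => h.1 : {L | L.length = m ∧ IsMonoWord L} ⊆ _)).toFinset

lemma mem_monoWords {X : Type*} [Fintype X] [LinearOrder X] {m : ℕ} {L : List (X × X)} :
    L ∈ monoWords X m ↔ L.length = m ∧ IsMonoWord L := by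
  simp [monoWords]

lemma isMonoWord_nil {X : Type*} [LinearOrder X] : IsMonoWord ([] : List (X × X)) := by
  simp [IsMonoWord]

lemma isMonoWord_cons {X : Type*} [LinearOrder X] {p : X × X} {L : List (X × X)} :
    IsMonoWord (p :: L) ↔ p.1 < p.2 ∧ (∀ q ∈ L, q.2 ≤ p.2) ∧ IsMonoWord L := by
  simp only [IsMonoWord, List.forall_mem_cons, List.pairwise_cons]
  tauto

variable {X : Type*}

/-- The product of the transpositions of a word, as an element of the symmetric group. -/
def wordPerm [DecidableEq X] (L : List (X × X)) : Perm X := (L.map fun p => swap p.1 p.2).prod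

@[simp] lemma wordPerm_nil [DecidableEq X] : wordPerm ([] : List (X × X)) = 1 := rfl

@[simp] lemma wordPerm_cons [DecidableEq X] (p : X × X) (L : List (X × X)) :
    wordPerm (p :: L) = swap p.1 p.2 * wordPerm L := by
  simp [wordPerm]

/-- A monotone word does not move the points beyond its larger entries. -/
lemma wordPerm_apply_of_lt [LinearOrder X] {L : List (X × X)} {s x : X} (hL : IsMonoWord L)
    (hs : ∀ p ∈ L, p.2 ≤ s) (hx : s < x) : wordPerm L x = x := by
  induction L with
  | nil => simp
  | cons p L ih =>
    rw [isMonoWord_cons] at hL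
    simp only [List.forall_mem_cons] at hs
    rw [wordPerm_cons, Perm.mul_apply, ih hL.2.2 hs.2]
    have := hs.1.trans_lt hx
    exact swap_apply_of_ne_of_ne (hL.1.trans this).ne' this.ne'

/-- The set `P` is a union of orbits of the group generated by `σ₀` and the transpositions of the
word `L`. -/
def IsInv (σ₀ : Perm X) (L : List (X × X)) (P : Set X) : Prop :=
  (∀ x, σ₀ x ∈ P ↔ x ∈ P) ∧ ∀ p ∈ L, (p.1 ∈ P ↔ p.2 ∈ P)

/-- The points `x` and `y` lie in the same orbit of the group generated by `σ₀` and the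
transpositions of the word `L`; this is expressed through the unions of orbits. -/
def Linked (σ₀ : Perm X) (L : List (X × X)) (x y : X) : Prop :=
  ∀ P : Set X, IsInv σ₀ L P → (x ∈ P ↔ y ∈ P)

/-- The group generated by `σ₀` and the transpositions of the word `L` is transitive. -/
def Connected (σ₀ : Perm X) (L : List (X × X)) : Prop := ∀ x y, Linked σ₀ L x y

variable {σ₀ : Perm X} {L : List (X × X)} {x y z r s : X}

lemma isInv_cons {p : X × X} {P : Set X} :
    IsInv σ₀ (p :: L) P ↔ (p.1 ∈ P ↔ p.2 ∈ P) ∧ IsInv σ₀ L P := by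
  simp only [IsInv, List.forall_mem_cons]; tauto

lemma Linked.refl : Linked σ₀ L x x := fun _ _ => Iff.rfl
lemma Linked.symm (h : Linked σ₀ L x y) : Linked σ₀ L y x := fun P hP => (h P hP).symm
lemma Linked.trans (h : Linked σ₀ L x y) (h' : Linked σ₀ L y z) : Linked σ₀ L x z :=
  fun P hP => (h P hP).trans (h' P hP)

lemma isInv_linked : IsInv σ₀ L {y | Linked σ₀ L x y} :=
  ⟨fun y => ⟨fun h => h.trans fun _ hP => hP.1 y, fun h => h.trans fun _ hP => (hP.1 y).symm⟩,
    fun p hp => ⟨fun h => h.trans fun _ hP => hP.2 p hp,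
      fun h => h.trans fun _ hP => (hP.2 p hp).symm⟩⟩

lemma Linked.cons (h : Linked σ₀ L x y) (p : X × X) : Linked σ₀ (p :: L) x y :=
  fun P hP => h P (isInv_cons.1 hP).2

lemma Connected.cons (h : Connected σ₀ L) (p : X × X) : Connected σ₀ (p :: L) :=
  fun x y => (h x y).cons p

lemma connected_cons_of_linked (h : Linked σ₀ L r s) :
    Connected σ₀ ((r, s) :: L) ↔ Connected σ₀ L :=
  ⟨fun hc x y P hP => hc x y P (isInv_cons.2 ⟨h P hP, hP⟩), fun hc => hc.cons _⟩

/-- A letter `(r, s)` makes a word transitive if and only if the orbits of `r` and `s` exhaust all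
the points. -/
lemma connected_cons_iff :
    Connected σ₀ ((r, s) :: L) ↔ ∀ x, Linked σ₀ L r x ∨ Linked σ₀ L s x := by
  have hrs : Linked σ₀ ((r, s) :: L) r s := fun P hP => (isInv_cons.1 hP).1
  constructor
  · intro h x
    have h1 : IsInv σ₀ L {y | Linked σ₀ L r y ∨ Linked σ₀ L s y} := by
      have a := isInv_linked (σ₀ := σ₀) (L := L) (x := r)
      have b := isInv_linked (σ₀ := σ₀) (L := L) (x := s)
      exact ⟨fun x => or_congr (a.1 x) (b.1 x), fun p hp => or_congr (a.2 p hp) (b.2 p hp)⟩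
    exact (h r x _ (isInv_cons.2 ⟨by simp [Linked.refl], h1⟩)).1 (Or.inl Linked.refl)
  · intro h
    have key : ∀ x, Linked σ₀ ((r, s) :: L) r x := fun x =>
      (h x).elim (fun h => h.cons _) fun h => hrs.trans (h.cons _)
    exact fun x y => (key x).symm.trans (key y)

lemma IsInv.wordPerm_mul [DecidableEq X] {P : Set X} (hP : IsInv σ₀ L P) (x : X) :
    (wordPerm L * σ₀) x ∈ P ↔ x ∈ P := by
  induction L with
  | nil => simpa using hP.1 x
  | cons p L ih =>
    rw [isInv_cons] at hP
    rw [← ih hP.2, wordPerm_cons, mul_assoc, Perm.mul_apply (swap _ _)]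
    rcases eq_or_ne ((wordPerm L * σ₀) x) p.1 with e | e
    · rw [e, swap_apply_left]; exact hP.1.symm
    · rcases eq_or_ne ((wordPerm L * σ₀) x) p.2 with e' | e'
      · rw [e', swap_apply_right]; exact hP.1
      · rw [swap_apply_of_ne_of_ne e e']

lemma linked_of_sameCycle [Finite X] [DecidableEq X] (h : SameCycle (wordPerm L * σ₀) x y) :
    Linked σ₀ L x y := by
  intro P hP
  exact ⟨mem_of_sameCycle (fun z hz => (hP.wordPerm_mul z).2 hz) h,
    mem_of_sameCycle (fun z hz => (hP.wordPerm_mul z).2 hz) h.symm⟩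

end Words

/-! ### Counting factorisations and removing the last transposition -/

section Count

variable {X : Type*} [Fintype X] [LinearOrder X] {ι : Type*} [Fintype ι]

/-- The number of pairs of a monotone word `L` of length `m` that is transitive together with `σ₀`
and a labelling of the cycles of the product with lengths `len`, subject to the condition `Q`. -/
noncomputable def countWith (σ₀ : Perm X) (m : ℕ) (len : ι → ℕ)
    (Q : List (X × X) → (X → ι) → Prop) : ℕ :=
  ((monoWords X m ×ˢ (univ : Finset (X → ι))).filter fun z =>
    Connected σ₀ z.1 ∧ IsLab (wordPerm z.1 * σ₀) len z.2 ∧ Q z.1 z.2).card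

/-- The analogue of `countWith` for words that are not transitive together with `σ₀`, but become so
when a transposition exchanging `s` and a point with label `b` is added. -/
noncomputable def countSplit (σ₀ : Perm X) (s : X) (b : ι) (m : ℕ) (len : ι → ℕ)
    (Q : List (X × X) → (X → ι) → Prop) : ℕ :=
  ((monoWords X m ×ˢ (univ : Finset (X → ι))).filter fun z =>
    (¬ Connected σ₀ z.1 ∧ ∀ r, z.2 r = b → Connected σ₀ ((r, s) :: z.1)) ∧
      IsLab (wordPerm z.1 * σ₀) len z.2 ∧ Q z.1 z.2).card

/-- The points `x ≥ s` are the `q` points `s, σ₀ s, …, σ₀ ^ (q - 1) s = t`, and those after `s` are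
greater than `s`. -/
structure IsTail (σ₀ : Perm X) (s t : X) (q : ℕ) : Prop where
  pos : 0 < q
  lt_pow : ∀ i < q, 0 < i → s < (σ₀ ^ i) s
  exists_pow : ∀ x, s ≤ x → ∃ i < q, (σ₀ ^ i) s = x
  top_eq : t = (σ₀ ^ (q - 1)) s

variable {σ₀ : Perm X} {s t : X} {q : ℕ}

/-- After `s`, the product of `σ₀` with a monotone word whose letters do not go beyond `s` follows
the cycle of `σ₀`. -/
lemma IsTail.wordPerm_pow (h : IsTail σ₀ s t q) {L : List (X × X)} (hL : IsMonoWord L)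
    (hs : ∀ p ∈ L, p.2 ≤ s) {i : ℕ} (hi : i < q) : ((wordPerm L * σ₀) ^ i) s = (σ₀ ^ i) s := by
  induction i with
  | zero => simp
  | succ i ih =>
    rw [pow_succ', Perm.mul_apply, ih (by omega), ← Perm.mul_apply, mul_assoc, ← pow_succ',
      Perm.mul_apply]
    exact wordPerm_apply_of_lt hL hs (h.lt_pow _ hi (by omega))

lemma card_filter_product {A B : Type*} {S : Finset A} {T : Finset B} {p : A × B → Prop}
    {_ : DecidablePred p} {c : A → Prop} {_ : DecidablePred c} {d : A → B → Prop}
    {_ : ∀ x, DecidablePred (d x)} (h : ∀ x ∈ S, ∀ y ∈ T, p (x, y) ↔ c x ∧ d x y) :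
    ((S ×ˢ T).filter p).card = ∑ x ∈ S.filter c, (T.filter (d x)).card := by
  rw [card_filter, sum_product, sum_filter]
  refine Finset.sum_congr rfl fun x hx => ?_
  rw [card_filter]
  split_ifs with hc
  · refine Finset.sum_congr rfl fun y hy => ?_
    simp [h x hx y hy, hc]
  · refine Finset.sum_eq_zero fun y hy => ?_
    simp [h x hx y hy, hc]

/-- Removing the last transposition `(r s)`: either `r` and `s` lie in the same cycle of the
remaining product, which is then cut by `(r s)`, or two cycles are joined, and these belong either
to one or to two orbits of the remaining permutations. -/
theorem countWith_succ (hT : IsTail σ₀ s t q) {i₀ b : ι} (hb : i₀ ≠ b) {len : ι → ℕ}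
    (hlen : len b = 0) (m : ℕ) :
    countWith σ₀ (m + 1) len (fun L lab => (∀ p ∈ L.head?, p.2 = s) ∧ lab t = i₀) =
      (if q ≤ len i₀ then ∑ i ∈ univ.filter (fun i => i ≠ i₀ ∧ len i ≠ 0),
        countWith σ₀ m (mergeLen len i₀ i) (fun L lab => (∀ p ∈ L, p.2 ≤ s) ∧ lab t = i₀) else 0) +
      ∑ c ∈ splittings (len i₀), c.2 *
        (countWith σ₀ m (splitLen len i₀ b c) (fun L lab => (∀ p ∈ L, p.2 ≤ s) ∧ lab t = i₀) +
         countSplit σ₀ s b m (splitLen len i₀ b c)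
          (fun L lab => (∀ p ∈ L, p.2 ≤ s) ∧ lab t = i₀)) := by
  set W := (monoWords X m).filter fun L => ∀ p ∈ L, p.2 ≤ s with hW
  -- everything is a sum over the remaining words
  have hcount : ∀ (len' : ι → ℕ), countWith σ₀ m len'
      (fun L lab => (∀ p ∈ L, p.2 ≤ s) ∧ lab t = i₀) = ∑ L ∈ W, if Connected σ₀ L then
        (univ.filter fun lab : X → ι => IsLab (wordPerm L * σ₀) len' lab ∧
          lab t = i₀).card else 0 := by
    intro len'
    rw [hW, ← sum_filter, filter_filter, countWith]
    exact card_filter_product fun _ _ _ => by tauto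
  have hsplit : ∀ (len' : ι → ℕ), countSplit σ₀ s b m len'
      (fun L lab => (∀ p ∈ L, p.2 ≤ s) ∧ lab t = i₀) = ∑ L ∈ W, if ¬ Connected σ₀ L then
        (univ.filter fun lab : X → ι => (∀ r, lab r = b → Connected σ₀ ((r, s) :: L)) ∧
          IsLab (wordPerm L * σ₀) len' lab ∧ lab t = i₀).card else 0 := by
    intro len'
    rw [hW, ← sum_filter, filter_filter, countSplit]
    exact card_filter_product fun _ _ _ => by tauto
  have hleft : countWith σ₀ (m + 1) len (fun L lab => (∀ p ∈ L.head?, p.2 = s) ∧ lab t = i₀) =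
      ∑ L ∈ W, ∑ r, if r < s ∧ Connected σ₀ ((r, s) :: L) then
        (univ.filter fun lab : X → ι =>
          IsLab (swap r s * (wordPerm L * σ₀)) len lab ∧ lab t = i₀).card else 0 := by
    have : ∀ L ∈ W, ∀ r : X, (if r < s ∧ Connected σ₀ ((r, s) :: L) then
        (univ.filter fun lab : X → ι =>
          IsLab (swap r s * (wordPerm L * σ₀)) len lab ∧ lab t = i₀).card else 0) =
        ∑ lab : X → ι, if r < s ∧ Connected σ₀ ((r, s) :: L) ∧
          IsLab (swap r s * (wordPerm L * σ₀)) len lab ∧ lab t = i₀ then 1 else 0 := by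
      intro L _ r
      rw [card_filter]
      by_cases h1 : r < s <;> by_cases h2 : Connected σ₀ ((r, s) :: L) <;> simp [h1, h2]
    rw [Finset.sum_congr rfl fun L hL => Finset.sum_congr rfl fun r _ => this L hL r]
    simp only [← sum_product']
    rw [← card_filter, countWith]
    symm
    refine card_bij (fun z _ => ((z.2.1, s) :: z.1, z.2.2)) ?_ ?_ ?_
    · rintro ⟨L, r, lab⟩ h
      simp only [mem_filter, mem_product, hW, mem_univ, and_true, mem_monoWords] at h ⊢
      obtain ⟨⟨⟨h1, h2⟩, h3⟩, h4, h5, h6, h7⟩ := h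
      refine ⟨⟨by simp [h1], isMonoWord_cons.2 ⟨h4, h3, h2⟩⟩, h5, ?_, by simp, h7⟩
      simpa [mul_assoc] using h6
    · rintro ⟨L, r, lab⟩ h ⟨L', r', lab'⟩ h' e
      simpa [and_comm, and_assoc, and_left_comm] using e
    · rintro ⟨L, lab⟩ h
      simp only [mem_filter, mem_product, mem_univ, and_true, mem_monoWords] at h
      obtain ⟨⟨h1, h2⟩, h5, h6, h7, h8⟩ := h
      cases L with
      | nil => simp at h1
      | cons p L =>
        obtain ⟨r, s'⟩ := p
        obtain rfl : s' = s := by simpa using h7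
        rw [isMonoWord_cons] at h2
        refine ⟨(L, r, lab), ?_, rfl⟩
        simp only [mem_filter, mem_product, hW, mem_univ, and_true, mem_monoWords]
        refine ⟨⟨⟨by simpa using h1, h2.2.2⟩, h2.2.1⟩, h2.1, h5, ?_, h8⟩
        simpa [mul_assoc] using h6
  rw [hleft]
  simp only [hcount, hsplit]
  have hrhs : ∀ (A : ι → List (X × X) → ℕ) (B : ℕ × ℕ → List (X × X) → ℕ)
      (C : ℕ × ℕ → List (X × X) → ℕ),
      (if q ≤ len i₀ then ∑ i ∈ univ.filter (fun i => i ≠ i₀ ∧ len i ≠ 0), ∑ L ∈ W, A i L else 0) +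
        ∑ c ∈ splittings (len i₀), c.2 * (∑ L ∈ W, B c L + ∑ L ∈ W, C c L) =
      ∑ L ∈ W, ((if q ≤ len i₀ then ∑ i ∈ univ.filter (fun i => i ≠ i₀ ∧ len i ≠ 0), A i L else 0)
        + ∑ c ∈ splittings (len i₀), c.2 * (B c L + C c L)) := by
    intro A B C
    rw [sum_add_distrib]
    congr 1
    · split_ifs
      · exact Finset.sum_comm
      · simp
    · rw [Finset.sum_comm]
      refine Finset.sum_congr rfl fun c _ => ?_
      rw [← Finset.mul_sum, sum_add_distrib]
  rw [hrhs]
  refine Finset.sum_congr rfl fun L hL => ?_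
  simp only [hW, mem_filter, mem_monoWords] at hL
  obtain ⟨⟨-, hL1⟩, hL2⟩ := hL
  set τ := wordPerm L * σ₀ with hτ
  have hpow : ∀ i < q, (τ ^ i) s = (σ₀ ^ i) s := fun i hi => hT.wordPerm_pow hL1 hL2 hi
  have hq2 : ∀ x, s ≤ x → ∃ i < q, (τ ^ i) s = x := by
    intro x hx
    obtain ⟨i, hi, e⟩ := hT.exists_pow x hx
    exact ⟨i, hi, (hpow i hi).trans e⟩
  have ht : t = (τ ^ (q - 1)) s := by
    rw [hpow _ (by have := hT.pos; omega)]; exact hT.top_eq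
  have hlt : ∀ r, ¬ SameCycle τ r s → r < s := by
    intro r hr
    by_contra h
    obtain ⟨i, hi, rfl⟩ := hq2 r (not_lt.1 h)
    exact hr (sameCycle_pow τ s i).symm
  have hst : SameCycle τ t s := by rw [ht]; exact (sameCycle_pow τ s _).symm
  rw [← Finset.sum_filter_add_sum_filter_not univ (fun r => SameCycle τ r s)]
  congr 1
  · have hcut := sum_card_labellings_cut (ι := ι) hT.pos (fun i hi => ?_) hq2 ht i₀ len
    · by_cases hc : Connected σ₀ L
      · simp only [hc, if_true]
        rw [← hcut, ← Finset.sum_filter, filter_filter]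
        refine Finset.sum_congr ?_ fun _ _ => rfl
        ext r
        simp only [mem_filter, mem_univ, true_and]
        exact ⟨fun h => ⟨h.2.1, h.1⟩, fun h => ⟨h.2, h.1, hc.cons _⟩⟩
      · simp only [hc, if_false, Finset.sum_const_zero, ite_self]
        refine Finset.sum_eq_zero fun r hr => ?_
        simp only [mem_filter, mem_univ, true_and] at hr
        rw [if_neg]
        rw [connected_cons_of_linked (linked_of_sameCycle hr)]
        exact fun h => hc h.2
    · rw [hpow i hi]
      rcases Nat.eq_zero_or_pos i with rfl | h0
      · simp
      · exact (hT.lt_pow i hi h0).le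
  · have h1 : ∀ r ∈ univ.filter (fun r => ¬ SameCycle τ r s),
        (if r < s ∧ Connected σ₀ ((r, s) :: L) then (univ.filter fun lab : X → ι =>
          IsLab (swap r s * τ) len lab ∧ lab t = i₀).card else 0) =
        ∑ c ∈ splittings (len i₀), ∑ lab ∈ univ.filter (fun lab : X → ι =>
          IsLab τ (splitLen len i₀ b c) lab ∧ lab s = i₀),
          if lab r = b ∧ Connected σ₀ ((r, s) :: L) then 1 else 0 := by
      intro r hr
      simp only [mem_filter, mem_univ, true_and] at hr
      by_cases hc : Connected σ₀ ((r, s) :: L)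
      · rw [if_pos ⟨hlt r hr, hc⟩]
        have e := card_labellings_swap_of_not_sameCycle hr hb hlen
        have e1 : (univ.filter fun lab : X → ι => IsLab (swap r s * τ) len lab ∧ lab t = i₀) =
            univ.filter fun lab : X → ι => IsLab (swap r s * τ) len lab ∧ lab s = i₀ := by
          ext lab
          simp only [mem_filter, mem_univ, true_and, and_congr_right_iff]
          intro hl
          rw [(hl.same_iff t s).2 (sameCycle_swap_mul_mono (sameCycle_swap_mul_of_not hr) hst)]
        rw [e1, e]
        refine Finset.sum_congr rfl fun c _ => ?_
        simp only [hc, and_true]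
        rw [← card_filter, filter_filter]
        simp only [and_assoc]
      · simp [hc]
    rw [Finset.sum_congr rfl h1, Finset.sum_comm]
    refine Finset.sum_congr rfl fun c hc => ?_
    rw [mem_splittings] at hc
    rw [Finset.sum_comm]
    have h2 : ∀ lab ∈ univ.filter (fun lab : X → ι =>
        IsLab τ (splitLen len i₀ b c) lab ∧ lab s = i₀),
        (∑ r ∈ univ.filter (fun r => ¬ SameCycle τ r s),
          if lab r = b ∧ Connected σ₀ ((r, s) :: L) then 1 else 0) =
        c.2 * ((if Connected σ₀ L then 1 else 0) + (if ¬ Connected σ₀ L ∧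
          (∀ r, lab r = b → Connected σ₀ ((r, s) :: L)) then 1 else 0)) := by
      intro lab hlab
      simp only [mem_filter, mem_univ, true_and] at hlab
      obtain ⟨hl, ls⟩ := hlab
      have hcb : (univ.filter fun r => lab r = b).card = c.2 := by
        rw [hl.card_eq, splitLen, Function.update_self]
      have hns : ∀ r, lab r = b → ¬ SameCycle τ r s := by
        intro r hr h
        rw [← hl.same_iff, hr, ls] at h
        exact hb h.symm
      rw [← card_filter, filter_filter]
      have hall : (∀ r, lab r = b → Connected σ₀ ((r, s) :: L)) →
          (univ.filter fun r => ¬ SameCycle τ r s ∧ lab r = b ∧ Connected σ₀ ((r, s) :: L)).card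
            = c.2 := by
        intro h
        rw [← hcb]
        congr 1
        ext r
        simp only [mem_filter, mem_univ, true_and]
        exact ⟨fun h => h.2.1, fun h' => ⟨hns r h', h', h r h'⟩⟩
      by_cases hC : Connected σ₀ L
      · rw [hall fun r _ => hC.cons _]
        simp [hC]
      · by_cases hA : ∀ r, lab r = b → Connected σ₀ ((r, s) :: L)
        · rw [hall hA]
          simp only [hC, if_false, not_false_eq_true, true_and, zero_add]
          rw [if_pos hA, mul_one]
        · simp only [hC, if_false, not_false_eq_true, true_and, zero_add]
          rw [if_neg hA, mul_zero, Finset.card_eq_zero, filter_eq_empty_iff]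
          rintro r - ⟨h3, h4, h5⟩
          apply hA
          intro r' hr'
          -- points with label `b` lie in one cycle, hence in one orbit
          have hl' : Linked σ₀ L r r' := by
            apply linked_of_sameCycle
            rw [← hl.same_iff, h4, hr']
          rw [connected_cons_iff] at h5 ⊢
          exact fun x => (h5 x).imp (fun h => hl'.symm.trans h) id
    rw [Finset.sum_congr rfl h2, ← Finset.mul_sum, sum_add_distrib]
    have e2 : ∀ lab : X → ι, IsLab τ (splitLen len i₀ b c) lab → (lab s = i₀ ↔ lab t = i₀) := by
      intro lab hl
      rw [(hl.same_iff t s).2 hst]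
    have e3 : (univ.filter (fun lab : X → ι =>
        IsLab τ (splitLen len i₀ b c) lab ∧ lab s = i₀)) = (univ.filter (fun lab : X → ι =>
        IsLab τ (splitLen len i₀ b c) lab ∧ lab t = i₀)) := by
      ext lab
      simp only [mem_filter, mem_univ, true_and, and_congr_right_iff]
      exact e2 lab
    rw [e3]
    congr 2
    · by_cases hC : Connected σ₀ L <;> simp [hC]
    · by_cases hC : Connected σ₀ L
      · simp [hC]
      · simp only [hC, not_false_eq_true, true_and, if_true]
        rw [← card_filter, filter_filter]
        congr 1
        ext lab
        simp only [mem_filter, mem_univ, true_and]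
        tauto

end Count

/-! ### Two orbits: merging and separating words -/

section Merging

variable {X Y₁ Y₂ : Type*} [LinearOrder X] [LinearOrder Y₁] [LinearOrder Y₂]

/-- A decomposition of `X` into the images of `f₁` and `f₂`, compatible with the orders and with the
permutations `σ₀`, `σ₁`, `σ₂`. -/
structure IsDecomposition (σ₀ : Perm X) (σ₁ : Perm Y₁) (σ₂ : Perm Y₂) (f₁ : Y₁ → X) (f₂ : Y₂ → X) :
    Prop where
  mono₁ : StrictMono f₁
  mono₂ : StrictMono f₂
  disj : ∀ y₁ y₂, f₁ y₁ ≠ f₂ y₂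
  cover : ∀ x, (∃ y, f₁ y = x) ∨ ∃ y, f₂ y = x
  comm₁ : ∀ y, σ₀ (f₁ y) = f₁ (σ₁ y)
  comm₂ : ∀ y, σ₀ (f₂ y) = f₂ (σ₂ y)

/-- The pair of points of `X` given by a pair of points of `Y₁` or a pair of points of `Y₂`. -/
def sumPair (f₁ : Y₁ → X) (f₂ : Y₂ → X) : (Y₁ × Y₁) ⊕ (Y₂ × Y₂) → X × X :=
  Sum.elim (Prod.map f₁ f₁) (Prod.map f₂ f₂)

/-- The subword of the letters of the first kind. -/
def lefts {A B : Type*} (M : List (A ⊕ B)) : List A := M.filterMap Sum.getLeft?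

/-- The subword of the letters of the second kind. -/
def rights {A B : Type*} (M : List (A ⊕ B)) : List B := M.filterMap Sum.getRight?

section
variable {A B : Type*} (a : A) (b : B) (M : List (A ⊕ B))
@[simp] lemma lefts_nil : lefts ([] : List (A ⊕ B)) = [] := rfl
@[simp] lemma rights_nil : rights ([] : List (A ⊕ B)) = [] := rfl
@[simp] lemma lefts_inl : lefts (Sum.inl a :: M) = a :: lefts M := by simp [lefts]
@[simp] lemma lefts_inr : lefts (Sum.inr b :: M) = lefts M := rfl
@[simp] lemma rights_inl : rights (Sum.inl a :: M) = rights M := rfl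
@[simp] lemma rights_inr : rights (Sum.inr b :: M) = b :: rights M := by simp [rights]

variable {a b M}
@[simp] lemma mem_lefts : a ∈ lefts M ↔ Sum.inl a ∈ M := by
  simp [lefts]
@[simp] lemma mem_rights : b ∈ rights M ↔ Sum.inr b ∈ M := by
  simp [rights]

lemma length_lefts_add_rights : (lefts M).length + (rights M).length = M.length := by
  induction M with
  | nil => rfl
  | cons z M ih =>
    cases z <;> simp <;> omega

lemma lefts_map_inl (l : List A) : lefts (l.map (Sum.inl : A → A ⊕ B)) = l := by
  induction l with
  | nil => rfl
  | cons a l ih => simp [ih]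

lemma rights_map_inl (l : List A) : rights (l.map (Sum.inl : A → A ⊕ B)) = [] := by
  induction l with
  | nil => rfl
  | cons a l ih => simp [ih]

lemma lefts_map_inr (l : List B) : lefts (l.map (Sum.inr : B → A ⊕ B)) = [] := by
  induction l with
  | nil => rfl
  | cons a l ih => simp [ih]

lemma rights_map_inr (l : List B) : rights (l.map (Sum.inr : B → A ⊕ B)) = l := by
  induction l with
  | nil => rfl
  | cons a l ih => simp [ih]
end

variable {σ₀ : Perm X} {σ₁ : Perm Y₁} {σ₂ : Perm Y₂} {f₁ : Y₁ → X} {f₂ : Y₂ → X}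

lemma isMonoWord_map_sumPair (h : IsDecomposition σ₀ σ₁ σ₂ f₁ f₂)
    (M : List ((Y₁ × Y₁) ⊕ (Y₂ × Y₂))) :
    IsMonoWord (M.map (sumPair f₁ f₂)) ↔ IsMonoWord (lefts M) ∧ IsMonoWord (rights M) ∧
      M.Pairwise fun z w => (sumPair f₁ f₂ w).2 ≤ (sumPair f₁ f₂ z).2 := by
  induction M with
  | nil => simp [isMonoWord_nil]
  | cons z M ih =>
    rw [List.map_cons, isMonoWord_cons, ih, List.pairwise_cons]
    cases z with
    | inl p =>
      simp only [lefts_inl, rights_inl, isMonoWord_cons, mem_lefts, List.mem_map]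
      have e1 : (sumPair f₁ f₂ (Sum.inl p)).1 < (sumPair f₁ f₂ (Sum.inl p)).2 ↔ p.1 < p.2 :=
        h.mono₁.lt_iff_lt
      rw [e1]
      constructor
      · rintro ⟨h1, h2, h3, h4, h5⟩
        refine ⟨⟨h1, ?_, h3⟩, h4, ?_, h5⟩
        · intro q hq
          exact h.mono₁.le_iff_le.1 (h2 _ ⟨_, hq, rfl⟩)
        · intro w hw
          exact h2 _ ⟨w, hw, rfl⟩
      · rintro ⟨⟨h1, -, h3⟩, h4, h6, h5⟩
        refine ⟨h1, ?_, h3, h4, h5⟩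
        rintro _ ⟨w, hw, rfl⟩
        exact h6 w hw
    | inr p =>
      simp only [lefts_inr, rights_inr, isMonoWord_cons, mem_rights, List.mem_map]
      have e1 : (sumPair f₁ f₂ (Sum.inr p)).1 < (sumPair f₁ f₂ (Sum.inr p)).2 ↔ p.1 < p.2 :=
        h.mono₂.lt_iff_lt
      rw [e1]
      constructor
      · rintro ⟨h1, h2, h3, h4, h5⟩
        refine ⟨h3, ⟨h1, ?_, h4⟩, ?_, h5⟩
        · intro q hq
          exact h.mono₂.le_iff_le.1 (h2 _ ⟨_, hq, rfl⟩)
        · intro w hw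
          exact h2 _ ⟨w, hw, rfl⟩
      · rintro ⟨h3, ⟨h1, -, h4⟩, h6, h5⟩
        refine ⟨h1, ?_, h3, h4, h5⟩
        rintro _ ⟨w, hw, rfl⟩
        exact h6 w hw

/-- A monotone word is determined by its two subwords, since the larger points of the letters of
different kinds are distinct. -/
lemma eq_of_lefts_rights (h : IsDecomposition σ₀ σ₁ σ₂ f₁ f₂)
    {M M' : List ((Y₁ × Y₁) ⊕ (Y₂ × Y₂))}
    (hM : M.Pairwise fun z w => (sumPair f₁ f₂ w).2 ≤ (sumPair f₁ f₂ z).2)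
    (hM' : M'.Pairwise fun z w => (sumPair f₁ f₂ w).2 ≤ (sumPair f₁ f₂ z).2)
    (hl : lefts M = lefts M') (hr : rights M = rights M') : M = M' := by
  induction M generalizing M' with
  | nil =>
    cases M' with
    | nil => rfl
    | cons z' M' => cases z' <;> simp at hl hr
  | cons z M ih =>
    cases M' with
    | nil => cases z <;> simp at hl hr
    | cons z' M' =>
      rw [List.pairwise_cons] at hM hM'
      cases z with
      | inl p =>
        cases z' with
        | inl p' =>
          simp only [lefts_inl, rights_inl, List.cons.injEq] at hl hr
          rw [hl.1, ih hM.2 hM'.2 hl.2 hr]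
        | inr p' =>
          exfalso
          simp only [lefts_inl, rights_inl, lefts_inr, rights_inr] at hl hr
          have h1 : Sum.inl p ∈ M' := by rw [← mem_lefts, ← hl]; simp
          have h2 : Sum.inr p' ∈ M := by rw [← mem_rights, hr]; simp
          exact h.disj p.2 p'.2 (le_antisymm (hM'.1 _ h1) (hM.1 _ h2))
      | inr p =>
        cases z' with
        | inr p' =>
          simp only [lefts_inr, rights_inr, List.cons.injEq] at hl hr
          rw [hr.1, ih hM.2 hM'.2 hl hr.2]
        | inl p' =>
          exfalso
          simp only [lefts_inl, rights_inl, lefts_inr, rights_inr] at hl hr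
          have h1 : Sum.inr p ∈ M' := by rw [← mem_rights, ← hr]; simp
          have h2 : Sum.inl p' ∈ M := by rw [← mem_lefts, hl]; simp
          exact h.disj p'.2 p.2 (le_antisymm (hM.1 _ h2) (hM'.1 _ h1))

/-- Any two monotone words on the two parts have a monotone shuffle. -/
lemma exists_merge (h : IsDecomposition σ₀ σ₁ σ₂ f₁ f₂) {L₁ : List (Y₁ × Y₁)}
    {L₂ : List (Y₂ × Y₂)} (h₁ : IsMonoWord L₁) (h₂ : IsMonoWord L₂) :
    ∃ M : List ((Y₁ × Y₁) ⊕ (Y₂ × Y₂)), IsMonoWord (M.map (sumPair f₁ f₂)) ∧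
      lefts M = L₁ ∧ rights M = L₂ := by
  simp only [isMonoWord_map_sumPair h]
  suffices ∃ M : List ((Y₁ × Y₁) ⊕ (Y₂ × Y₂)),
      (M.Pairwise fun z w => (sumPair f₁ f₂ w).2 ≤ (sumPair f₁ f₂ z).2) ∧
      lefts M = L₁ ∧ rights M = L₂ by
    obtain ⟨M, hM, rfl, rfl⟩ := this
    exact ⟨M, ⟨h₁, h₂, hM⟩, rfl, rfl⟩
  induction L₁ generalizing L₂ with
  | nil =>
    refine ⟨L₂.map Sum.inr, ?_, lefts_map_inr _, rights_map_inr _⟩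
    rw [List.pairwise_map]
    exact h₂.2.imp fun hab => h.mono₂.le_iff_le.2 hab
  | cons p L₁ ih₁ =>
    induction L₂ with
    | nil =>
      refine ⟨(p :: L₁).map Sum.inl, ?_, lefts_map_inl _, rights_map_inl _⟩
      rw [List.pairwise_map]
      exact h₁.2.imp fun hab => h.mono₁.le_iff_le.2 hab
    | cons p' L₂ ih₂ =>
      rcases le_total (f₂ p'.2) (f₁ p.2) with hle | hle
      · obtain ⟨M, hM, hl, hr⟩ := ih₁ (isMonoWord_cons.1 h₁).2.2 h₂
        refine ⟨Sum.inl p :: M, List.pairwise_cons.2 ⟨?_, hM⟩, by simp [hl], by simp [hr]⟩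
        rintro (w | w) hw
        · rw [← mem_lefts, hl] at hw
          exact h.mono₁.le_iff_le.2 ((isMonoWord_cons.1 h₁).2.1 w hw)
        · rw [← mem_rights, hr, List.mem_cons] at hw
          refine le_trans (h.mono₂.le_iff_le.2 ?_) hle
          rcases hw with rfl | hw
          · exact le_rfl
          · exact (isMonoWord_cons.1 h₂).2.1 w hw
      · obtain ⟨M, hM, hl, hr⟩ := ih₂ (isMonoWord_cons.1 h₂).2.2
        refine ⟨Sum.inr p' :: M, List.pairwise_cons.2 ⟨?_, hM⟩, by simp [hl], by simp [hr]⟩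
        rintro (w | w) hw
        · rw [← mem_lefts, hl, List.mem_cons] at hw
          refine le_trans (h.mono₁.le_iff_le.2 ?_) hle
          rcases hw with rfl | hw
          · exact le_rfl
          · exact (isMonoWord_cons.1 h₁).2.1 w hw
        · rw [← mem_rights, hr] at hw
          exact h.mono₂.le_iff_le.2 ((isMonoWord_cons.1 h₂).2.1 w hw)

lemma sumPair_injective (h : IsDecomposition σ₀ σ₁ σ₂ f₁ f₂) :
    Function.Injective (sumPair f₁ f₂) := by
  rintro (p | p) (p' | p') e
  · simpa [sumPair, Prod.ext_iff, h.mono₁.injective.eq_iff] using e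
  · exact absurd (congrArg Prod.fst e) (h.disj _ _)
  · exact absurd (congrArg Prod.fst e).symm (h.disj _ _)
  · simpa [sumPair, Prod.ext_iff, h.mono₂.injective.eq_iff] using e

/-- A word whose letters respect the decomposition consists of letters of the two kinds. -/
lemma exists_map_sumPair (h : IsDecomposition σ₀ σ₁ σ₂ f₁ f₂) {L : List (X × X)}
    (hL : ∀ p ∈ L, (p.1 ∈ Set.range f₁ ↔ p.2 ∈ Set.range f₁)) :
    ∃ M : List ((Y₁ × Y₁) ⊕ (Y₂ × Y₂)), M.map (sumPair f₁ f₂) = L := by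
  rw [← Set.mem_range, Set.range_list_map]
  intro p hp
  have h1 := hL p hp
  have h2 : p.1 ∈ Set.range f₁ ∨ p.1 ∈ Set.range f₂ := h.cover p.1
  have h3 : p.2 ∈ Set.range f₁ ∨ p.2 ∈ Set.range f₂ := h.cover p.2
  have hd : ∀ x, x ∈ Set.range f₁ → x ∉ Set.range f₂ := by
    rintro _ ⟨y, rfl⟩ ⟨y', e⟩
    exact h.disj _ _ e.symm
  by_cases h4 : p.1 ∈ Set.range f₁
  · obtain ⟨y, hy⟩ := h4
    obtain ⟨y', hy'⟩ := h1.1 ⟨y, hy⟩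
    exact ⟨Sum.inl (y, y'), by simp [sumPair, hy, hy']⟩
  · obtain ⟨y, hy⟩ := h2.resolve_left h4
    obtain ⟨y', hy'⟩ := h3.resolve_left fun h' => h4 (h1.2 h')
    exact ⟨Sum.inr (y, y'), by simp [sumPair, hy, hy']⟩

section
variable (h : IsDecomposition σ₀ σ₁ σ₂ f₁ f₂) (M : List ((Y₁ × Y₁) ⊕ (Y₂ × Y₂)))
include h

lemma wordPerm_map_left (y : Y₁) :
    (wordPerm (M.map (sumPair f₁ f₂)) * σ₀) (f₁ y) = f₁ ((wordPerm (lefts M) * σ₁) y) := by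
  rw [Perm.mul_apply, Perm.mul_apply, h.comm₁]
  generalize σ₁ y = y
  induction M with
  | nil => rfl
  | cons z M ih =>
    cases z with
    | inl p =>
      rw [List.map_cons, wordPerm_cons, Perm.mul_apply, ih, lefts_inl, wordPerm_cons,
        Perm.mul_apply]
      exact h.mono₁.injective.swap_apply _ _ _
    | inr p =>
      rw [List.map_cons, wordPerm_cons, Perm.mul_apply, ih, lefts_inr]
      exact swap_apply_of_ne_of_ne (h.disj _ _) (h.disj _ _)

lemma wordPerm_map_right (y : Y₂) :
    (wordPerm (M.map (sumPair f₁ f₂)) * σ₀) (f₂ y) = f₂ ((wordPerm (rights M) * σ₂) y) := by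
  rw [Perm.mul_apply, Perm.mul_apply, h.comm₂]
  generalize σ₂ y = y
  induction M with
  | nil => rfl
  | cons z M ih =>
    cases z with
    | inr p =>
      rw [List.map_cons, wordPerm_cons, Perm.mul_apply, ih, rights_inr, wordPerm_cons,
        Perm.mul_apply]
      exact h.mono₂.injective.swap_apply _ _ _
    | inl p =>
      rw [List.map_cons, wordPerm_cons, Perm.mul_apply, ih, rights_inl]
      exact swap_apply_of_ne_of_ne (h.disj _ _).symm (h.disj _ _).symm

lemma isInv_map_iff (P : Set X) :
    IsInv σ₀ (M.map (sumPair f₁ f₂)) P ↔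
      IsInv σ₁ (lefts M) (f₁ ⁻¹' P) ∧ IsInv σ₂ (rights M) (f₂ ⁻¹' P) := by
  constructor
  · rintro ⟨h1, h2⟩
    refine ⟨⟨fun y => ?_, fun p hp => ?_⟩, ⟨fun y => ?_, fun p hp => ?_⟩⟩
    · simpa [h.comm₁] using h1 (f₁ y)
    · exact h2 _ (List.mem_map_of_mem (mem_lefts.1 hp))
    · simpa [h.comm₂] using h1 (f₂ y)
    · exact h2 _ (List.mem_map_of_mem (mem_rights.1 hp))
  · rintro ⟨⟨h1, h2⟩, ⟨h3, h4⟩⟩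
    refine ⟨fun x => ?_, fun p hp => ?_⟩
    · rcases h.cover x with ⟨y, rfl⟩ | ⟨y, rfl⟩
      · rw [h.comm₁]; exact h1 y
      · rw [h.comm₂]; exact h3 y
    · obtain ⟨z | z, hz, rfl⟩ := List.mem_map.1 hp
      · exact h2 z (mem_lefts.2 hz)
      · exact h4 z (mem_rights.2 hz)

lemma linked_map_left (y y' : Y₁) :
    Linked σ₀ (M.map (sumPair f₁ f₂)) (f₁ y) (f₁ y') ↔ Linked σ₁ (lefts M) y y' := by
  constructor
  · intro hl P hP
    have h1 := hl (f₁ '' P) ((isInv_map_iff h M _).2 ⟨?_, ?_⟩)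
    · rwa [h.mono₁.injective.mem_set_image, h.mono₁.injective.mem_set_image] at h1
    · rwa [Set.preimage_image_eq _ h.mono₁.injective]
    · have : f₂ ⁻¹' (f₁ '' P) = ∅ := by
        ext y
        simp [h.disj]
      rw [this]
      simp [IsInv]
  · exact fun hl P hP => hl _ ((isInv_map_iff h M P).1 hP).1

lemma linked_map_right (y y' : Y₂) :
    Linked σ₀ (M.map (sumPair f₁ f₂)) (f₂ y) (f₂ y') ↔ Linked σ₂ (rights M) y y' := by
  constructor
  · intro hl P hP
    have h1 := hl (f₂ '' P) ((isInv_map_iff h M _).2 ⟨?_, ?_⟩)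
    · rwa [h.mono₂.injective.mem_set_image, h.mono₂.injective.mem_set_image] at h1
    · have : f₁ ⁻¹' (f₂ '' P) = ∅ := by
        ext y
        simp [(h.disj _ _).symm]
      rw [this]
      simp [IsInv]
    · rwa [Set.preimage_image_eq _ h.mono₂.injective]
  · exact fun hl P hP => hl _ ((isInv_map_iff h M P).1 hP).2

lemma isInv_map_range : IsInv σ₀ (M.map (sumPair f₁ f₂)) (Set.range f₁) := by
  rw [isInv_map_iff h]
  have : f₂ ⁻¹' (Set.range f₁) = ∅ := by
    ext y
    simp [h.disj]
  rw [this, Set.preimage_range]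
  simp [IsInv]

end

end Merging

section SplitLabellings

variable {X Y : Type*} [Fintype X] [Fintype Y] [DecidableEq X] [DecidableEq Y]
  {ι : Type*} [Fintype ι]

lemma sameCycle_map_iff {τ : Perm X} {τ' : Perm Y} {f : Y → X} (hf : Function.Injective f)
    (h : ∀ y, τ (f y) = f (τ' y)) (y y' : Y) : SameCycle τ (f y) (f y') ↔ SameCycle τ' y y' := by
  have hpow : ∀ (i : ℕ) (y : Y), (τ ^ i) (f y) = f ((τ' ^ i) y) := by
    intro i
    induction i with
    | zero => simp
    | succ i ih => intro y; rw [pow_succ, pow_succ, Perm.mul_apply, Perm.mul_apply, h, ih]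
  constructor
  · intro hs
    obtain ⟨i, -, e⟩ := hs.exists_pow_eq'
    rw [hpow] at e
    rw [← hf e]
    exact sameCycle_pow _ _ _
  · intro hs
    obtain ⟨i, -, rfl⟩ := hs.exists_pow_eq'
    rw [← hpow]
    exact sameCycle_pow _ _ _

lemma mem_range_of_sameCycle {τ : Perm X} {τ' : Perm Y} {f : Y → X}
    (h : ∀ y, τ (f y) = f (τ' y)) {y : Y} {x : X} (hs : SameCycle τ (f y) x) :
    x ∈ Set.range f :=
  mem_of_sameCycle (P := Set.range f) (by rintro _ ⟨y, rfl⟩; exact ⟨_, (h y).symm⟩) hs ⟨y, rfl⟩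

lemma IsLab.restrict {τ : Perm X} {τ' : Perm Y} {f : Y → X} (hf : Function.Injective f)
    (h : ∀ y, τ (f y) = f (τ' y)) {len : ι → ℕ} {lab : X → ι} (hl : IsLab τ len lab) :
    IsLab τ' (fun i => if ∃ y, lab (f y) = i then len i else 0) (lab ∘ f) := by
  refine ⟨fun y y' => ?_, fun i => ?_⟩
  · rw [← sameCycle_map_iff hf h, ← hl.same_iff]; rfl
  · split_ifs with hi
    · obtain ⟨y₀, hy₀⟩ := hi
      rw [← hl.card_eq, ← card_image_of_injective _ hf]
      congr 1
      ext x
      simp only [mem_image, mem_filter, mem_univ, true_and, Function.comp_apply]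
      constructor
      · rintro ⟨y, hy, rfl⟩; exact hy
      · intro hx
        rw [← hy₀, eq_comm, hl.same_iff] at hx
        obtain ⟨y, rfl⟩ := mem_range_of_sameCycle h hx
        refine ⟨y, ?_, rfl⟩
        rw [← hy₀]
        exact ((hl.same_iff _ _).2 hx).symm
    · rw [Finset.card_eq_zero, filter_eq_empty_iff]
      exact fun y _ e => hi ⟨y, e⟩

end SplitLabellings

section SplitCount

variable {X Y₁ Y₂ : Type*} [LinearOrder X] [LinearOrder Y₁] [LinearOrder Y₂]
  [Fintype X] [Fintype Y₁] [Fintype Y₂] {ι : Type*} [Fintype ι]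
  {σ₀ : Perm X} {σ₁ : Perm Y₁} {σ₂ : Perm Y₂} {f₁ : Y₁ → X} {f₂ : Y₂ → X}

/-- Labellings on the two parts that use disjoint sets of labels form a labelling. -/
lemma isLab_glue (h : IsDecomposition σ₀ σ₁ σ₂ f₁ f₂) {τ : Perm X} {τ₁ : Perm Y₁} {τ₂ : Perm Y₂}
    (h₁ : ∀ y, τ (f₁ y) = f₁ (τ₁ y)) (h₂ : ∀ y, τ (f₂ y) = f₂ (τ₂ y)) {len len₁ len₂ : ι → ℕ}
    (hlen : ∀ i, len i = len₁ i + len₂ i) (hdisj : ∀ i, len₁ i = 0 ∨ len₂ i = 0) {lab : X → ι}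
    (hl₁ : IsLab τ₁ len₁ (lab ∘ f₁)) (hl₂ : IsLab τ₂ len₂ (lab ∘ f₂)) : IsLab τ len lab := by
  have hne : ∀ y₁ y₂, lab (f₁ y₁) ≠ lab (f₂ y₂) := by
    intro y₁ y₂ e
    have a := hl₁.len_ne_zero y₁
    have b := hl₂.len_ne_zero y₂
    simp only [Function.comp_apply] at a b
    rw [e] at a
    rcases hdisj (lab (f₂ y₂)) with h | h
    · exact a h
    · exact b h
  have hns : ∀ y₁ y₂, ¬ SameCycle τ (f₁ y₁) (f₂ y₂) := by
    intro y₁ y₂ e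
    obtain ⟨y, e⟩ := mem_range_of_sameCycle h₁ e
    exact h.disj _ _ e
  refine ⟨fun x x' => ?_, fun i => ?_⟩
  · rcases h.cover x with ⟨y, rfl⟩ | ⟨y, rfl⟩ <;> rcases h.cover x' with ⟨y', rfl⟩ | ⟨y', rfl⟩
    · rw [sameCycle_map_iff h.mono₁.injective h₁, ← hl₁.same_iff]; rfl
    · exact ⟨fun e => absurd e (hne _ _), fun e => absurd e (hns _ _)⟩
    · exact ⟨fun e => absurd e.symm (hne _ _), fun e => absurd e.symm (hns _ _)⟩
    · rw [sameCycle_map_iff h.mono₂.injective h₂, ← hl₂.same_iff]; rfl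
  · rw [hlen, ← hl₁.card_eq, ← hl₂.card_eq, ← card_image_of_injective _ h.mono₁.injective,
      ← card_image_of_injective _ h.mono₂.injective, ← card_union_of_disjoint]
    · congr 1
      ext x
      simp only [mem_union, mem_image, mem_filter, mem_univ, true_and, Function.comp_apply]
      constructor
      · intro hx
        rcases h.cover x with ⟨y, rfl⟩ | ⟨y, rfl⟩
        · exact Or.inl ⟨y, hx, rfl⟩
        · exact Or.inr ⟨y, hx, rfl⟩
      · rintro (⟨y, hy, rfl⟩ | ⟨y, hy, rfl⟩) <;> exact hy
    · rw [Finset.disjoint_left]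
      intro x hx hx'
      obtain ⟨y, -, rfl⟩ := mem_image.1 hx
      obtain ⟨y', -, e⟩ := mem_image.1 hx'
      exact h.disj _ _ e.symm

/-- The labels other than `i₀` and `b` that are in use. -/
noncomputable def freeLabels (len : ι → ℕ) (i₀ b : ι) : Finset ι :=
  univ.filter fun i => i ≠ i₀ ∧ i ≠ b ∧ len i ≠ 0

/-- The lengths restricted to the labels in `I` and `b`. -/
noncomputable def lenIn (len : ι → ℕ) (b : ι) (I : Finset ι) : ι → ℕ :=
  fun i => if i ∈ I ∨ i = b then len i else 0

/-- The lengths restricted to the labels other than `b` that are not in `I`. -/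
noncomputable def lenOut (len : ι → ℕ) (b : ι) (I : Finset ι) : ι → ℕ :=
  fun i => if i ∈ I ∨ i = b then 0 else len i

/-- Words with exactly the two orbits `range f₁`, `range f₂` are shuffles of a transitive word on
either orbit; the monotonicity determines the shuffle. -/
theorem card_two_orbits (h : IsDecomposition σ₀ σ₁ σ₂ f₁ f₂) {s t : Y₂}
    (hlow : ∀ y, f₁ y < f₂ s) {i₀ b : ι} (hb : i₀ ≠ b) {len : ι → ℕ} (hlen : len b ≠ 0) (m : ℕ) :
    ((monoWords X m ×ˢ (univ : Finset (X → ι))).filter fun z =>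
      (IsInv σ₀ z.1 (Set.range f₁) ∧ (∀ y y', Linked σ₀ z.1 (f₁ y) (f₁ y')) ∧
        (∀ y y', Linked σ₀ z.1 (f₂ y) (f₂ y')) ∧ ∀ r, z.2 r = b → r ∈ Set.range f₁) ∧
      IsLab (wordPerm z.1 * σ₀) len z.2 ∧ (∀ p ∈ z.1, p.2 ≤ f₂ s) ∧ z.2 (f₂ t) = i₀).card =
    ∑ c ∈ antidiagonal m, ∑ I ∈ (freeLabels len i₀ b).powerset,
      countWith σ₁ c.1 (lenIn len b I) (fun _ _ => True) *
      countWith σ₂ c.2 (lenOut len b I) (fun L lab => (∀ p ∈ L, p.2 ≤ s) ∧ lab t = i₀) := by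
  rw [← sum_product']
  simp only [countWith, ← card_product]
  rw [← card_sigma]
  symm
  have hinj₁ := h.mono₁.injective
  have hinj₂ := h.mono₂.injective
  -- gluing of labellings
  let glue : (Y₁ → ι) → (Y₂ → ι) → X → ι := fun l₁ l₂ x =>
    if hx : ∃ y, f₁ y = x then l₁ hx.choose else
      if hx : ∃ y, f₂ y = x then l₂ hx.choose else i₀
  have glue₁ : ∀ l₁ l₂, glue l₁ l₂ ∘ f₁ = l₁ := by
    intro l₁ l₂
    funext y
    have hx : ∃ y', f₁ y' = f₁ y := ⟨y, rfl⟩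
    simp only [glue, Function.comp_apply]
    rw [dif_pos hx, hinj₁ hx.choose_spec]
  have glue₂ : ∀ l₁ l₂, glue l₁ l₂ ∘ f₂ = l₂ := by
    intro l₁ l₂
    funext y
    have hx : ∃ y', f₂ y' = f₂ y := ⟨y, rfl⟩
    have hx' : ¬ ∃ y', f₁ y' = f₂ y := fun ⟨y', e⟩ => h.disj _ _ e
    simp only [glue, Function.comp_apply]
    rw [dif_neg hx', dif_pos hx, hinj₂ hx.choose_spec]
  let mrg : List (Y₁ × Y₁) → List (Y₂ × Y₂) → List ((Y₁ × Y₁) ⊕ (Y₂ × Y₂)) := fun L₁ L₂ =>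
    if hL : IsMonoWord L₁ ∧ IsMonoWord L₂ then (exists_merge h hL.1 hL.2).choose else []
  have mrg_spec : ∀ {L₁ L₂}, IsMonoWord L₁ → IsMonoWord L₂ →
      IsMonoWord ((mrg L₁ L₂).map (sumPair f₁ f₂)) ∧
        lefts (mrg L₁ L₂) = L₁ ∧ rights (mrg L₁ L₂) = L₂ := by
    intro L₁ L₂ h₁ h₂
    simp only [mrg]
    rw [dif_pos ⟨h₁, h₂⟩]
    exact (exists_merge h h₁ h₂).choose_spec
  refine card_bij (fun z _ => ((mrg z.2.1.1 z.2.2.1).map (sumPair f₁ f₂), glue z.2.1.2 z.2.2.2))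
    ?_ ?_ ?_
  · rintro ⟨⟨c, I⟩, ⟨⟨L₁, l₁⟩, ⟨L₂, l₂⟩⟩⟩ hz
    simp only [mem_sigma, mem_product, mem_filter, mem_univ, and_true, mem_monoWords,
      HasAntidiagonal.mem_antidiagonal, mem_powerset] at hz ⊢
    obtain ⟨⟨hc, hI⟩, ⟨⟨hL₁, hm₁⟩, hc₁, hl₁⟩, ⟨⟨hL₂, hm₂⟩, hc₂, hl₂, hs₂, ht₂⟩⟩ := hz
    obtain ⟨hM, hl, hr⟩ := mrg_spec hm₁ hm₂
    have hi₀ : i₀ ∉ I ∧ b ∉ I := by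
      constructor <;> intro hmem <;> have := hI hmem <;> simp [freeLabels] at this
    have w₁ := wordPerm_map_left h (mrg L₁ L₂)
    have w₂ := wordPerm_map_right h (mrg L₁ L₂)
    rw [hl] at w₁
    rw [hr] at w₂
    refine ⟨⟨?_, hM⟩, ⟨isInv_map_range h _, ?_, ?_, ?_⟩, ?_, ?_, ?_⟩
    · rw [List.length_map, ← length_lefts_add_rights, hl, hr, hL₁, hL₂, hc]
    · intro y y'
      rw [linked_map_left h, hl]; exact hc₁ _ _
    · intro y y'
      rw [linked_map_right h, hr]; exact hc₂ _ _
    · intro r hrb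
      rcases h.cover r with ⟨y, rfl⟩ | ⟨y, rfl⟩
      · exact ⟨y, rfl⟩
      · exfalso
        have e : l₂ y = b := by rw [← glue₂ l₁ l₂]; exact hrb
        apply hl₂.len_ne_zero y
        simp [lenOut, e]
    · refine isLab_glue h w₁ w₂ (len₁ := lenIn len b I) (len₂ := lenOut len b I) ?_ ?_ ?_ ?_
      · intro i; simp only [lenIn, lenOut]; split_ifs <;> simp
      · intro i; simp only [lenIn, lenOut]; split_ifs <;> simp
      · rwa [glue₁]
      · rwa [glue₂]
    · intro p hp
      obtain ⟨z | z, hz, rfl⟩ := List.mem_map.1 hp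
      · exact (hlow _).le
      · rw [← mem_rights, hr] at hz
        exact h.mono₂.le_iff_le.2 (hs₂ z hz)
    · rw [← ht₂]
      exact congrFun (glue₂ l₁ l₂) t
  · rintro ⟨⟨c, I⟩, ⟨⟨L₁, l₁⟩, ⟨L₂, l₂⟩⟩⟩ hz ⟨⟨c', I'⟩, ⟨⟨L₁', l₁'⟩, ⟨L₂', l₂'⟩⟩⟩ hz' e
    simp only [mem_sigma, mem_product, mem_filter, mem_univ, and_true, mem_monoWords,
      HasAntidiagonal.mem_antidiagonal, mem_powerset] at hz hz'
    obtain ⟨⟨hc, hI⟩, ⟨⟨hL₁, hm₁⟩, hc₁, hl₁⟩, ⟨⟨hL₂, hm₂⟩, hc₂, hl₂, hs₂, ht₂⟩⟩ := hz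
    obtain ⟨⟨hc', hI'⟩, ⟨⟨hL₁', hm₁'⟩, hc₁', hl₁'⟩, ⟨⟨hL₂', hm₂'⟩, hc₂', hl₂', hs₂', ht₂'⟩⟩ := hz'
    obtain ⟨-, hl, hr⟩ := mrg_spec hm₁ hm₂
    obtain ⟨-, hl', hr'⟩ := mrg_spec hm₁' hm₂'
    simp only [Prod.mk.injEq] at e
    obtain ⟨e1, e2⟩ := e
    have e1 := (sumPair_injective h).list_map e1
    have eL₁ : L₁ = L₁' := by rw [← hl, ← hl', e1]
    have eL₂ : L₂ = L₂' := by rw [← hr, ← hr', e1]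
    have el₁ : l₁ = l₁' := by rw [← glue₁ l₁ l₂, ← glue₁ l₁' l₂', e2]
    have el₂ : l₂ = l₂' := by rw [← glue₂ l₁ l₂, ← glue₂ l₁' l₂', e2]
    subst eL₁ eL₂ el₁ el₂
    have ec : c = c' := by
      ext
      · rw [← hL₁, ← hL₁']
      · rw [← hL₂, ← hL₂']
    -- `I` consists of the free labels that are in use on the first orbit
    have key : ∀ J : Finset ι, J ⊆ freeLabels len i₀ b →
        IsLab (wordPerm L₁ * σ₁) (lenIn len b J) l₁ →
        J = (freeLabels len i₀ b).filter fun i => (univ.filter fun x => l₁ x = i).card ≠ 0 := by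
      intro J hJ hlab
      ext i
      simp only [mem_filter, hlab.card_eq]
      constructor
      · intro hi
        refine ⟨hJ hi, ?_⟩
        have := hJ hi
        simp only [freeLabels, mem_filter, mem_univ, true_and] at this
        simp [lenIn, hi, this.2.2]
      · rintro ⟨hi, hi'⟩
        simp only [freeLabels, mem_filter, mem_univ, true_and] at hi
        by_contra hn
        simp [lenIn, hn, hi.2.1] at hi'
    have eI : I = I' := (key I hI hl₁).trans (key I' hI' hl₁').symm
    subst ec eI
    rfl
  · rintro ⟨L, lab⟩ hz
    simp only [mem_product, mem_filter, mem_univ, and_true, mem_monoWords] at hz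
    obtain ⟨⟨hLm, hmono⟩, ⟨hinv, hlk₁, hlk₂, hrb⟩, hlab, hs, ht⟩ := hz
    obtain ⟨M, rfl⟩ := exists_map_sumPair h hinv.2
    have hmono' := (isMonoWord_map_sumPair h M).1 hmono
    have w₁ := wordPerm_map_left h M
    have w₂ := wordPerm_map_right h M
    set I := (freeLabels len i₀ b).filter fun i => ∃ y, lab (f₁ y) = i with hIdef
    have hne : ∀ y₁ y₂, lab (f₁ y₁) ≠ lab (f₂ y₂) := by
      intro y₁ y₂ e
      rw [hlab.same_iff] at e
      obtain ⟨y, e⟩ := mem_range_of_sameCycle w₁ e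
      exact h.disj _ _ e
    obtain ⟨r, hr⟩ : ∃ r, lab r = b := by
      rw [← hlab.card_eq, Finset.card_ne_zero] at hlen
      obtain ⟨r, hr⟩ := hlen
      exact ⟨r, by simpa using hr⟩
    obtain ⟨yb, rfl⟩ := hrb r hr
    have hI : ∀ i, len i ≠ 0 → ((i ∈ I ∨ i = b) ↔ ∃ y, lab (f₁ y) = i) := by
      intro i hi
      constructor
      · rintro (h | rfl)
        · exact (mem_filter.1 h).2
        · exact ⟨yb, hr⟩
      · rintro ⟨y, rfl⟩
        by_cases hib : lab (f₁ y) = b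
        · exact Or.inr hib
        · refine Or.inl (mem_filter.2 ⟨?_, y, rfl⟩)
          simp only [freeLabels, mem_filter, mem_univ, true_and]
          exact ⟨fun e => hne y t (e.trans ht.symm), hib, hi⟩
    have e₁ : (fun i => if ∃ y, lab (f₁ y) = i then len i else 0) = lenIn len b I := by
      funext i
      unfold lenIn
      rcases eq_or_ne (len i) 0 with h0 | h0
      · simp [h0]
      · simp only [hI i h0]
    have e₂ : (fun i => if ∃ y, lab (f₂ y) = i then len i else 0) = lenOut len b I := by
      funext i
      unfold lenOut
      rcases eq_or_ne (len i) 0 with h0 | h0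
      · simp [h0]
      · simp only [hI i h0]
        rw [← hlab.card_eq, Finset.card_ne_zero] at h0
        obtain ⟨x, hx⟩ := h0
        simp only [mem_filter, mem_univ, true_and] at hx
        subst hx
        rcases h.cover x with ⟨y, rfl⟩ | ⟨y, rfl⟩
        · rw [if_neg, if_pos ⟨y, rfl⟩]
          rintro ⟨y', e⟩
          exact hne _ _ e.symm
        · rw [if_pos ⟨y, rfl⟩, if_neg]
          rintro ⟨y', e⟩
          exact hne _ _ e
    have hl₁ := hlab.restrict hinj₁ w₁
    have hl₂ := hlab.restrict hinj₂ w₂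
    rw [e₁] at hl₁
    rw [e₂] at hl₂
    obtain ⟨hM, hl, hr'⟩ := mrg_spec hmono'.1 hmono'.2.1
    refine ⟨⟨⟨((lefts M).length, (rights M).length), I⟩,
      ⟨⟨lefts M, lab ∘ f₁⟩, ⟨rights M, lab ∘ f₂⟩⟩⟩, ?_, ?_⟩
    · simp only [mem_sigma, mem_product, mem_filter, mem_univ, and_true, mem_monoWords,
        HasAntidiagonal.mem_antidiagonal, mem_powerset, true_and]
      refine ⟨⟨?_, filter_subset _ _⟩, ⟨hmono'.1, ?_, hl₁⟩, hmono'.2.1, ?_, hl₂, ?_, ht⟩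
      · rw [length_lefts_add_rights, ← hLm, List.length_map]
      · exact fun y y' => (linked_map_left h M y y').1 (hlk₁ y y')
      · exact fun y y' => (linked_map_right h M y y').1 (hlk₂ y y')
      · intro p hp
        exact h.mono₂.le_iff_le.1 (hs _ (List.mem_map_of_mem (mem_rights.1 hp)))
    · simp only [Prod.mk.injEq]
      constructor
      · congr 1
        exact eq_of_lefts_rights h ((isMonoWord_map_sumPair h _).1 hM).2.2 hmono'.2.2 hl hr'
      · funext x
        rcases h.cover x with ⟨y, rfl⟩ | ⟨y, rfl⟩
        · exact congrFun (glue₁ (lab ∘ f₁) (lab ∘ f₂)) y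
        · exact congrFun (glue₂ (lab ∘ f₁) (lab ∘ f₂)) y

/-- The words of `countSplit` whose orbit not containing `s` is `U`. -/
lemma not_connected_and_eq_iff {ι : Type*} {lab : X → ι} {b : ι} {L : List (X × X)} {s : X}
    {U : Set X} (hs : s ∉ U) (hb : ∃ r, lab r = b) :
    ((¬ Connected σ₀ L ∧ ∀ r, lab r = b → Connected σ₀ ((r, s) :: L)) ∧
        {x | ¬ Linked σ₀ L s x} = U) ↔
      IsInv σ₀ L U ∧ (∀ x ∈ U, ∀ y ∈ U, Linked σ₀ L x y) ∧
        (∀ x ∉ U, ∀ y ∉ U, Linked σ₀ L x y) ∧ ∀ r, lab r = b → r ∈ U := by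
  obtain ⟨r₀, hr₀⟩ := hb
  constructor
  · rintro ⟨⟨hc, hr⟩, rfl⟩
    have hi := isInv_linked (σ₀ := σ₀) (L := L) (x := s)
    refine ⟨⟨fun x => not_congr (hi.1 x), fun p hp => not_congr (hi.2 p hp)⟩, ?_, ?_, ?_⟩
    · intro x hx y hy
      have h1 := connected_cons_iff.1 (hr r₀ hr₀)
      exact ((h1 x).resolve_right hx).symm.trans ((h1 y).resolve_right hy)
    · intro x hx y hy
      simp only [Set.mem_ofPred_eq, not_not] at hx hy
      exact hx.symm.trans hy
    · intro r hrb hl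
      exact hc ((connected_cons_of_linked hl.symm).1 (hr r hrb))
  · rintro ⟨hi, h1, h2, h3⟩
    refine ⟨⟨fun hc => ?_, fun r hr => connected_cons_iff.2 fun x => ?_⟩, ?_⟩
    · exact hs ((hc r₀ s U hi).1 (h3 r₀ hr₀))
    · by_cases hx : x ∈ U
      · exact Or.inl (h1 r (h3 r hr) x hx)
      · exact Or.inr (h2 s hs x hx)
    · ext x
      simp only [Set.mem_ofPred_eq]
      by_cases hx : x ∈ U
      · simp only [hx, iff_true]
        exact fun hl => hs ((hl U hi).2 hx)
      · simp only [hx, iff_false, not_not]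
        exact h2 s hs x hx

/-- The counts are invariant under isomorphisms of the ordered set of points. -/
lemma countWith_congr {X Y : Type*} [LinearOrder X] [LinearOrder Y] [Fintype X] [Fintype Y]
    (e : X ≃o Y) {σ : Perm X} {σ' : Perm Y} (hσ : ∀ x, σ' (e x) = e (σ x)) (m : ℕ) (len : ι → ℕ)
    {Q : List (X × X) → (X → ι) → Prop} {Q' : List (Y × Y) → (Y → ι) → Prop}
    (hQ : ∀ L lab, Q' (L.map (Prod.map e e)) lab ↔ Q L (lab ∘ e)) :
    countWith σ m len Q = countWith σ' m len Q' := by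
  symm
  have hlin : ∀ L x y, Linked σ' (L.map (Prod.map e e)) (e x) (e y) ↔ Linked σ L x y := by
    have hinv : ∀ L (P : Set Y), IsInv σ' (L.map (Prod.map e e)) P ↔ IsInv σ L (e ⁻¹' P) := by
      intro L P
      simp only [IsInv, Set.mem_preimage, List.forall_mem_map, Prod.map_fst, Prod.map_snd, ← hσ]
      exact and_congr_left fun _ => ⟨fun h x => h (e x), fun h y => by
        obtain ⟨x, rfl⟩ := e.surjective y
        exact h x⟩
    intro L x y
    constructor
    · intro h P hP
      have := h (e '' P) ((hinv L _).2 (by rwa [Set.preimage_image_eq _ e.injective]))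
      rwa [e.injective.mem_set_image, e.injective.mem_set_image] at this
    · exact fun h P hP => h (e ⁻¹' P) ((hinv L P).1 hP)
  have hperm : ∀ L x, (wordPerm (L.map (Prod.map e e)) * σ') (e x) = e ((wordPerm L * σ) x) := by
    intro L x
    rw [Perm.mul_apply, Perm.mul_apply, hσ]
    generalize σ x = x
    induction L with
    | nil => rfl
    | cons p L ih =>
      rw [List.map_cons, wordPerm_cons, Perm.mul_apply, ih, wordPerm_cons, Perm.mul_apply]
      exact e.injective.swap_apply _ _ _
  have hlab : ∀ L (len : ι → ℕ) (lab : Y → ι),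
      IsLab (wordPerm (L.map (Prod.map e e)) * σ') len lab ↔
      IsLab (wordPerm L * σ) len (lab ∘ e) := by
    intro L len lab
    constructor
    · intro hl
      have := hl.restrict e.injective (hperm L)
      convert this using 1
      funext i
      split_ifs with hi
      · rfl
      · rw [← hl.card_eq, Finset.card_eq_zero, filter_eq_empty_iff]
        intro y _ hy
        obtain ⟨x, rfl⟩ := e.surjective y
        exact hi ⟨x, hy⟩
    · intro hl
      refine ⟨fun y y' => ?_, fun i => ?_⟩
      · obtain ⟨x, rfl⟩ := e.surjective y
        obtain ⟨x', rfl⟩ := e.surjective y'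
        rw [sameCycle_map_iff e.injective (hperm L), ← hl.same_iff]; rfl
      · rw [← hl.card_eq, ← card_image_of_injective _ e.injective]
        congr 1
        ext y
        obtain ⟨x, rfl⟩ := e.surjective y
        simp
  have hmono : ∀ L : List (X × X), IsMonoWord (L.map (Prod.map e e)) ↔ IsMonoWord L := by
    intro L
    simp only [IsMonoWord, List.forall_mem_map, List.pairwise_map, Prod.map_fst, Prod.map_snd,
      e.lt_iff_lt, e.le_iff_le]
  unfold countWith
  symm
  refine card_bij (fun z _ => (z.1.map (Prod.map e e), z.2 ∘ e.symm)) ?_ ?_ ?_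
  · rintro ⟨L, lab⟩ hz
    simp only [mem_product, mem_filter, mem_univ, and_true, mem_monoWords] at hz ⊢
    obtain ⟨⟨h1, h2⟩, h3, h4, h5⟩ := hz
    have hc : (lab ∘ e.symm) ∘ e = lab := by funext x; simp
    refine ⟨⟨by simpa using h1, (hmono L).2 h2⟩, fun y y' => ?_, ?_, ?_⟩
    · obtain ⟨x, rfl⟩ := e.surjective y
      obtain ⟨x', rfl⟩ := e.surjective y'
      exact (hlin L x x').2 (h3 x x')
    · rwa [hlab, hc]
    · rwa [hQ, hc]
  · rintro ⟨L, lab⟩ - ⟨L', lab'⟩ - h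
    simp only [Prod.mk.injEq] at h
    rw [((e.injective.prodMap e.injective).list_map) h.1]
    rw [e.symm.surjective.injective_comp_right h.2]
  · rintro ⟨L, lab⟩ hz
    simp only [mem_product, mem_filter, mem_univ, and_true, mem_monoWords] at hz
    obtain ⟨⟨h1, h2⟩, h3, h4, h5⟩ := hz
    obtain ⟨L, rfl⟩ : ∃ L' : List (X × X), L'.map (Prod.map e e) = L := by
      refine ⟨L.map (Prod.map e.symm e.symm), ?_⟩
      rw [List.map_map]
      convert List.map_id L
      funext p
      simp [Prod.map]
    refine ⟨(L, lab ∘ e), ?_, ?_⟩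
    · simp only [mem_product, mem_filter, mem_univ, and_true, mem_monoWords]
      exact ⟨⟨by simpa using h1, (hmono L).1 h2⟩, fun x y => (hlin L x y).1 (h3 _ _),
        (hlab L len lab).1 h4, (hQ L lab).1 h5⟩
    · have : (lab ∘ e) ∘ e.symm = lab := by funext x; simp
      simp only [this]

/-- Labels that are not used may be added or removed. -/
lemma countWith_reindex {ι' : Type*} [Fintype ι'] {g : ι → ι'} (hg : Function.Injective g)
    (σ : Perm X) (m : ℕ) {len : ι → ℕ} {len' : ι' → ℕ} (h₁ : ∀ i, len' (g i) = len i)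
    (h₂ : ∀ j, j ∉ Set.range g → len' j = 0)
    {Q : List (X × X) → (X → ι) → Prop} {Q' : List (X × X) → (X → ι') → Prop}
    (hQ : ∀ L lab, Q' L (g ∘ lab) ↔ Q L lab) :
    countWith σ m len Q = countWith σ m len' Q' := by
  have hlab : ∀ (τ : Perm X) (lab : X → ι), IsLab τ len' (g ∘ lab) ↔ IsLab τ len lab := by
    intro τ lab
    constructor
    · intro hl
      refine ⟨fun x y => ?_, fun i => ?_⟩
      · rw [← hl.same_iff]; exact hg.eq_iff.symm
      · rw [← h₁, ← hl.card_eq]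
        congr 1
        ext x
        simp [hg.eq_iff]
    · intro hl
      refine ⟨fun x y => ?_, fun j => ?_⟩
      · rw [← hl.same_iff]; exact hg.eq_iff
      · by_cases hj : j ∈ Set.range g
        · obtain ⟨i, rfl⟩ := hj
          rw [h₁, ← hl.card_eq]
          congr 1
          ext x
          simp [hg.eq_iff]
        · rw [h₂ j hj, Finset.card_eq_zero, filter_eq_empty_iff]
          exact fun x _ hx => hj ⟨_, hx⟩
  refine card_bij (fun z _ => (z.1, g ∘ z.2)) ?_ ?_ ?_
  · rintro ⟨L, lab⟩ hz
    simp only [mem_product, mem_filter, mem_univ, and_true] at hz ⊢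
    exact ⟨hz.1, hz.2.1, (hlab _ _).2 hz.2.2.1, (hQ _ _).2 hz.2.2.2⟩
  · rintro ⟨L, lab⟩ - ⟨L', lab'⟩ - h
    simp only [Prod.mk.injEq] at h
    rw [h.1, hg.comp_left h.2]
  · rintro ⟨L, lab⟩ hz
    simp only [mem_product, mem_filter, mem_univ, and_true] at hz
    have : ∀ x, ∃ i, g i = lab x := by
      intro x
      by_contra hn
      exact hz.2.2.1.len_ne_zero x (h₂ _ hn)
    choose lab' hlab' using this
    obtain rfl : g ∘ lab' = lab := funext hlab'
    refine ⟨(L, lab'), ?_, rfl⟩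
    simp only [mem_product, mem_filter, mem_univ, and_true]
    exact ⟨hz.1, hz.2.1, (hlab _ _).1 hz.2.2.1, (hQ _ _).1 hz.2.2.2⟩

end SplitCount

/-! ### The special permutation as a rotation of blocks -/

section Blocks

variable {κ : Type*} [LinearOrder κ] [Fintype κ] {a : ℕ} {ι : Type*} [Fintype ι]

/-- The special permutation, on a union of blocks of length `a` that are indexed by `κ`: every block
is rotated cyclically. The points are ordered lexicographically. -/
def blockRot (κ : Type*) (a : ℕ) : Perm (κ ×ₗ Fin a) :=
  (ofLex.trans (prodCongr (Equiv.refl κ) (finRotate a))).trans toLex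

lemma blockRot_toLex (k : κ) (j : Fin a) :
    blockRot κ a (toLex (k, j)) = toLex (k, finRotate a j) := rfl

lemma blockRot_pow (k : κ) {j i : ℕ} (h : j + i < a) :
    ((blockRot κ a) ^ i) (toLex (k, ⟨j, by omega⟩)) = toLex (k, ⟨j + i, h⟩) := by
  induction i with
  | zero => rfl
  | succ i ih =>
    rw [pow_succ', Perm.mul_apply, ih (by omega), blockRot_toLex]
    obtain ⟨n, rfl⟩ : ∃ n, a = n + 1 := ⟨a - 1, by omega⟩
    rw [finRotate_of_lt (by omega)]
    rfl

/-- The number of factorisations with special `σ₀`, for `κ` blocks. -/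
noncomputable def countA (κ : Type*) [LinearOrder κ] [Fintype κ] (a m : ℕ) (len : ι → ℕ) : ℕ :=
  countWith (blockRot κ a) m len fun _ _ => True

/-- The number of factorisations with special `σ₀` whose transpositions do not involve the last
`a - ℓ` points and whose last point lies in the cycle with label `i₀`. -/
noncomputable def countC (κ : Type*) [LinearOrder κ] [Fintype κ] (a ℓ m : ℕ) (len : ι → ℕ)
    (i₀ : ι) : ℕ :=
  countWith (blockRot κ a) m len fun L lab =>
    (∀ p ∈ L, IsTop (ofLex p.2).1 → ((ofLex p.2).2 : ℕ) < ℓ) ∧ ∀ x, IsTop x → lab x = i₀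

/-- The number of refined factorisations with counter `ℓ` whose distinguished cycle has label
`i₀`. -/
noncomputable def countB (κ : Type*) [LinearOrder κ] [Fintype κ] (a ℓ m : ℕ) (len : ι → ℕ)
    (i₀ : ι) : ℕ :=
  countWith (blockRot κ a) m len fun L lab => (L = [] → ℓ = 1) ∧
    (∀ p ∈ L.head?, IsTop (ofLex p.2).1 ∧ ((ofLex p.2).2 : ℕ) + 1 = ℓ) ∧ ∀ x, IsTop x → lab x = i₀

lemma isTop_iff {k : κ} (hk : IsTop k) (ha : 0 < a) (x : κ ×ₗ Fin a) :
    IsTop x ↔ x = toLex (k, ⟨a - 1, by omega⟩) := by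
  have htop : IsTop (toLex (k, (⟨a - 1, by omega⟩ : Fin a))) := by
    intro y
    obtain ⟨⟨k', j⟩, rfl⟩ := toLex.surjective y
    rw [Prod.Lex.toLex_le_toLex]
    rcases (hk k').lt_or_eq with h | h
    · exact Or.inl h
    · refine Or.inr ⟨h, ?_⟩
      rw [Fin.le_def]; simp only; omega
  exact ⟨fun h => le_antisymm (htop x) (h _), fun h => h ▸ htop⟩

lemma isTop_iff_eq {k : κ} (hk : IsTop k) (k' : κ) : IsTop k' ↔ k' = k :=
  ⟨fun h => le_antisymm (hk k') (h k), fun h => h ▸ hk⟩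

lemma le_tail_iff {k : κ} (hk : IsTop k) {ℓ : ℕ} (h0 : 0 < ℓ) (hℓ : ℓ ≤ a) (x : κ ×ₗ Fin a) :
    x ≤ toLex (k, (⟨ℓ - 1, by omega⟩ : Fin a)) ↔
      (IsTop (ofLex x).1 → ((ofLex x).2 : ℕ) < ℓ) := by
  obtain ⟨⟨k', j⟩, rfl⟩ := toLex.surjective x
  rw [Prod.Lex.toLex_le_toLex, isTop_iff_eq hk, Fin.le_def]
  simp only [ofLex_toLex]
  constructor
  · rintro (h | ⟨-, h⟩) e
    · exact absurd e h.ne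
    · omega
  · intro h
    rcases (hk k').lt_or_eq with h1 | h1
    · exact Or.inl h1
    · exact Or.inr ⟨h1, by have := h h1; omega⟩

lemma isTail_blockRot {k : κ} (hk : IsTop k) {ℓ : ℕ} (h0 : 0 < ℓ) (hℓ : ℓ ≤ a) :
    IsTail (blockRot κ a) (toLex (k, ⟨ℓ - 1, by omega⟩)) (toLex (k, ⟨a - 1, by omega⟩))
      (a - ℓ + 1) := by
  refine ⟨by omega, ?_, ?_, ?_⟩
  · intro i hi hi0
    rw [blockRot_pow k (by omega), Prod.Lex.toLex_lt_toLex]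
    refine Or.inr ⟨rfl, ?_⟩
    rw [Fin.lt_def]; simp only; omega
  · intro x hx
    obtain ⟨⟨k', j⟩, rfl⟩ := toLex.surjective x
    rw [Prod.Lex.toLex_le_toLex] at hx
    rcases hx with hx | ⟨hx, hx'⟩
    · exact absurd (hk k') (not_le.2 hx)
    · simp only at hx hx'
      subst hx
      rw [Fin.le_def] at hx'
      simp only at hx'
      refine ⟨j - (ℓ - 1), by omega, ?_⟩
      rw [blockRot_pow k (by omega)]
      congr 2
      ext
      simp only; omega
  · rw [blockRot_pow k (by omega)]
    congr 2
    ext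
    simp only; omega

lemma countC_eq {k : κ} (hk : IsTop k) {ℓ : ℕ} (h0 : 0 < ℓ) (hℓ : ℓ ≤ a) (m : ℕ) (len : ι → ℕ)
    (i₀ : ι) : countC κ a ℓ m len i₀ = countWith (blockRot κ a) m len fun L lab =>
      (∀ p ∈ L, p.2 ≤ toLex (k, ⟨ℓ - 1, by omega⟩)) ∧ lab (toLex (k, ⟨a - 1, by omega⟩)) = i₀ := by
  unfold countC
  simp only [isTop_iff hk (show 0 < a by omega), forall_eq, le_tail_iff hk h0 hℓ]

/-- As soon as there is a transposition, the condition on an empty word is void, and the counter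
fixes the point `s` of the last transposition. -/
lemma countB_succ_eq {k : κ} (hk : IsTop k) {ℓ : ℕ} (h0 : 0 < ℓ) (hℓ : ℓ ≤ a) (m : ℕ)
    (len : ι → ℕ) (i₀ : ι) :
    countB κ a ℓ (m + 1) len i₀ = countWith (blockRot κ a) (m + 1) len fun L lab =>
      (∀ p ∈ L.head?, p.2 = toLex (k, ⟨ℓ - 1, by omega⟩)) ∧
        lab (toLex (k, ⟨a - 1, by omega⟩)) = i₀ := by
  unfold countB countWith
  congr 1
  ext ⟨L, lab⟩
  simp only [mem_filter, mem_product, mem_monoWords, isTop_iff hk (show 0 < a by omega), forall_eq]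
  refine and_congr_right fun hL => and_congr_right fun _ => and_congr_right fun _ => ?_
  have h1 : L ≠ [] := by
    rintro rfl
    simp at hL
  simp only [h1, false_implies, true_and]
  refine and_congr_left fun _ => forall_congr' fun p => imp_congr_right fun _ => ?_
  obtain ⟨p1, p2⟩ := p
  obtain ⟨⟨k', j⟩, rfl⟩ := toLex.surjective p2
  simp only [isTop_iff_eq hk, ofLex_toLex, EmbeddingLike.apply_eq_iff_eq, Prod.mk.injEq,
    Fin.ext_iff]
  refine and_congr_right fun _ => ?_
  omega

/-- In a transitive factorisation the last transposition involves the last block. -/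
lemma isTop_head {k : κ} (hk : IsTop k) (ha : 0 < a) {p : (κ ×ₗ Fin a) × (κ ×ₗ Fin a)}
    {L : List ((κ ×ₗ Fin a) × (κ ×ₗ Fin a))} (hL : IsMonoWord (p :: L))
    (hc : Connected (blockRot κ a) (p :: L)) : IsTop (ofLex p.2).1 := by
  rw [isTop_iff_eq hk]
  by_contra hne
  have hfst : ∀ {x y : κ ×ₗ Fin a}, x ≤ y → (ofLex x).1 ≤ (ofLex y).1 := by
    intro x y h
    rcases Prod.Lex.le_iff.1 h with h | ⟨h, -⟩
    · exact h.le
    · exact h.le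
  have hall : ∀ q ∈ p :: L, (ofLex q.2).1 ≠ k := by
    intro q hq e
    rcases List.mem_cons.1 hq with rfl | hq'
    · exact hne e
    · apply hne
      exact le_antisymm (hk _) (e ▸ hfst ((isMonoWord_cons.1 hL).2.1 q hq'))
  have hinv : IsInv (blockRot κ a) (p :: L) {x | (ofLex x).1 = k} := by
    refine ⟨fun x => Iff.rfl, fun q hq => ?_⟩
    simp only [Set.mem_ofPred_eq, hall q hq, iff_false]
    intro e
    exact hall q hq (le_antisymm (hk _) (e ▸ hfst (hL.1 q hq).le))
  exact hne ((hc (toLex (k, ⟨0, ha⟩)) p.2 _ hinv).1 rfl)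

/-- The condition `s_m ≤ s` sums the refined counts over the possible counters. -/
lemma sum_countB {k : κ} (hk : IsTop k) {ℓ : ℕ} (h0 : 0 < ℓ) (hℓ : ℓ ≤ a) (m : ℕ)
    (len : ι → ℕ) (i₀ : ι) :
    ∑ p ∈ Icc 1 ℓ, countB κ a p m len i₀ = countC κ a ℓ m len i₀ := by
  unfold countB countC countWith
  rw [Finset.card_eq_sum_card_fiberwise (t := Icc 1 ℓ)
    (f := fun z => z.1.head?.elim 1 fun p => ((ofLex p.2).2 : ℕ) + 1)]
  · refine Finset.sum_congr rfl fun j hj => ?_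
    congr 1
    ext ⟨L, lab⟩
    simp only [mem_filter, mem_product, mem_univ, and_true, mem_monoWords, mem_Icc] at hj ⊢
    cases L with
    | nil =>
      simp only [List.head?_nil, Option.elim_none]
      constructor
      · rintro ⟨h1, h2, h3, h4, h5, h6⟩
        exact ⟨⟨h1, h2, h3, by simp, h6⟩, (h4 trivial).symm⟩
      · rintro ⟨⟨h1, h2, h3, h4, h5⟩, h6⟩
        exact ⟨h1, h2, h3, fun _ => h6.symm, by simp, h5⟩
    | cons p L =>
      simp only [List.head?_cons, Option.elim_some]
      constructor
      · rintro ⟨h1, h2, h3, h4, h5, h6⟩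
        have h5 := h5 p rfl
        refine ⟨⟨h1, h2, h3, ?_, h6⟩, h5.2⟩
        intro q hq
        rw [← le_tail_iff hk h0 hℓ]
        have h7 : p.2 ≤ toLex (k, (⟨ℓ - 1, by omega⟩ : Fin a)) :=
          (le_tail_iff hk h0 hℓ _).2 fun _ => by omega
        rcases List.mem_cons.1 hq with rfl | hq
        · exact h7
        · exact ((isMonoWord_cons.1 h1.2).2.1 q hq).trans h7
      · rintro ⟨⟨h1, h2, h3, h4, h5⟩, h6⟩
        refine ⟨h1, h2, h3, by simp, ?_, h5⟩
        rintro _ ⟨⟩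
        exact ⟨isTop_head hk (by omega) h1.2 h2, h6⟩
  · rintro ⟨L, lab⟩ hz
    simp only [coe_filter, mem_product, mem_univ, and_true, mem_monoWords, Set.mem_ofPred_eq] at hz
    obtain ⟨h1, h2, h3, h4, h5⟩ := hz
    simp only [coe_Icc, Set.mem_Icc]
    cases L with
    | nil => simp; omega
    | cons p L =>
      have := h4 p (by simp) (isTop_head hk (by omega) h1.2 h2)
      simp; omega

/-- Without a bound on the transpositions, the factorisations are sorted by the label of the last
point. -/
lemma countA_eq_sum {k : κ} (hk : IsTop k) (ha : 0 < a) (m : ℕ) (len : ι → ℕ) :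
    countA κ a m len = ∑ i, countC κ a a m len i := by
  unfold countA countC countWith
  rw [Finset.card_eq_sum_card_fiberwise (t := univ)
    (f := fun z => z.2 (toLex (k, (⟨a - 1, by omega⟩ : Fin a))))]
  · refine Finset.sum_congr rfl fun j hj => ?_
    congr 1
    ext ⟨L, lab⟩
    simp only [mem_filter, mem_product, mem_univ, and_true, mem_monoWords, isTop_iff hk ha,
      forall_eq]
    have : ∀ p ∈ L, IsTop (ofLex p.2).1 → ((ofLex p.2).2 : ℕ) < a := fun p _ _ => (ofLex p.2).2.2
    tauto
  · exact fun _ _ => by simp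

/-- The map on points induced by a map on blocks. -/
def blockMap {κ' : Type*} (g : κ' → κ) (a : ℕ) (x : κ' ×ₗ Fin a) : κ ×ₗ Fin a :=
  toLex (g (ofLex x).1, (ofLex x).2)

lemma strictMono_blockMap {κ' : Type*} [LinearOrder κ'] {g : κ' → κ} (hg : StrictMono g) :
    StrictMono (blockMap g a) := by
  intro x y h
  rw [Prod.Lex.lt_iff] at h
  rw [blockMap, blockMap, Prod.Lex.toLex_lt_toLex]
  rcases h with h | ⟨h, h'⟩
  · exact Or.inl (hg h)
  · exact Or.inr ⟨congrArg g h, h'⟩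

lemma isDecomposition_blocks (K : Finset κ) :
    IsDecomposition (blockRot κ a) (blockRot {k // k ∈ K} a) (blockRot {k // k ∉ K} a)
      (blockMap Subtype.val a) (blockMap Subtype.val a) := by
  refine ⟨strictMono_blockMap fun _ _ h => h, strictMono_blockMap fun _ _ h => h, ?_, ?_,
    fun _ => rfl, fun _ => rfl⟩
  · intro y₁ y₂ e
    have : ((ofLex y₁).1 : κ) = (ofLex y₂).1 := congrArg (fun z => (ofLex z).1) e
    exact (ofLex y₂).1.2 (this ▸ (ofLex y₁).1.2)
  · intro x
    obtain ⟨⟨k, j⟩, rfl⟩ := toLex.surjective x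
    by_cases hk : k ∈ K
    · exact Or.inl ⟨toLex (⟨k, hk⟩, j), rfl⟩
    · exact Or.inr ⟨toLex (⟨k, hk⟩, j), rfl⟩

lemma mem_range_blockMap (K : Finset κ) (x : κ ×ₗ Fin a) :
    x ∈ Set.range (blockMap (Subtype.val : {k // k ∈ K} → κ) a) ↔ (ofLex x).1 ∈ K := by
  constructor
  · rintro ⟨y, rfl⟩
    exact (ofLex y).1.2
  · intro h
    exact ⟨toLex (⟨_, h⟩, (ofLex x).2), rfl⟩

/-- A block is a cycle of the special permutation, so it never meets two orbits. -/
lemma linked_block (L : List ((κ ×ₗ Fin a) × (κ ×ₗ Fin a))) (k : κ) (j j' : Fin a) :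
    Linked (blockRot κ a) L (toLex (k, j)) (toLex (k, j')) := by
  have key : ∀ j : Fin a, Linked (blockRot κ a) L (toLex (k, ⟨0, j.pos⟩)) (toLex (k, j)) := by
    intro j P hP
    have hpow : ∀ (i : ℕ) x, ((blockRot κ a) ^ i) x ∈ P ↔ x ∈ P := by
      intro i
      induction i with
      | zero => simp
      | succ i ih => intro x; rw [pow_succ', Perm.mul_apply, hP.1, ih]
    rw [← hpow j, blockRot_pow k (by simp)]
    simp
  exact (key j).symm.trans (key j')

/-- The isomorphism of ordered sets of points induced by an isomorphism of ordered sets of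
blocks. -/
def blockIso {κ' : Type*} [LinearOrder κ'] (e : κ' ≃o κ) (a : ℕ) :
    (κ' ×ₗ Fin a) ≃o (κ ×ₗ Fin a) where
  toFun := blockMap e a
  invFun := blockMap e.symm a
  left_inv x := by simp [blockMap]
  right_inv x := by simp [blockMap]
  map_rel_iff' := (strictMono_blockMap e.strictMono).le_iff_le

lemma countA_congr {κ' : Type*} [LinearOrder κ'] [Fintype κ'] (e : κ' ≃o κ) (m : ℕ) (len : ι → ℕ) :
    countA κ a m len = countA κ' a m len :=
  (countWith_congr (blockIso e a) (fun _ => rfl) m len fun _ _ => Iff.rfl).symm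

lemma countC_congr {κ' : Type*} [LinearOrder κ'] [Fintype κ'] (e : κ' ≃o κ) (ℓ m : ℕ) (len : ι → ℕ)
    (i₀ : ι) : countC κ a ℓ m len i₀ = countC κ' a ℓ m len i₀ := by
  refine (countWith_congr (blockIso e a) (fun _ => rfl) m len fun L lab => ?_).symm
  rw [List.forall_mem_map]
  refine and_congr (forall_congr' fun p => imp_congr_right fun _ => ?_) ?_
  · exact imp_congr (e.surjective.forall.trans (by simp [IsTop, blockIso, blockMap])) Iff.rfl
  · rw [(blockIso e a).surjective.forall]
    refine forall_congr' fun x => imp_congr ?_ Iff.rfl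
    exact (blockIso e a).surjective.forall.trans (by simp [IsTop])

/-- The words with two orbits are sorted by the set of blocks of the orbit not containing the last
point. -/
theorem countSplit_blockRot {k : κ} (hk : IsTop k) {ℓ : ℕ} (h0 : 0 < ℓ) (hℓ : ℓ ≤ a) {i₀ b : ι}
    (hb : i₀ ≠ b) {len : ι → ℕ} (hlen : len b ≠ 0) (m : ℕ) :
    countSplit (blockRot κ a) (toLex (k, ⟨ℓ - 1, by omega⟩)) b m len (fun L lab =>
      (∀ p ∈ L, p.2 ≤ toLex (k, ⟨ℓ - 1, by omega⟩)) ∧ lab (toLex (k, ⟨a - 1, by omega⟩)) = i₀) =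
    ∑ K ∈ (univ.erase k).powerset, ∑ c ∈ antidiagonal m, ∑ I ∈ (freeLabels len i₀ b).powerset,
      countA {k // k ∈ K} a c.1 (lenIn len b I) *
      countC {k // k ∉ K} a ℓ c.2 (lenOut len b I) i₀ := by
  set s : κ ×ₗ Fin a := toLex (k, ⟨ℓ - 1, by omega⟩) with hs
  unfold countSplit
  rw [Finset.card_eq_sum_card_fiberwise (t := (univ.erase k).powerset)
    (f := fun z => univ.filter fun k' => ∃ j, ¬ Linked (blockRot κ a) z.1 s (toLex (k', j)))]
  · refine Finset.sum_congr rfl fun K hK => ?_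
    have hkK : k ∉ K := fun h => by simpa using mem_powerset.1 hK h
    have hk' : IsTop (⟨k, hkK⟩ : {k // k ∉ K}) := fun y => hk _
    have hlow : ∀ y, blockMap (Subtype.val : {k // k ∈ K} → κ) a y <
        blockMap (Subtype.val : {k // k ∉ K} → κ) a (toLex (⟨k, hkK⟩, ⟨ℓ - 1, by omega⟩)) := by
      intro y
      rw [blockMap, blockMap, Prod.Lex.toLex_lt_toLex]
      left
      exact lt_of_le_of_ne (hk _) fun e => by
        have h1 := (ofLex y).1.2
        rw [show ((ofLex y).1 : κ) = k from e] at h1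
        exact hkK h1
    have key := card_two_orbits (isDecomposition_blocks (a := a) K) (ι := ι)
      (s := toLex (⟨k, hkK⟩, ⟨ℓ - 1, by omega⟩)) (t := toLex (⟨k, hkK⟩, ⟨a - 1, by omega⟩))
      hlow hb hlen m
    simp only [countC_eq hk' h0 hℓ, countA]
    rw [show (∑ c ∈ antidiagonal m, ∑ I ∈ (freeLabels len i₀ b).powerset, _ = _) from key.symm]
    congr 1
    ext ⟨L, lab⟩
    simp only [mem_filter, mem_product, mem_univ, and_true, and_assoc]
    refine and_congr_right fun hL => ?_
    have e : IsLab (wordPerm L * blockRot κ a) len lab →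
        (((¬ Connected (blockRot κ a) L ∧ ∀ r, lab r = b → Connected (blockRot κ a) ((r, s) :: L)) ∧
          (univ.filter fun k' => ∃ j, ¬ Linked (blockRot κ a) L s (toLex (k', j))) = K) ↔
        (IsInv (blockRot κ a) L (Set.range (blockMap (Subtype.val : {k // k ∈ K} → κ) a)) ∧
          (∀ y y' : {k // k ∈ K} ×ₗ Fin a,
            Linked (blockRot κ a) L (blockMap Subtype.val a y) (blockMap Subtype.val a y')) ∧
          (∀ y y' : {k // k ∉ K} ×ₗ Fin a,
            Linked (blockRot κ a) L (blockMap Subtype.val a y) (blockMap Subtype.val a y')) ∧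
          ∀ r, lab r = b → r ∈ Set.range (blockMap (Subtype.val : {k // k ∈ K} → κ) a))) := by
      intro hl
      have hsU : s ∉ Set.range (blockMap (Subtype.val : {k // k ∈ K} → κ) a) := by
        rw [mem_range_blockMap]; exact hkK
      have hexb : ∃ r, lab r = b := by
        rw [← hl.card_eq, Finset.card_ne_zero] at hlen
        obtain ⟨r, hr⟩ := hlen
        exact ⟨r, by simpa using hr⟩
      have hcompl : ∀ x, x ∉ Set.range (blockMap (Subtype.val : {k // k ∈ K} → κ) a) ↔
          x ∈ Set.range (blockMap (Subtype.val : {k // k ∉ K} → κ) a) := by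
        intro x
        rw [mem_range_blockMap]
        constructor
        · exact fun h => ⟨toLex (⟨_, h⟩, (ofLex x).2), rfl⟩
        · rintro ⟨y, rfl⟩
          exact (ofLex y).1.2
      have h1 := not_connected_and_eq_iff (σ₀ := blockRot κ a) (L := L) hsU hexb
      simp only [hcompl, Set.forall_mem_range] at h1
      rw [← h1]
      refine and_congr_right fun _ => ?_
      rw [Set.ext_iff, Finset.ext_iff]
      simp only [mem_range_blockMap, mem_filter, mem_univ, true_and, Set.mem_ofPred_eq]
      constructor
      · intro h x
        rw [← h]
        constructor
        · exact fun hx => ⟨(ofLex x).2, hx⟩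
        · rintro ⟨j, hj⟩ hx
          exact hj (hx.trans (linked_block L _ _ _))
      · intro h k'
        constructor
        · rintro ⟨j, hj⟩
          exact (h _).1 hj
        · intro hk'
          exact ⟨⟨0, by omega⟩, (h (toLex (k', ⟨0, by omega⟩))).2 hk'⟩
    constructor
    · rintro ⟨h1, h2, h3, h4, h5, h6⟩
      have := (e h3).1 ⟨⟨h1, h2⟩, h6⟩
      exact ⟨this.1, this.2.1, this.2.2.1, this.2.2.2, h3, h4, h5⟩
    · rintro ⟨h1, h2, h3, h4, h5, h6, h7⟩
      have := (e h5).2 ⟨h1, h2, h3, h4⟩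
      exact ⟨this.1.1, this.1.2, h5, h6, h7, this.2⟩
  · rintro ⟨L, lab⟩ -
    simp only [coe_powerset, Set.mem_preimage, Set.mem_powerset_iff, coe_erase, coe_univ]
    intro k' hk'
    simp only [coe_filter, mem_univ, true_and, Set.mem_ofPred_eq] at hk'
    simp only [Set.mem_sdiff, Set.mem_univ, true_and, Set.mem_singleton_iff]
    rintro rfl
    obtain ⟨j, hj⟩ := hk'
    exact hj (linked_block L _ _ _)

/-- The recursion for factorisations with special `σ₀`, in terms of the number `m` of
transpositions. -/
theorem countB_succ {n ℓ : ℕ} (h0 : 0 < ℓ) (hℓ : ℓ ≤ a) {i₀ b : ι} (hb : i₀ ≠ b) {len : ι → ℕ}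
    (hlen : len b = 0) (m : ℕ) :
    countB (Fin (n + 1)) a ℓ (m + 1) len i₀ =
      (if a + 1 ≤ len i₀ + ℓ then ∑ i ∈ univ.filter (fun i => i ≠ i₀ ∧ len i ≠ 0),
        countC (Fin (n + 1)) a ℓ m (mergeLen len i₀ i) i₀ else 0) +
      ∑ c ∈ splittings (len i₀), c.2 * (countC (Fin (n + 1)) a ℓ m (splitLen len i₀ b c) i₀ +
        ∑ j ∈ range (n + 1), n.choose j * ∑ d ∈ antidiagonal m,
          ∑ I ∈ (freeLabels len i₀ b).powerset,
            countA (Fin j) a d.1 (lenIn (splitLen len i₀ b c) b I) *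
            countC (Fin (n + 1 - j)) a ℓ d.2 (lenOut (splitLen len i₀ b c) b I) i₀) := by
  have hk : IsTop (Fin.last n) := fun x => Fin.le_last x
  rw [countB_succ_eq hk h0 hℓ, countWith_succ (isTail_blockRot hk h0 hℓ) hb hlen m]
  simp only [← countC_eq hk h0 hℓ]
  have e0 : a - ℓ + 1 ≤ len i₀ ↔ a + 1 ≤ len i₀ + ℓ := by omega
  simp only [e0]
  congr 1
  refine Finset.sum_congr rfl fun c hc => ?_
  congr 2
  rw [mem_splittings] at hc
  have hcb : splitLen len i₀ b c b ≠ 0 := by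
    rw [splitLen, Function.update_self]; omega
  have hfree : freeLabels (splitLen len i₀ b c) i₀ b = freeLabels len i₀ b := by
    ext i
    simp only [freeLabels, mem_filter, mem_univ, true_and]
    refine and_congr_right fun h1 => and_congr_right fun h2 => ?_
    rw [splitLen, Function.update_of_ne h2, Function.update_of_ne h1]
  rw [countSplit_blockRot hk h0 hℓ hb hcb, hfree]
  have hcardK : ∀ K ∈ ((univ : Finset (Fin (n + 1))).erase (Fin.last n)).powerset,
      (∑ d ∈ antidiagonal m, ∑ I ∈ (freeLabels len i₀ b).powerset,
        countA {k // k ∈ K} a d.1 (lenIn (splitLen len i₀ b c) b I) *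
        countC {k // k ∉ K} a ℓ d.2 (lenOut (splitLen len i₀ b c) b I) i₀) =
      ∑ d ∈ antidiagonal m, ∑ I ∈ (freeLabels len i₀ b).powerset,
        countA (Fin K.card) a d.1 (lenIn (splitLen len i₀ b c) b I) *
        countC (Fin (n + 1 - K.card)) a ℓ d.2 (lenOut (splitLen len i₀ b c) b I) i₀ := by
    intro K _
    have e1 : Fin K.card ≃o {k // k ∈ K} := K.orderIsoOfFin rfl
    have e2 : Fin (n + 1 - K.card) ≃o {k // k ∉ K} :=
      Fintype.orderIsoFinOfCardEq _ (by simp)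
    refine Finset.sum_congr rfl fun d _ => Finset.sum_congr rfl fun I _ => ?_
    rw [countA_congr e1, countC_congr e2]
  rw [Finset.sum_congr rfl hcardK]
  refine (Finset.sum_powerset_apply_card (fun j => ∑ d ∈ antidiagonal m,
    ∑ I ∈ (freeLabels len i₀ b).powerset,
      countA (Fin j) a d.1 (lenIn (splitLen len i₀ b c) b I) *
      countC (Fin (n + 1 - j)) a ℓ d.2 (lenOut (splitLen len i₀ b c) b I) i₀)).trans ?_
  simp

end Blocks

/-! ### Complete homogeneous polynomials in Jucys–Murphy elements -/

section CompleteHomogeneous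

variable {A : Type*} [Ring A]

/-- The complete homogeneous polynomial of degree `m` in `J 0, …, J (k - 1)`; in every monomial, the
indices are decreasing from left to right. -/
def completeHom (J : ℕ → A) : ℕ → ℕ → A
  | _, 0 => 1
  | 0, _ + 1 => 0
  | k + 1, m + 1 => J k * completeHom J (k + 1) m + completeHom J k (m + 1)

variable (J : ℕ → A)

@[simp] lemma completeHom_zero (k : ℕ) : completeHom J k 0 = 1 := by
  cases k <;> simp [completeHom]

lemma completeHom_zero_succ (m : ℕ) : completeHom J 0 (m + 1) = 0 := by simp [completeHom]

lemma completeHom_succ_succ (k m : ℕ) : completeHom J (k + 1) (m + 1) =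
    J k * completeHom J (k + 1) m + completeHom J k (m + 1) := by rw [completeHom]

lemma completeHom_succ_one (k : ℕ) :
    completeHom J (k + 1) 1 = J k + completeHom J k 1 := by
  rw [completeHom_succ_succ, completeHom_zero, mul_one]

/-- Eliminating the polynomials in `J 0, …, J k` from the recursion for two successive indices
leaves only the symmetric expressions in `J k` and `J (k + 1)`. -/
lemma completeHom_two (k m : ℕ) : completeHom J (k + 2) (m + 2) =
    (J (k + 1) + J k) * completeHom J (k + 2) (m + 1) -
      J k * J (k + 1) * completeHom J (k + 2) m + completeHom J k (m + 2) := by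
  have h1 := completeHom_succ_succ J (k + 1) (m + 1)
  have h2 := completeHom_succ_succ J k (m + 1)
  have h3 := completeHom_succ_succ J (k + 1) m
  rw [h1, h2, add_mul, mul_assoc (J k), show J (k + 1) * completeHom J (k + 2) m =
    completeHom J (k + 2) (m + 1) - completeHom J (k + 1) (m + 1) from by rw [h3]; abel, mul_sub]
  abel

variable {J}

/-- A ring endomorphism that fixes the elementary symmetric polynomials in `J j` and `J (j + 1)` and
all the other `J k` fixes the complete homogeneous polynomials. -/
lemma map_completeHom {n : ℕ} (φ : A →+* A) {j : ℕ}
    (hφ : ∀ k < n, k ≠ j → k ≠ j + 1 → φ (J k) = J k)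
    (hadd : φ (J (j + 1) + J j) = J (j + 1) + J j)
    (hmul : φ (J j * J (j + 1)) = J j * J (j + 1)) (k m : ℕ) (hk : k ≤ n) (hkj : k ≠ j + 1) :
    φ (completeHom J k m) = completeHom J k m := by
  induction k using Nat.strong_induction_on generalizing m with
  | _ k ihk =>
    by_cases hk2 : k = j + 2
    · subst hk2
      have hj : ∀ m, φ (completeHom J j m) = completeHom J j m := fun m =>
        ihk j (by omega) m (by omega) (by omega)
      induction m using Nat.strong_induction_on with
      | _ m ihm =>
        match m with
        | 0 => simp
        | 1 =>
          rw [completeHom_succ_one, completeHom_succ_one, ← add_assoc, map_add, hadd, hj]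
        | m + 2 =>
          rw [completeHom_two, map_add, map_sub, map_mul, map_mul, hadd, hmul,
            ihm m (by omega), ihm (m + 1) (by omega), hj]
    · induction m with
      | zero => simp
      | succ m ihm =>
        cases k with
        | zero => rw [completeHom_zero_succ, map_zero]
        | succ k =>
          rw [completeHom_succ_succ, map_add, map_mul, hφ k (by omega) (by omega) (by omega), ihm,
            ihk k (by omega) _ (by omega) (by omega)]

end CompleteHomogeneous

section JucysMurphy

variable {n : ℕ}

/-- The monoid that records, for a word, the product of its transpositions and the sets respected by
its transpositions: the second component is the indicator function of the family of these
sets. -/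
abbrev TrackMonoid (X : Type*) : Type _ := Perm X × (Set X → ℕ)

/-- The element of the tracking monoid given by a transposition. -/
noncomputable def trElem {X : Type*} [DecidableEq X] (r s : X) : TrackMonoid X :=
  (swap r s, fun P => if (r ∈ P ↔ s ∈ P) then 1 else 0)

/-- The element of the tracking monoid given by a word. -/
noncomputable def wordElem {X : Type*} [DecidableEq X] (L : List (X × X)) : TrackMonoid X :=
  (L.map fun p => trElem p.1 p.2).prod

section
variable {X : Type*} [DecidableEq X]

lemma wordElem_cons (p : X × X) (L : List (X × X)) :
    wordElem (p :: L) = trElem p.1 p.2 * wordElem L := by simp [wordElem]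

lemma wordElem_fst (L : List (X × X)) : (wordElem L).1 = wordPerm L := by
  induction L with
  | nil => rfl
  | cons p L ih => rw [wordElem_cons, wordPerm_cons, Prod.fst_mul, ih]; rfl

lemma wordElem_snd_ne_zero (L : List (X × X)) (P : Set X) :
    (wordElem L).2 P ≠ 0 ↔ ∀ p ∈ L, (p.1 ∈ P ↔ p.2 ∈ P) := by
  induction L with
  | nil => simp [wordElem]
  | cons p L ih =>
    rw [wordElem_cons, Prod.snd_mul, Pi.mul_apply, mul_ne_zero_iff, ih, List.forall_mem_cons]
    simp [trElem]

/-- Relabelling the points by `w`. -/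
def relabel (w : Perm X) : TrackMonoid X →* TrackMonoid X where
  toFun z := (w * z.1 * w⁻¹, fun P => z.2 (w ⁻¹' P))
  map_one' := by ext <;> simp
  map_mul' z z' := by
    refine Prod.ext ?_ rfl
    simp [mul_assoc]

lemma relabel_trElem (w : Perm X) (r s : X) : relabel w (trElem r s) = trElem (w r) (w s) := by
  refine Prod.ext ?_ rfl
  exact (swap_apply_apply w r s).symm

lemma trElem_comm_of_disjoint {r s r' s' : X} (h1 : r ≠ r') (h2 : r ≠ s') (h3 : s ≠ r')
    (h4 : s ≠ s') : trElem r s * trElem r' s' = trElem r' s' * trElem r s := by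
  refine Prod.ext ?_ (mul_comm _ _)
  change swap r s * swap r' s' = swap r' s' * swap r s
  ext x
  simp only [Perm.mul_apply, swap_apply_def]
  grind

/-- The relation between transpositions with a common point; it holds in the tracking monoid
since, on both sides, the second component indicates the sets that separate no two of the three
points. -/
lemma trElem_mul_trElem {r s s' : X} (h1 : r ≠ s) (h2 : r ≠ s') (h3 : s ≠ s') :
    trElem r s * trElem r s' = trElem r s' * trElem s s' := by
  refine Prod.ext ?_ ?_
  · change swap r s * swap r s' = swap r s' * swap s s'
    ext x
    simp only [Perm.mul_apply, swap_apply_def]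
    grind
  · funext P
    simp only [Prod.snd_mul, Pi.mul_apply, trElem]
    by_cases r ∈ P <;> by_cases s ∈ P <;> by_cases s' ∈ P <;> simp [*]

lemma trElem_comm (r s : X) : trElem r s = trElem s r := by
  refine Prod.ext (swap_comm _ _) ?_
  funext P
  simp only [trElem, iff_comm]

end

/-- The Jucys–Murphy element `∑ r < k, (r k)`. -/
noncomputable def jucysMurphy (n k : ℕ) : MonoidAlgebra ℤ (TrackMonoid (Fin n)) :=
  ∑ p ∈ univ.filter (fun p : Fin n × Fin n => p.1 < p.2 ∧ (p.2 : ℕ) = k),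
    MonoidAlgebra.of ℤ _ (trElem p.1 p.2)

lemma jucysMurphy_coe (s : Fin n) : jucysMurphy n s =
    ∑ r ∈ univ.filter (· < s), MonoidAlgebra.of ℤ _ (trElem r s) := by
  unfold jucysMurphy
  refine (Finset.sum_bij (fun r _ => (r, s)) ?_ ?_ ?_ ?_).symm
  · intro r hr
    simpa using hr
  · intro r _ r' _ h
    exact congrArg Prod.fst h
  · rintro ⟨r, s'⟩ h
    simp only [mem_filter, mem_univ, true_and, Fin.val_inj] at h
    obtain ⟨h1, rfl⟩ := h
    exact ⟨r, by simpa using h1, rfl⟩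
  · intro r _
    rfl

/-- Expanding the complete homogeneous polynomials in the Jucys–Murphy elements gives the sum over
all monotone words. -/
lemma sum_wordElem (n k m : ℕ) :
    ∑ L ∈ (monoWords (Fin n) m).filter (fun L => ∀ p ∈ L, (p.2 : ℕ) < k),
      MonoidAlgebra.of ℤ _ (wordElem L) = completeHom (jucysMurphy n) k m := by
  induction k generalizing m with
  | zero =>
    cases m with
    | zero =>
      rw [completeHom_zero, Finset.sum_eq_single []]
      · exact map_one _
      · intro L hL hne
        simp only [mem_filter, mem_monoWords, List.length_eq_zero_iff] at hL
        exact absurd hL.1.1 hne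
      · intro h
        exact absurd (by simp [mem_monoWords, isMonoWord_nil]) h
    | succ m =>
      rw [completeHom_zero_succ, Finset.sum_eq_zero]
      intro L hL
      simp only [mem_filter, mem_monoWords] at hL
      cases L with
      | nil => simp at hL
      | cons p L => exact absurd (hL.2 p (by simp)) (Nat.not_lt_zero _)
  | succ k ihk =>
    induction m with
    | zero =>
      rw [completeHom_zero, Finset.sum_eq_single []]
      · exact map_one _
      · intro L hL hne
        simp only [mem_filter, mem_monoWords, List.length_eq_zero_iff] at hL
        exact absurd hL.1.1 hne
      · intro h
        exact absurd (by simp [mem_monoWords, isMonoWord_nil]) h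
    | succ m ihm =>
      rw [completeHom_succ_succ, ← ihk, ← ihm,
        ← Finset.sum_filter_add_sum_filter_not _ (fun L => ∀ p ∈ L, (p.2 : ℕ) < k), add_comm,
        filter_filter, filter_filter]
      congr 1
      · rw [jucysMurphy, Finset.sum_mul_sum, ← Finset.sum_product']
        symm
        refine Finset.sum_bij (fun z _ => z.1 :: z.2) ?_ ?_ ?_ ?_
        · rintro ⟨p, L⟩ h
          simp only [mem_product, mem_filter, mem_univ, true_and, mem_monoWords] at h ⊢
          obtain ⟨⟨h1, h2⟩, ⟨h3, h4⟩, h5⟩ := h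
          refine ⟨⟨by simp [h3], isMonoWord_cons.2 ⟨h1, ?_, h4⟩⟩, ?_, ?_⟩
          · intro q hq
            rw [Fin.le_def]
            have := h5 q hq
            omega
          · intro q hq
            rcases List.mem_cons.1 hq with rfl | hq
            · omega
            · exact h5 q hq
          · intro h
            have := h p (by simp)
            omega
        · rintro ⟨p, L⟩ - ⟨p', L'⟩ - h
          simpa using h
        · rintro L h
          simp only [mem_filter, mem_monoWords] at h
          obtain ⟨⟨h1, h2⟩, h3, h4⟩ := h
          cases L with
          | nil => simp at h1
          | cons p L =>
            rw [isMonoWord_cons] at h2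
            refine ⟨(p, L), ?_, rfl⟩
            simp only [mem_product, mem_filter, mem_univ, true_and, mem_monoWords]
            refine ⟨⟨h2.1, ?_⟩, ⟨by simpa using h1, h2.2.2⟩, fun q hq => h3 q (by simp [hq])⟩
            by_contra hne
            apply h4
            have hp := h3 p (by simp)
            intro q hq
            rcases List.mem_cons.1 hq with rfl | hq
            · omega
            · have := h2.2.1 q hq
              rw [Fin.le_def] at this
              omega
        · rintro ⟨p, L⟩ -
          rw [wordElem_cons, map_mul]
      · refine Finset.sum_congr ?_ fun _ _ => rfl
        ext L
        simp only [mem_filter]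
        refine and_congr_right fun _ => ⟨fun h => h.2, fun h => ⟨fun p hp => ?_, h⟩⟩
        have := h p hp
        omega

/-- The sum of all monotone words is invariant under the exchange of two adjacent points. -/
lemma map_completeHom_jucysMurphy (j : Fin n) (m : ℕ) :
    MonoidAlgebra.mapDomainRingHom ℤ (relabel (swap j.castSucc j.succ))
      (completeHom (jucysMurphy (n + 1)) (n + 1) m) =
        completeHom (jucysMurphy (n + 1)) (n + 1) m := by
  set t := swap j.castSucc j.succ with ht
  set φ := MonoidAlgebra.mapDomainRingHom ℤ (relabel t) with hφ
  have hof : ∀ r s : Fin (n + 1), φ (MonoidAlgebra.of ℤ _ (trElem r s)) =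
      MonoidAlgebra.of ℤ _ (trElem (t r) (t s)) := by
    intro r s
    rw [← relabel_trElem, hφ]
    simp
  have htl : t j.castSucc = j.succ := swap_apply_left _ _
  have htr : t j.succ = j.castSucc := swap_apply_right _ _
  have htn : ∀ r : Fin (n + 1), r ≠ j.castSucc → r ≠ j.succ → t r = r := fun r h h' =>
    swap_apply_of_ne_of_ne h h'
  have hlt : ∀ r ∈ univ.filter (fun r : Fin (n + 1) => r < j.castSucc),
      r ≠ j.castSucc ∧ r ≠ j.succ := by
    intro r hr
    simp only [mem_filter, mem_univ, true_and, Fin.lt_def, Fin.val_castSucc] at hr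
    simp only [ne_eq, Fin.ext_iff, Fin.val_castSucc, Fin.val_succ]
    omega
  have hne : j.castSucc ≠ j.succ := by
    simp [Fin.ext_iff]
  set x : Fin (n + 1) → MonoidAlgebra ℤ (TrackMonoid (Fin (n + 1))) := fun r =>
    MonoidAlgebra.of ℤ _ (trElem r j.castSucc) with hx
  set y : Fin (n + 1) → MonoidAlgebra ℤ (TrackMonoid (Fin (n + 1))) := fun r =>
    MonoidAlgebra.of ℤ _ (trElem r j.succ) with hy
  set T : MonoidAlgebra ℤ (TrackMonoid (Fin (n + 1))) :=
    MonoidAlgebra.of ℤ _ (trElem j.castSucc j.succ) with hT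
  set R := univ.filter (fun r : Fin (n + 1) => r < j.castSucc) with hR
  have hJ0 : jucysMurphy (n + 1) j = ∑ r ∈ R, x r := by
    have := jucysMurphy_coe (j.castSucc)
    rwa [Fin.val_castSucc] at this
  have hJ1 : jucysMurphy (n + 1) (j + 1) = ∑ r ∈ R, y r + T := by
    have := jucysMurphy_coe (j.succ)
    rw [Fin.val_succ] at this
    rw [this, show univ.filter (fun r : Fin (n + 1) => r < j.succ) = insert j.castSucc R from ?_,
      Finset.sum_insert]
    · exact add_comm _ _
    · simp [hR]
    · ext r
      simp only [hR, mem_filter, mem_univ, true_and, mem_insert, Fin.lt_def, Fin.val_succ,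
        Fin.ext_iff, Fin.val_castSucc]
      omega
  have hφx : ∀ r ∈ R, φ (x r) = y r := by
    intro r hr
    rw [hx, hy]
    simp only
    rw [hof, htl, htn r (hlt r hr).1 (hlt r hr).2]
  have hφy : ∀ r ∈ R, φ (y r) = x r := by
    intro r hr
    rw [hx, hy]
    simp only
    rw [hof, htr, htn r (hlt r hr).1 (hlt r hr).2]
  have hφT : φ T = T := by
    rw [hT, hof, htl, htr, trElem_comm]
  refine map_completeHom (n := n + 1) φ (j := j) ?_ ?_ ?_ _ _ le_rfl ?_
  · intro k hk hk1 hk2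
    unfold jucysMurphy
    rw [map_sum]
    have hts : ∀ r s : Fin (n + 1), r < s → (s : ℕ) = k → t s = s ∧ t r < s := by
      intro r s hrs hs
      have hs1 : s ≠ j.castSucc := fun h => hk1 (by rw [← hs, h]; rfl)
      have hs2 : s ≠ j.succ := fun h => hk2 (by rw [← hs, h]; rfl)
      refine ⟨htn s hs1 hs2, ?_⟩
      by_cases hr1 : r = j.castSucc
      · subst hr1
        rw [htl]
        simp only [Fin.lt_def, ne_eq, Fin.ext_iff, Fin.val_castSucc, Fin.val_succ] at *
        omega
      by_cases hr2 : r = j.succ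
      · subst hr2
        rw [htr]
        simp only [Fin.lt_def, ne_eq, Fin.ext_iff, Fin.val_castSucc, Fin.val_succ] at *
        omega
      · rwa [htn r hr1 hr2]
    refine Finset.sum_bij' (fun p _ => (t p.1, p.2)) (fun p _ => (t p.1, p.2)) ?_ ?_ ?_ ?_ ?_
    all_goals
      rintro ⟨r, s⟩ hp
      simp only [mem_filter, mem_univ, true_and] at hp
    · simpa using ⟨(hts r s hp.1 hp.2).2, hp.2⟩
    · simpa using ⟨(hts r s hp.1 hp.2).2, hp.2⟩
    · simp [ht]
    · simp [ht]
    · rw [hof, (hts r s hp.1 hp.2).1]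
  · rw [hJ0, hJ1, map_add, map_add, map_sum, map_sum, hφT, Finset.sum_congr rfl hφx,
      Finset.sum_congr rfl hφy]
    abel
  · -- the terms with `r = r'` of each double product cancel against the products with `T`
    have hxy : ∀ r ∈ R, x r * y r = y r * T := fun r hr => by
      rw [hx, hy, hT, ← map_mul, ← map_mul, trElem_mul_trElem (hlt r hr).1 (hlt r hr).2 hne]
    have hyx : ∀ r ∈ R, y r * x r = x r * T := fun r hr => by
      rw [hx, hy, hT, ← map_mul, ← map_mul, trElem_mul_trElem (hlt r hr).2 (hlt r hr).1 hne.symm,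
        trElem_comm j.succ]
    have hcomm : ∀ r ∈ R, ∀ r' ∈ R, r ≠ r' → y r * x r' = x r' * y r := fun r hr r' hr' h => by
      rw [hx, hy, ← map_mul, ← map_mul, trElem_comm_of_disjoint h (hlt r hr).1
        (hlt r' hr').2.symm hne.symm]
    rw [hJ0, hJ1, mul_add, map_add, map_mul, map_mul, map_sum, map_sum, hφT,
      Finset.sum_congr rfl hφx, Finset.sum_congr rfl hφy]
    have h1 : (∑ r ∈ R, x r) * ∑ r ∈ R, y r =
        ∑ r ∈ R, y r * T + ∑ r ∈ R, ∑ r' ∈ R.erase r, x r' * y r := by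
      rw [Finset.sum_mul_sum, Finset.sum_comm, ← Finset.sum_add_distrib]
      refine Finset.sum_congr rfl fun r hr => ?_
      rw [← Finset.add_sum_erase _ _ hr, hxy r hr]
    have h2 : (∑ r ∈ R, y r) * ∑ r ∈ R, x r =
        ∑ r ∈ R, x r * T + ∑ r ∈ R, ∑ r' ∈ R.erase r, x r' * y r := by
      rw [Finset.sum_mul_sum, ← Finset.sum_add_distrib]
      refine Finset.sum_congr rfl fun r hr => ?_
      rw [← Finset.add_sum_erase _ _ hr, hyx r hr]
      congr 1
      refine Finset.sum_congr rfl fun r' hr' => ?_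
      rw [mem_erase] at hr'
      exact hcomm r hr r' hr'.2 hr'.1.symm
    rw [h1, h2, Finset.sum_mul, Finset.sum_mul]
    abel
  · have := j.2
    omega

/-- Sums over the monotone words of functions of the recorded data do not depend on the numbering of
the points. -/
lemma sum_relabel_wordElem (m : ℕ) (w : Perm (Fin n)) (f : TrackMonoid (Fin n) → ℤ) :
    ∑ L ∈ monoWords (Fin n) m, f (relabel w (wordElem L)) =
      ∑ L ∈ monoWords (Fin n) m, f (wordElem L) := by
  cases n with
  | zero =>
    refine Finset.sum_congr rfl fun L _ => ?_
    congr 1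
    refine Prod.ext (Subsingleton.elim _ _) ?_
    funext P
    exact congrArg (wordElem L).2 (Set.ext fun x => x.elim0)
  | succ n =>
    have hw : w ∈ Submonoid.closure (Set.range fun i : Fin n => swap i.castSucc i.succ) := by
      rw [mclosure_swap_castSucc_succ]
      trivial
    induction hw using Submonoid.closure_induction generalizing f with
    | mem w hw =>
      obtain ⟨j, rfl⟩ := hw
      have h := map_completeHom_jucysMurphy j m
      have hfil : (monoWords (Fin (n + 1)) m).filter (fun L => ∀ p ∈ L, (p.2 : ℕ) < n + 1) =
          monoWords (Fin (n + 1)) m := filter_true_of_mem fun L _ p _ => p.2.2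
      rw [← sum_wordElem, hfil, map_sum] at h
      have h' := congrArg (fun z => Finsupp.linearCombination ℤ f
        (MonoidAlgebra.coeffLinearEquiv ℤ z)) h
      simp only [map_sum, MonoidAlgebra.mapDomainRingHom_apply, MonoidAlgebra.of_apply,
        MonoidAlgebra.mapDomain_single] at h'
      have key : ∀ z : TrackMonoid (Fin (n + 1)), Finsupp.linearCombination ℤ f
          (MonoidAlgebra.coeffLinearEquiv ℤ (MonoidAlgebra.single z (1 : ℤ))) = f z := fun z => by
        refine (Finsupp.linearCombination_single ℤ 1 z).trans ?_
        rw [one_smul]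
      simpa only [key] using h'
    | one =>
      refine Finset.sum_congr rfl fun L _ => ?_
      congr 1
    | mul w w' _ _ ih ih' =>
      rw [← ih f, ← ih' fun z => f (relabel w z)]
      refine Finset.sum_congr rfl fun L _ => ?_
      congr 1

end JucysMurphy

lemma isLab_comp_iff {X Y ι : Type*} [Fintype X] [Fintype Y]
    (e : X ≃ Y) {τ : Perm X} {τ' : Perm Y} (h : ∀ x, τ' (e x) = e (τ x)) (len : ι → ℕ)
    (lab : Y → ι) : IsLab τ' len lab ↔ IsLab τ len (lab ∘ e) := by
  have hcard : ∀ i, (univ.filter fun x => (lab ∘ e) x = i).card =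
      (univ.filter fun y => lab y = i).card := by
    intro i
    rw [← card_map e.toEmbedding]
    congr 1
    ext y
    simp only [mem_map, mem_filter, mem_univ, true_and, Function.comp_apply]
    exact ⟨by rintro ⟨x, hx, rfl⟩; exact hx, fun hy => ⟨e.symm y, by simpa using hy, by simp⟩⟩
  constructor
  · rintro ⟨h1, h2⟩
    refine ⟨fun x y => ?_, fun i => (hcard i).trans (h2 i)⟩
    rw [← sameCycle_map_iff e.injective h, ← h1]
    rfl
  · rintro ⟨h1, h2⟩
    refine ⟨fun x y => ?_, fun i => (hcard i).symm.trans (h2 i)⟩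
    obtain ⟨x, rfl⟩ := e.surjective x
    obtain ⟨y, rfl⟩ := e.surjective y
    rw [sameCycle_map_iff e.injective h, ← h1]
    rfl

/-- The number of connected factorisations depends only on the conjugacy class of the initial
permutation. -/
theorem countWith_conj {ι : Type*} [Fintype ι] {d : ℕ} (σ w : Perm (Fin d)) (m : ℕ)
    (len : ι → ℕ) :
    countWith (w⁻¹ * σ * w) m len (fun _ _ => True) = countWith σ m len (fun _ _ => True) := by
  set f : Perm (Fin d) → TrackMonoid (Fin d) → ℤ := fun σ z =>
    if ∀ P, (∀ x, σ x ∈ P ↔ x ∈ P) → z.2 P ≠ 0 → ∀ x y, (x ∈ P ↔ y ∈ P) then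
      ((univ.filter fun lab : Fin d → ι => IsLab (z.1 * σ) len lab).card : ℤ) else 0 with hf
  have hcount : ∀ σ, (countWith σ m len (fun _ _ => True) : ℤ) =
      ∑ L ∈ monoWords (Fin d) m, f σ (wordElem L) := by
    intro σ
    rw [countWith, @card_filter_product _ _ _ _ _ _ (fun L => Connected σ L)
      (fun _ => Classical.propDecidable _)
      (fun L lab => IsLab (wordPerm L * σ) len lab) (fun _ _ => Classical.propDecidable _)
      (fun L _ lab _ => by simp), sum_filter,
      Nat.cast_sum]
    refine Finset.sum_congr rfl fun L _ => ?_
    have hc : Connected σ L ↔ ∀ P, (∀ x, σ x ∈ P ↔ x ∈ P) → (wordElem L).2 P ≠ 0 →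
        ∀ x y, (x ∈ P ↔ y ∈ P) := by
      simp only [wordElem_snd_ne_zero]
      exact ⟨fun h P h1 h2 x y => h x y P ⟨h1, h2⟩, fun h x y P hP => h P hP.1 hP.2 x y⟩
    rw [hf]
    simp only [hc, wordElem_fst, Nat.cast_ite, Nat.cast_zero]
  have hrel : ∀ z, f σ (relabel w z) = f (w⁻¹ * σ * w) z := by
    intro z
    have h1 : (∀ P, (∀ x, σ x ∈ P ↔ x ∈ P) → (relabel w z).2 P ≠ 0 → ∀ x y, (x ∈ P ↔ y ∈ P)) ↔
        ∀ P, (∀ x, (w⁻¹ * σ * w) x ∈ P ↔ x ∈ P) → z.2 P ≠ 0 → ∀ x y, (x ∈ P ↔ y ∈ P) := by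
      constructor
      · intro h P hP hz x y
        have := h (⇑(w⁻¹) ⁻¹' P) (fun x => by simpa using hP (w⁻¹ x))
          (by
            change z.2 (w ⁻¹' (⇑(w⁻¹) ⁻¹' P)) ≠ 0
            convert hz
            ext x
            simp) (w x) (w y)
        simpa using this
      · intro h P hP hz x y
        have := h (w ⁻¹' P) (fun x => by simpa using hP (w x)) hz (w⁻¹ x) (w⁻¹ y)
        simpa using this
    have h2 : (univ.filter fun lab : Fin d → ι => IsLab ((relabel w z).1 * σ) len lab).card =
        (univ.filter fun lab : Fin d → ι => IsLab (z.1 * (w⁻¹ * σ * w)) len lab).card := by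
      refine Finset.card_bij' (fun lab _ => lab ∘ w) (fun lab _ => lab ∘ ⇑w⁻¹) ?_ ?_ ?_ ?_
      · intro lab hlab
        rw [mem_filter] at hlab ⊢
        refine ⟨mem_univ _, (isLab_comp_iff w (fun x => ?_) len lab).1 hlab.2⟩
        simp [relabel]
      · intro lab hlab
        rw [mem_filter] at hlab ⊢
        refine ⟨mem_univ _, (isLab_comp_iff w⁻¹ (fun x => ?_) len lab).1 hlab.2⟩
        simp [relabel]
      · intro lab _
        funext x
        simp
      · intro lab _
        funext x
        simp
    rw [hf]
    simp only [h1, h2]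
  have := sum_relabel_wordElem m w (f σ)
  rw [← hcount, Finset.sum_congr rfl fun L _ => hrel _, ← hcount] at this
  exact_mod_cast this

/-! ### Sequences of transpositions and words -/

section Sequences

/-- The sequence of transpositions encoded by a word of length `m`; if the word is too short, the
sequence is continued with the identity. -/
def wordSeq {X : Type*} [DecidableEq X] (m : ℕ) (L : List (X × X)) (i : Fin m) : Perm X :=
  (L.reverse[(i : ℕ)]?).elim 1 fun p => swap p.1 p.2

lemma ofFn_wordSeq {X : Type*} [DecidableEq X] {m : ℕ} {L : List (X × X)} (hL : L.length = m) :
    List.ofFn (wordSeq m L) = (L.map fun p => swap p.1 p.2).reverse := by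
  subst hL
  refine List.ext_getElem (by simp) fun i h1 h2 => ?_
  have h3 : i < L.reverse.length := by simpa using h1
  rw [List.getElem_ofFn]
  simp only [wordSeq]
  rw [List.getElem?_eq_getElem h3]
  simp

lemma wordSeq_apply {X : Type*} [DecidableEq X] {m : ℕ} {L : List (X × X)} (hL : L.length = m)
    (i : Fin m) : wordSeq m L i =
      swap (L.reverse[(i : ℕ)]'(by simp [hL])).1 (L.reverse[(i : ℕ)]'(by simp [hL])).2 := by
  simp only [wordSeq]
  rw [List.getElem?_eq_getElem (by simp [hL])]
  rfl

lemma swap_injective_of_lt {X : Type*} [LinearOrder X] {r s r' s' : X} (h : r < s) (h' : r' < s')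
    (e : swap r s = swap r' s') : r = r' ∧ s = s' := by
  have h1 : swap r' s' r = s := by rw [← e, swap_apply_left]
  have h2 : swap r' s' s = r := by rw [← e, swap_apply_right]
  by_cases hr : r = r'
  · subst hr
    rw [swap_apply_left] at h1
    exact ⟨rfl, h1.symm⟩
  · by_cases hr' : r = s'
    · subst hr'
      rw [swap_apply_right] at h1
      subst h1
      exact absurd (h.trans h') (lt_irrefl _)
    · rw [swap_apply_of_ne_of_ne hr hr'] at h1
      exact absurd h1 h.ne

lemma leftToRightProd_wordSeq {d m : ℕ} {L : List (Fin d × Fin d)} (hL : L.length = m)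
    (σ₀ : Perm (Fin d)) : leftToRightProd σ₀ (wordSeq m L) = wordPerm L * σ₀ := by
  rw [leftToRightProd, ofFn_wordSeq hL, List.reverse_reverse, wordPerm]

lemma isMonotoneSeq_wordSeq {d m : ℕ} {L : List (Fin d × Fin d)} (hL : L.length = m)
    (h : IsMonoWord L) : IsMonotoneSeq (wordSeq m L) := by
  refine ⟨fun i => (L.reverse[(i : ℕ)]'(by simp [hL])).1,
    fun i => (L.reverse[(i : ℕ)]'(by simp [hL])).2, fun i => ⟨?_, wordSeq_apply hL i⟩, ?_⟩
  · exact h.1 _ (List.mem_reverse.1 (List.getElem_mem _))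
  · intro i j hij
    rcases hij.lt_or_eq with hij | rfl
    · have := List.pairwise_reverse.2 h.2
      exact List.pairwise_iff_getElem.1 this i j (by simp [hL]) (by simp [hL]) hij
    · exact le_rfl

lemma exists_word_of_isMonotoneSeq {d m : ℕ} {σ : Fin m → Perm (Fin d)} (h : IsMonotoneSeq σ) :
    ∃ L : List (Fin d × Fin d), L.length = m ∧ IsMonoWord L ∧ wordSeq m L = σ := by
  obtain ⟨r, s, hrs, hs⟩ := h
  have hlen : (List.ofFn fun i => (r i, s i)).reverse.length = m := by simp
  refine ⟨(List.ofFn fun i => (r i, s i)).reverse, hlen, ⟨?_, ?_⟩, ?_⟩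
  · intro p hp
    rw [List.mem_reverse, List.mem_ofFn] at hp
    obtain ⟨i, rfl⟩ := hp
    exact (hrs i).1
  · rw [List.pairwise_reverse, List.pairwise_ofFn]
    exact fun i j hij => hs hij.le
  · funext i
    rw [wordSeq_apply hlen, (hrs i).2]
    simp

lemma wordSeq_injOn {d m : ℕ} {L L' : List (Fin d × Fin d)} (hL : L.length = m)
    (hL' : L'.length = m) (h : IsMonoWord L) (h' : IsMonoWord L')
    (e : wordSeq m L = wordSeq m L') : L = L' := by
  rw [← List.reverse_inj]
  refine List.ext_getElem (by simp [hL, hL']) fun i h1 h2 => ?_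
  have hi : i < m := by simpa [hL] using h1
  have he := congrFun e ⟨i, hi⟩
  rw [wordSeq_apply hL, wordSeq_apply hL'] at he
  obtain ⟨e1, e2⟩ := swap_injective_of_lt (h.1 _ (List.mem_reverse.1 (List.getElem_mem _)))
    (h'.1 _ (List.mem_reverse.1 (List.getElem_mem _))) he
  exact Prod.ext e1 e2

/-- The group generated by `σ₀` and the transpositions is transitive if and only if no invariant
set separates two points. -/
lemma isPretransitive_iff_connected {d m : ℕ} {L : List (Fin d × Fin d)} (hL : L.length = m)
    (σ₀ : Perm (Fin d)) :
    MulAction.IsPretransitive (Subgroup.closure (insert σ₀ (Set.range (wordSeq m L)))) (Fin d) ↔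
      Connected σ₀ L := by
  set G := Subgroup.closure (insert σ₀ (Set.range (wordSeq m L))) with hG
  have hmem : ∀ p ∈ L, swap p.1 p.2 ∈ G := by
    intro p hp
    obtain ⟨i, hi, hip⟩ := List.getElem_of_mem (List.mem_reverse.2 hp)
    refine Subgroup.subset_closure (Or.inr ⟨⟨i, by simpa [hL] using hi⟩, ?_⟩)
    rw [wordSeq_apply hL]
    simp only [hip]
  constructor
  · intro h x y P hP
    obtain ⟨⟨g, hg⟩, rfl⟩ := h.exists_smul_eq x y
    change x ∈ P ↔ g x ∈ P
    have : ∀ x, g x ∈ P ↔ x ∈ P := by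
      induction hg using Subgroup.closure_induction with
      | mem g hg =>
        rcases hg with rfl | ⟨i, rfl⟩
        · exact hP.1
        · intro x
          rw [wordSeq_apply hL]
          have hp := hP.2 _ (List.mem_reverse.1 (List.getElem_mem (l := L.reverse) (n := i)
            (by simp [hL])))
          rw [swap_apply_def]
          split_ifs with h1 h2
          · rw [h1]; exact hp.symm
          · rw [h2]; exact hp
          · rfl
      | one => exact fun _ => Iff.rfl
      | mul g g' _ _ ih ih' => exact fun x => (ih _).trans (ih' x)
      | inv g _ ih =>
        exact fun x => by rw [← ih (g⁻¹ x), ← Perm.mul_apply, mul_inv_cancel, Perm.one_apply]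
    exact (this x).symm
  · intro h
    refine ⟨fun x y => ?_⟩
    have hP : IsInv σ₀ L {z | ∃ g : G, g • x = z} := by
      have hmul : ∀ g ∈ G, ∀ z, (∃ g : G, g • x = z) → ∃ g' : G, g' • x = g z := by
        rintro g hg z ⟨g', rfl⟩
        exact ⟨⟨g, hg⟩ * g', mul_smul _ _ _⟩
      refine ⟨fun z => ⟨fun hz => ?_, fun hz => ?_⟩, fun p hp => ⟨fun hz => ?_, fun hz => ?_⟩⟩
      · have := hmul σ₀⁻¹ (G.inv_mem (Subgroup.subset_closure (Or.inl rfl))) _ hz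
        rwa [← Perm.mul_apply, inv_mul_cancel, Perm.one_apply] at this
      · exact hmul σ₀ (Subgroup.subset_closure (Or.inl rfl)) _ hz
      · have := hmul _ (hmem p hp) _ hz
        rwa [swap_apply_left] at this
      · have := hmul _ (hmem p hp) _ hz
        rwa [swap_apply_right] at this
    exact (h x y _ hP).1 ⟨1, one_smul _ _⟩

/-- For positive lengths, the surjectivity of a cycle labelling is automatic. -/
lemma isCycleLabelling_iff {d : ℕ} {μ : List ℕ} (hμ : ∀ x ∈ μ, 0 < x) (τ : Perm (Fin d))
    (lab : Fin d → Fin μ.length) : IsCycleLabelling μ τ lab ↔ IsLab τ μ.get lab := by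
  have hcard : ∀ i, Nat.card {x // lab x = i} = μ.get i ↔
      (@filter _ (fun x => lab x = i) (fun _ => Classical.propDecidable _) univ).card =
        μ.get i := by
    intro i
    rw [Nat.card_eq_fintype_card, Fintype.card_subtype]
    constructor <;> intro h <;> convert h
  constructor
  · rintro ⟨h1, -, h3⟩
    exact ⟨h1, fun i => (hcard i).1 (h3 i)⟩
  · rintro ⟨h1, h2⟩
    refine ⟨h1, fun i => ?_, fun i => (hcard i).2 (h2 i)⟩
    have h3 := hμ _ (List.get_mem μ i)
    have h4 := (hcard i).2 (h2 i)
    rw [← h4, Nat.card_pos_iff] at h3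
    obtain ⟨⟨x, hx⟩⟩ := h3.1
    exact ⟨x, hx⟩

/-- Factorisations with fixed `σ₀`, as sequences of transpositions or as words. -/
lemma card_sequences {d m : ℕ} {μ : List ℕ} (hμ : ∀ x ∈ μ, 0 < x) (σ₀ : Perm (Fin d))
    {Q' : (Fin m → Perm (Fin d)) → (Fin d → Fin μ.length) → Prop}
    {Q : List (Fin d × Fin d) → (Fin d → Fin μ.length) → Prop}
    (hQ : ∀ L, L.length = m → IsMonoWord L → ∀ lab, IsLab (wordPerm L * σ₀) μ.get lab →
      Connected σ₀ L → (Q' (wordSeq m L) lab ↔ Q L lab)) :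
    ((univ : Finset ((Fin m → Perm (Fin d)) × (Fin d → Fin μ.length))).filter fun z =>
      IsMonotoneSeq z.1 ∧ IsCycleLabelling μ (leftToRightProd σ₀ z.1) z.2 ∧
      MulAction.IsPretransitive (Subgroup.closure (insert σ₀ (Set.range z.1))) (Fin d) ∧
      Q' z.1 z.2).card = countWith σ₀ m μ.get Q := by
  symm
  have hiff : ∀ L, L.length = m → IsMonoWord L → ∀ lab,
      (IsMonotoneSeq (wordSeq m L) ∧
        IsCycleLabelling μ (leftToRightProd σ₀ (wordSeq m L)) lab ∧
      MulAction.IsPretransitive (Subgroup.closure (insert σ₀ (Set.range (wordSeq m L)))) (Fin d) ∧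
      Q' (wordSeq m L) lab) ↔ Connected σ₀ L ∧ IsLab (wordPerm L * σ₀) μ.get lab ∧ Q L lab := by
    intro L h1 h2 lab
    rw [isCycleLabelling_iff hμ, leftToRightProd_wordSeq h1, isPretransitive_iff_connected h1]
    constructor
    · rintro ⟨-, h3, h4, h5⟩
      exact ⟨h4, h3, (hQ L h1 h2 lab h3 h4).1 h5⟩
    · rintro ⟨h4, h3, h5⟩
      exact ⟨isMonotoneSeq_wordSeq h1 h2, h3, h4, (hQ L h1 h2 lab h3 h4).2 h5⟩
  refine Finset.card_bij (fun z _ => (wordSeq m z.1, z.2)) ?_ ?_ ?_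
  · rintro ⟨L, lab⟩ h
    simp only [mem_filter, mem_product, mem_monoWords, mem_univ, and_true, true_and] at h ⊢
    exact (hiff L h.1.1 h.1.2 lab).2 h.2
  · rintro ⟨L, lab⟩ h ⟨L', lab'⟩ h' e
    simp only [mem_filter, mem_product, mem_monoWords, mem_univ, and_true] at h h'
    simp only [Prod.mk.injEq] at e ⊢
    exact ⟨wordSeq_injOn h.1.1 h'.1.1 h.1.2 h'.1.2 e.1, e.2⟩
  · rintro ⟨σ, lab⟩ h
    simp only [mem_filter, mem_univ, true_and] at h
    obtain ⟨L, h1, h2, rfl⟩ := exists_word_of_isMonotoneSeq h.1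
    refine ⟨(L, lab), ?_, rfl⟩
    simp only [mem_filter, mem_product, mem_monoWords, mem_univ, and_true]
    exact ⟨⟨h1, h2⟩, (hiff L h1 h2 lab).1 h⟩

end Sequences

/-! ### The special permutation on an initial segment of the natural numbers -/

section Special

/-- The points `1, …, k a`, as `k` consecutive blocks of length `a`. -/
def blockOrderIso (k a : ℕ) : (Fin k ×ₗ Fin a) ≃o Fin (k * a) where
  toEquiv := ofLex.trans finProdFinEquiv
  map_rel_iff' := by
    rintro x y
    obtain ⟨⟨i, j⟩, rfl⟩ := toLex.surjective x
    obtain ⟨⟨i', j'⟩, rfl⟩ := toLex.surjective y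
    simp only [Prod.Lex.toLex_le_toLex, Equiv.trans_apply, ofLex_toLex, Fin.le_def, Fin.lt_def,
      finProdFinEquiv_apply_val, Fin.ext_iff]
    have hj := j.2
    have hj' := j'.2
    rcases lt_trichotomy (i : ℕ) i' with h | h | h
    · have : a * i + a ≤ a * i' := by nlinarith
      constructor
      · intro _; exact Or.inl h
      · intro _; omega
    · rw [h]; omega
    · have : a * i' + a ≤ a * i := by nlinarith
      omega

lemma blockOrderIso_val (k a : ℕ) (i : Fin k) (j : Fin a) :
    (blockOrderIso k a (toLex (i, j)) : ℕ) = j + a * i := rfl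

/-- The special permutation of `1, …, k a`. -/
def specialPerm (k a : ℕ) : Perm (Fin (k * a)) :=
  ((blockOrderIso k a).symm.toEquiv.trans (blockRot (Fin k) a)).trans (blockOrderIso k a).toEquiv

lemma specialPerm_apply (k a : ℕ) (x : Fin k ×ₗ Fin a) :
    specialPerm k a (blockOrderIso k a x) = blockOrderIso k a (blockRot (Fin k) a x) := by
  simp [specialPerm]

lemma isSpecial_specialPerm (k a : ℕ) : IsSpecial a (specialPerm k a) := by
  intro x
  obtain ⟨x, rfl⟩ := (blockOrderIso k a).surjective x
  obtain ⟨⟨i, j⟩, rfl⟩ := toLex.surjective x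
  rw [specialPerm_apply, blockRot_toLex, blockOrderIso_val, blockOrderIso_val]
  obtain ⟨n, rfl⟩ : ∃ n, a = n + 1 := ⟨a - 1, by have := j.2; omega⟩
  have hj := j.2
  by_cases h : (j : ℕ) = n
  · have h1 : n + 1 ∣ (j : ℕ) + (n + 1) * i + 1 := ⟨i + 1, by rw [h]; ring⟩
    have h2 : j = Fin.last n := Fin.ext h
    rw [if_pos h1, h2, finRotate_last]
    simp only [Fin.val_zero, Fin.val_last]
    omega
  · have h1 : ¬ n + 1 ∣ (j : ℕ) + (n + 1) * i + 1 := by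
      intro hd
      have h3 : n + 1 ∣ (j : ℕ) + 1 := by
        rw [show (j : ℕ) + (n + 1) * i + 1 = (j + 1) + (n + 1) * i by ring] at hd
        exact (Nat.dvd_add_left (Dvd.intro _ rfl)).1 hd
      have := Nat.le_of_dvd (by omega) h3
      omega
    rw [if_neg h1]
    have := finRotate_of_lt (n := n) (k := j) (by omega)
    rw [Fin.eta] at this
    rw [this]
    simp only
    omega

lemma IsSpecial.unique {a d : ℕ} {σ τ : Perm (Fin d)} (h : IsSpecial a σ) (h' : IsSpecial a τ) :
    σ = τ := by
  ext x
  rw [h x, h' x]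

lemma specialPerm_pow {k a : ℕ} (x : Fin k ×ₗ Fin a) (i : ℕ) :
    (specialPerm k a ^ i) (blockOrderIso k a x) =
      blockOrderIso k a ((blockRot (Fin k) a ^ i) x) := by
  induction i with
  | zero => rfl
  | succ i ih => rw [pow_succ', pow_succ', Perm.mul_apply, Perm.mul_apply, ih, specialPerm_apply]

lemma finRotate_pow_eq_one (a : ℕ) : finRotate a ^ a = 1 := by
  match a with
  | 0 => rfl
  | 1 => exact Subsingleton.elim _ _
  | n + 2 =>
    have h : orderOf (finRotate (n + 2)) = n + 2 := by
      rw [isCycle_finRotate.orderOf, support_finRotate, card_univ, Fintype.card_fin]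
    exact orderOf_dvd_iff_pow_eq_one.1 h.dvd

lemma blockRot_pow_eq_one (κ : Type*) [LinearOrder κ] [Fintype κ] (a : ℕ) :
    blockRot κ a ^ a = 1 := by
  have h : ∀ (i : ℕ) (k : κ) (j : Fin a), (blockRot κ a ^ i) (toLex (k, j)) =
      toLex (k, (finRotate a ^ i) j) := by
    intro i k j
    induction i with
    | zero => rfl
    | succ i ih => rw [pow_succ', pow_succ', Perm.mul_apply, Perm.mul_apply, ih, blockRot_toLex]
  ext x
  obtain ⟨⟨k, j⟩, rfl⟩ := toLex.surjective x
  rw [h, finRotate_pow_eq_one]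
  rfl

lemma blockRot_pow_ne {κ : Type*} [LinearOrder κ] [Fintype κ] {a i : ℕ} (h0 : 0 < i)
    (hi : i < a) (x : κ ×ₗ Fin a) :
    (blockRot κ a ^ i) x ≠ x := by
  obtain ⟨⟨k, j⟩, rfl⟩ := toLex.surjective x
  have hj := j.2
  by_cases h : (j : ℕ) + i < a
  · have := blockRot_pow (κ := κ) k h
    rw [Fin.eta] at this
    rw [this]
    intro e
    have := congrArg (fun z => ((ofLex z).2 : ℕ)) e
    simp only [ofLex_toLex] at this
    omega
  · -- after `i` steps the point would return to itself after another `a - i` steps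
    intro e
    have h2 : (j : ℕ) - (a - i) + (a - i) < a := by omega
    have h3 := blockRot_pow (κ := κ) k h2
    set y : κ ×ₗ Fin a := toLex (k, ⟨(j : ℕ) - (a - i), by omega⟩) with hy
    have h4 : (blockRot κ a ^ (a - i)) y = toLex (k, j) := by
      rw [h3]
      congr 2
      ext
      simp only
      omega
    have h5 : (blockRot κ a ^ i) (toLex (k, j)) = y := by
      rw [← h4, ← Perm.mul_apply, ← pow_add, show i + (a - i) = a by omega, blockRot_pow_eq_one]
      rfl
    rw [e] at h5
    have := congrArg (fun z => ((ofLex z).2 : ℕ)) h5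
    simp only [hy, ofLex_toLex] at this
    omega

/-- All the cycles of the special permutation have length `a`. -/
lemma partition_specialPerm {k a : ℕ} (ha : 0 < a) :
    (specialPerm k a).partition.parts = Multiset.replicate k a := by
  have hone : specialPerm k a ^ a = 1 := by
    ext x
    obtain ⟨x, rfl⟩ := (blockOrderIso k a).surjective x
    rw [specialPerm_pow, blockRot_pow_eq_one]
    rfl
  have hne : ∀ i, 0 < i → i < a → ∀ x, (specialPerm k a ^ i) x ≠ x := by
    intro i h0 hi x
    obtain ⟨x, rfl⟩ := (blockOrderIso k a).surjective x
    rw [specialPerm_pow]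
    exact fun e => blockRot_pow_ne h0 hi x ((blockOrderIso k a).injective e)
  rcases Nat.eq_or_lt_of_le (Nat.succ_le_of_lt ha) with h1 | h1
  · have h2 : a = 1 := h1.symm
    subst h2
    rw [pow_one] at hone
    rw [hone, parts_partition]
    simp
  · have hsupp : (specialPerm k a).support = univ := by
      ext x
      simpa using hne 1 one_pos h1 x
    have hall : ∀ n ∈ (specialPerm k a).cycleType, n = a := by
      intro n hn
      rw [cycleType_def, Multiset.mem_map] at hn
      obtain ⟨c, hc, rfl⟩ := hn
      rw [Finset.mem_val, mem_cycleFactorsFinset_iff] at hc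
      obtain ⟨x, hx, -⟩ := id hc.1
      have hcx : ∀ i : ℕ, (c ^ i) x = (specialPerm k a ^ i) x := by
        intro i
        induction i with
        | zero => rfl
        | succ i ih =>
          rw [pow_succ', pow_succ', Perm.mul_apply, Perm.mul_apply, ← ih]
          refine hc.2 _ ?_
          rw [pow_apply_mem_support]
          simpa using hx
      have h3 : ∀ i : ℕ, orderOf c ∣ i ↔ (specialPerm k a ^ i) x = x := by
        intro i
        rw [orderOf_dvd_iff_pow_eq_one, ← hcx]
        exact ⟨fun h => by rw [h]; rfl, fun h => hc.1.pow_eq_one_iff.2 ⟨x, hx, h⟩⟩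
      have h4 : orderOf c ∣ a := (h3 a).2 (by rw [hone]; rfl)
      have h5 : orderOf c = a := by
        by_contra hlt
        exact hne _ (orderOf_pos c) (lt_of_le_of_ne (Nat.le_of_dvd ha h4) hlt) x
          ((h3 _).1 dvd_rfl)
      rw [Function.comp_apply, ← hc.1.orderOf, h5]
    have hsum := sum_cycleType (specialPerm k a)
    rw [parts_partition, hsupp, card_univ, Nat.sub_self, Multiset.replicate_zero, add_zero]
    rw [Multiset.eq_replicate]
    refine ⟨?_, hall⟩
    rw [Multiset.eq_replicate_of_mem hall, hsupp, card_univ, Fintype.card_fin,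
      Multiset.sum_replicate, smul_eq_mul] at hsum
    exact Nat.eq_of_mul_eq_mul_right ha hsum

/-- There are `(k a)! / (aᵏ k!)` permutations with `k` cycles of length `a`. -/
lemma card_partition_eq_replicate {k a : ℕ} (ha : 0 < a) :
    (univ.filter fun σ : Perm (Fin (k * a)) =>
      σ.partition.parts = Multiset.replicate k a).card * (a ^ k * k.factorial) =
        (k * a).factorial := by
  have h := card_isConj_mul_eq (specialPerm k a)
  rw [Fintype.card_fin] at h
  have h1 : Nat.card {h : Perm (Fin (k * a)) | IsConj (specialPerm k a) h} =
      (univ.filter fun σ : Perm (Fin (k * a)) =>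
        σ.partition.parts = Multiset.replicate k a).card := by
    rw [Nat.card_eq_fintype_card, ← Set.toFinset_card]
    congr 1
    ext σ
    simp only [Set.mem_toFinset, Set.mem_ofPred_eq, mem_filter, mem_univ, true_and]
    rw [partition_eq_of_isConj, ← partition_specialPerm ha, Nat.Partition.ext_iff, eq_comm]
  have hp := partition_specialPerm (k := k) ha
  have hc : (specialPerm k a).cycleType = (Multiset.replicate k a).filter fun n => 2 ≤ n := by
    rw [← hp, filter_parts_partition_eq_cycleType]
  rw [h1] at h
  rw [← h]
  congr 1
  rcases Nat.eq_or_lt_of_le (Nat.succ_le_of_lt ha) with h2 | h2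
  · have h3 : a = 1 := h2.symm
    subst h3
    rw [hc, Multiset.filter_eq_nil.2]
    · simp
    · intro n hn
      rw [Multiset.eq_of_mem_replicate hn]
      norm_num
  · rw [hc, Multiset.filter_eq_self.2]
    · rw [Multiset.sum_replicate, Multiset.prod_replicate, smul_eq_mul, Nat.sub_self,
        Nat.factorial_zero, one_mul]
      congr 1
      rcases Nat.eq_zero_or_pos k with rfl | hk
      · simp
      · rw [Multiset.toFinset_replicate, if_neg hk.ne', prod_singleton,
          Multiset.count_replicate_self]
    · intro n hn
      rw [Multiset.eq_of_mem_replicate hn]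
      exact h2

end Special

/-! ### Hurwitz numbers as numbers of words -/

section Translation

variable {a k : ℕ}

lemma countWith_specialPerm {ι : Type*} [Fintype ι] (m : ℕ) (len : ι → ℕ) :
    countWith (specialPerm k a) m len (fun _ _ => True) = countA (Fin k) a m len :=
  (countWith_congr (blockOrderIso k a) (specialPerm_apply k a) m len fun _ _ => Iff.rfl).symm

/-- Every `σ₀` of cycle type `(a, …, a)` contributes equally, and there are `(ak)! / (a ^ k * k!)`
of them. -/
lemma card_factorisations {d m : ℕ} (ha : 0 < a) {μ : List ℕ} (hμ : ∀ x ∈ μ, 0 < x)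
    (hd : d = k * a) :
    (univ.filter fun x : Perm (Fin d) × (Fin m → Perm (Fin d)) × (Fin d → Fin μ.length) =>
      IsFactorisation a μ x.1 x.2.1 x.2.2).card * (a ^ k * k.factorial) =
        d.factorial * countA (Fin k) a m μ.get := by
  subst hd
  rw [← univ_product_univ, @card_filter_product _ _ _ _ _ _
    (fun σ₀ : Perm (Fin (k * a)) => σ₀.partition.parts = Multiset.replicate k a)
    (fun _ => Classical.propDecidable _)
    (fun σ₀ z => IsMonotoneSeq z.1 ∧ IsCycleLabelling μ (leftToRightProd σ₀ z.1) z.2 ∧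
      MulAction.IsPretransitive (Subgroup.closure (insert σ₀ (Set.range z.1))) (Fin (k * a)) ∧
        True) (fun _ _ => Classical.propDecidable _) ?_]
  · rw [Finset.sum_congr rfl (g := fun _ => countA (Fin k) a m μ.get), sum_const, smul_eq_mul,
      mul_right_comm]
    · congr 1
      convert card_partition_eq_replicate (k := k) ha
    · intro σ₀ h
      simp only [mem_filter, mem_univ, true_and] at h
      rw [← partition_specialPerm ha, ← Nat.Partition.ext_iff, eq_comm,
        ← partition_eq_of_isConj] at h
      obtain ⟨c, hc⟩ := isConj_iff.1 h
      rw [← countWith_specialPerm, ← countWith_conj (specialPerm k a) c⁻¹, inv_inv, hc]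
      have := card_sequences (m := m) hμ σ₀ (Q' := fun _ _ => True) (Q := fun _ _ => True)
        fun _ _ _ _ _ _ => Iff.rfl
      rw [← this]
      congr
  · rintro σ₀ - ⟨σ, lab⟩ -
    constructor
    · rintro ⟨h1, h2, h3, h4⟩
      rw [Nat.mul_div_cancel _ ha] at h1
      exact ⟨h1, h2, h3, h4, trivial⟩
    · rintro ⟨h1, h2, h3, h4, -⟩
      exact ⟨by rw [Nat.mul_div_cancel _ ha, h1], h2, h3, h4⟩

/-- The Hurwitz numbers count words with special `σ₀`. -/
theorem H_eq (ha : 0 < a) (g : ℕ) {μ : List ℕ} (hμ : ∀ x ∈ μ, 0 < x) (hs : μ.sum = k * a) :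
    H a g μ = countA (Fin k) a (numTranspositions a g μ) μ.get / (a ^ k * k.factorial : ℚ) := by
  have h := card_factorisations (m := numTranspositions a g μ) ha hμ hs
  rw [H, Nat.card_eq_fintype_card, Fintype.card_subtype]
  have h1 : (a ^ k * k.factorial : ℚ) ≠ 0 := by positivity
  have h2 : (μ.sum.factorial : ℚ) ≠ 0 := by positivity
  rw [div_eq_div_iff h2 h1]
  have h3 : ((univ.filter fun x : Perm (Fin μ.sum) × (Fin (numTranspositions a g μ) →
      Perm (Fin μ.sum)) × (Fin μ.sum → Fin μ.length) =>
      IsFactorisation a μ x.1 x.2.1 x.2.2).card : ℚ) * (a ^ k * k.factorial) =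
        μ.sum.factorial * countA (Fin k) a (numTranspositions a g μ) μ.get := by exact_mod_cast h
  rw [mul_comm (countA _ _ _ _ : ℚ), ← h3]

lemma IsFactorisation.dvd {d m : ℕ} {μ : List ℕ} {σ₀ : Perm (Fin d)} {σ : Fin m → Perm (Fin d)}
    {lab : Fin d → Fin μ.length} (h : IsFactorisation a μ σ₀ σ lab) : a ∣ d := by
  have h1 := σ₀.partition.parts_sum
  rw [h.cycleType_zero, Multiset.sum_replicate, smul_eq_mul, Fintype.card_fin] at h1
  exact Dvd.intro_left _ h1

lemma H_eq_zero (g : ℕ) {μ : List ℕ} (h : ¬ a ∣ μ.sum) : H a g μ = 0 := by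
  rw [H]
  have : IsEmpty {x : Perm (Fin μ.sum) × (Fin (numTranspositions a g μ) → Perm (Fin μ.sum)) ×
      (Fin μ.sum → Fin μ.length) // IsFactorisation a μ x.1 x.2.1 x.2.2} :=
    ⟨fun x => h x.2.dvd⟩
  rw [Nat.card_of_isEmpty]
  simp

lemma Href_eq_zero (ℓ g μ₁ : ℕ) {ν : List ℕ} (h : ¬ a ∣ (μ₁ :: ν).sum) : Href a ℓ g μ₁ ν = 0 := by
  rw [Href, N]
  have : IsEmpty {x : Equiv.Perm (Fin (μ₁ :: ν).sum) ×
      (Fin (numTranspositions a g (μ₁ :: ν)) → Equiv.Perm (Fin (μ₁ :: ν).sum)) ×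
      (Fin (μ₁ :: ν).sum → Fin (μ₁ :: ν).length) //
    IsRefinedFactorisation a ℓ (μ₁ :: ν) x.1 x.2.1 x.2.2} :=
    ⟨fun x => h x.2.toIsFactorisation.dvd⟩
  rw [Nat.card_of_isEmpty]
  simp

/-- Translation of the counter: the number `ak - a + ℓ` is the `ℓ`-th point of the last block. -/
lemma val_eq_counter_iff {ℓ : ℕ} (h0 : 0 < ℓ) (x : Fin k ×ₗ Fin a) :
    (blockOrderIso k a x : ℕ) + 1 + a = k * a + ℓ ↔
      IsTop (ofLex x).1 ∧ ((ofLex x).2 : ℕ) + 1 = ℓ := by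
  obtain ⟨⟨i, j⟩, rfl⟩ := toLex.surjective x
  obtain ⟨n, rfl⟩ : ∃ n, k = n + 1 := ⟨k - 1, by have := i.2; omega⟩
  rw [blockOrderIso_val, isTop_iff_eq (k := Fin.last n) fun x => Fin.le_last x, Fin.ext_iff,
    Fin.val_last]
  simp only [ofLex_toLex]
  have hj := j.2
  have hi := i.2
  rcases (Nat.lt_succ_iff.1 hi).lt_or_eq with h | h
  · have : a * (i + 1) ≤ a * n := Nat.mul_le_mul_left _ h
    constructor
    · intro e
      have : a * i + a + a * 0 ≤ a * n := by linarith
      nlinarith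
    · intro e
      omega
  · rw [h, show (n + 1) * a = a * n + a by ring]
    omega

lemma isTail_specialPerm {k : ℕ} {ℓ : ℕ} (h0 : 0 < ℓ) (hℓ : ℓ ≤ a) :
    IsTail (specialPerm (k + 1) a) (blockOrderIso (k + 1) a (toLex (Fin.last k, ⟨ℓ - 1, by omega⟩)))
      (blockOrderIso (k + 1) a (toLex (Fin.last k, ⟨a - 1, by omega⟩))) (a - ℓ + 1) := by
  have h := isTail_blockRot (a := a) (k := Fin.last k) (fun x => Fin.le_last x) h0 hℓ
  refine ⟨h.pos, fun i hi hi0 => ?_, fun x hx => ?_, ?_⟩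
  · rw [specialPerm_pow]
    exact (blockOrderIso (k + 1) a).lt_iff_lt.2 (h.lt_pow i hi hi0)
  · obtain ⟨x, rfl⟩ := (blockOrderIso (k + 1) a).surjective x
    obtain ⟨i, hi, e⟩ := h.exists_pow x ((blockOrderIso (k + 1) a).le_iff_le.1 hx)
    exact ⟨i, hi, by rw [specialPerm_pow, e]⟩
  · rw [specialPerm_pow, ← h.top_eq]

/-- The refined factorisations with fixed special `σ₀`, as words. -/
lemma refined_iff {k ℓ m : ℕ} (h0 : 0 < ℓ) (hℓ : ℓ ≤ a) {μ : List ℕ} {i₀ : Fin μ.length}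
    (hi₀ : (i₀ : ℕ) = 0) {L : List (Fin ((k + 1) * a) × Fin ((k + 1) * a))} (hL : L.length = m)
    (hmono : IsMonoWord L) {lab : Fin ((k + 1) * a) → Fin μ.length}
    (hlab : IsLab (wordPerm L * specialPerm (k + 1) a) μ.get lab) :
    ((m = 0 → ℓ = 1) ∧ (∀ i : Fin m, (i : ℕ) + 1 = m → ∃ r s : Fin ((k + 1) * a),
      r < s ∧ (s : ℕ) + 1 + a = (k + 1) * a + ℓ ∧ wordSeq m L i = Equiv.swap r s) ∧
      ∀ x : Fin ((k + 1) * a), (k + 1) * a + ℓ ≤ (x : ℕ) + 1 + a → (lab x : ℕ) = 0) ↔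
    ((L.map (Prod.map (blockOrderIso (k + 1) a).symm (blockOrderIso (k + 1) a).symm) = [] → ℓ = 1) ∧
    (∀ p ∈ (L.map (Prod.map (blockOrderIso (k + 1) a).symm (blockOrderIso (k + 1) a).symm)).head?,
      IsTop (ofLex p.2).1 ∧ ((ofLex p.2).2 : ℕ) + 1 = ℓ) ∧
      ∀ x, IsTop x → (lab ∘ blockOrderIso (k + 1) a) x = i₀) := by
  set e := blockOrderIso (k + 1) a with he
  have hlast : IsTop (Fin.last k) := fun x => Fin.le_last x
  have hhead : ∀ p ∈ L.head?, ∀ i : Fin m, (i : ℕ) + 1 = m → wordSeq m L i = swap p.1 p.2 := by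
    intro p hp i hi
    cases L with
    | nil => simp at hp
    | cons q L =>
      simp only [List.head?_cons, Option.mem_def, Option.some.injEq] at hp
      subst hp
      rw [wordSeq_apply hL]
      have : (q :: L).reverse[(i : ℕ)]'(by
          rw [List.length_reverse, hL]; exact i.2) = q := by
        have hi' : (i : ℕ) = L.length := by
          rw [List.length_cons] at hL
          omega
        simp [hi']
      rw [this]
  have h1 : (m = 0 → ℓ = 1) ↔ (L.map (Prod.map e.symm e.symm) = [] → ℓ = 1) := by
    rw [List.map_eq_nil_iff, ← List.length_eq_zero_iff, hL]
  have h2 : (∀ i : Fin m, (i : ℕ) + 1 = m → ∃ r s : Fin ((k + 1) * a),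
      r < s ∧ (s : ℕ) + 1 + a = (k + 1) * a + ℓ ∧ wordSeq m L i = Equiv.swap r s) ↔
      ∀ p ∈ L.head?, (p.2 : ℕ) + 1 + a = (k + 1) * a + ℓ := by
    constructor
    · intro h p hp
      have hm : 0 < m := by
        rw [← hL, List.length_pos_iff]
        rintro rfl
        simp at hp
      obtain ⟨r, s, hrs, hs, h⟩ := h ⟨m - 1, by omega⟩ (by simp only; omega)
      rw [hhead p hp _ (by simp only; omega)] at h
      rw [(swap_injective_of_lt (hmono.1 p (List.mem_of_mem_head? hp)) hrs h).2, hs]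
    · intro h i hi
      cases L with
      | nil =>
        have := i.2
        simp at hL
        omega
      | cons p L =>
        exact ⟨p.1, p.2, hmono.1 p (by simp), h p (by simp), hhead p (by simp) i hi⟩
  have h3 : (∀ p ∈ (L.map (Prod.map e.symm e.symm)).head?,
      IsTop (ofLex p.2).1 ∧ ((ofLex p.2).2 : ℕ) + 1 = ℓ) ↔
      ∀ p ∈ L.head?, (p.2 : ℕ) + 1 + a = (k + 1) * a + ℓ := by
    have : ∀ p : Fin ((k + 1) * a) × Fin ((k + 1) * a),
        (IsTop (ofLex (e.symm p.2)).1 ∧ ((ofLex (e.symm p.2)).2 : ℕ) + 1 = ℓ) ↔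
        (p.2 : ℕ) + 1 + a = (k + 1) * a + ℓ := by
      intro p
      rw [← val_eq_counter_iff h0, ← he, OrderIso.apply_symm_apply]
    cases L with
    | nil => simp
    | cons p L =>
      simp only [List.map_cons, List.head?_cons, Option.mem_def, Option.some.injEq, forall_eq',
        Prod.map_snd, this]
  rw [h1, h2, h3]
  refine and_congr_right fun _ => and_congr_right fun h => ?_
  set s : Fin (k + 1) ×ₗ Fin a := toLex (Fin.last k, ⟨ℓ - 1, by omega⟩) with hs
  set t : Fin (k + 1) ×ₗ Fin a := toLex (Fin.last k, ⟨a - 1, by omega⟩) with ht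
  have hes : (e s : ℕ) + 1 + a = (k + 1) * a + ℓ := by
    rw [val_eq_counter_iff h0]
    exact ⟨hlast, by simp only [hs, ofLex_toLex]; omega⟩
  have hT : IsTail (specialPerm (k + 1) a) (e s) (e t) (a - ℓ + 1) := isTail_specialPerm h0 hℓ
  have hle : ∀ p ∈ L, p.2 ≤ e s := by
    cases L with
    | nil => simp
    | cons p L =>
      have hp : p.2 = e s := by
        have := h p (by simp)
        ext
        omega
      intro q hq
      rcases List.mem_cons.1 hq with rfl | hq
      · exact hp.le
      · exact hp ▸ (isMonoWord_cons.1 hmono).2.1 q hq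
  -- the last points lie in one cycle of the product
  have hcyc : ∀ x, e s ≤ x → lab x = lab (e s) := by
    intro x hx
    obtain ⟨i, hi, rfl⟩ := hT.exists_pow x hx
    rw [hlab.same_iff, ← hT.wordPerm_pow hmono hle hi]
    exact (sameCycle_pow_left).2 (SameCycle.refl _ _)
  have hst : e s ≤ e t := by
    rw [e.le_iff_le, hs, ht, Prod.Lex.toLex_le_toLex]
    exact Or.inr ⟨rfl, by rw [Fin.le_def]; simp only; omega⟩
  simp only [isTop_iff hlast (show 0 < a by omega), forall_eq, Function.comp_apply, ← ht]
  rw [hcyc _ hst]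
  constructor
  · intro h
    ext
    rw [hi₀, h (e s) hes.ge]
  · intro h x hx
    rw [hcyc x, h, hi₀]
    rw [Fin.le_def]
    omega

/-- The refined factorisations have a unique `σ₀`, and are counted by their words. -/
lemma card_refinedFactorisations {d m ℓ : ℕ} (h0 : 0 < ℓ) (hℓ : ℓ ≤ a) {μ : List ℕ}
    (hμ : ∀ x ∈ μ, 0 < x) (hd : d = (k + 1) * a) {i₀ : Fin μ.length} (hi₀ : (i₀ : ℕ) = 0) :
    (univ.filter fun x : Perm (Fin d) × (Fin m → Perm (Fin d)) × (Fin d → Fin μ.length) =>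
      IsRefinedFactorisation a ℓ μ x.1 x.2.1 x.2.2).card =
        countB (Fin (k + 1)) a ℓ m μ.get i₀ := by
  subst hd
  have ha : 0 < a := by omega
  rw [← univ_product_univ, @card_filter_product _ _ _ _ _ _
    (fun σ₀ : Perm (Fin ((k + 1) * a)) => σ₀ = specialPerm (k + 1) a)
    (fun _ => Classical.propDecidable _)
    (fun σ₀ z => IsMonotoneSeq z.1 ∧ IsCycleLabelling μ (leftToRightProd σ₀ z.1) z.2 ∧
      MulAction.IsPretransitive (Subgroup.closure (insert σ₀ (Set.range z.1)))
        (Fin ((k + 1) * a)) ∧ ((m = 0 → ℓ = 1) ∧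
        (∀ i : Fin m, (i : ℕ) + 1 = m → ∃ r s : Fin ((k + 1) * a),
          r < s ∧ (s : ℕ) + 1 + a = (k + 1) * a + ℓ ∧ z.1 i = Equiv.swap r s) ∧
        ∀ x : Fin ((k + 1) * a), (k + 1) * a + ℓ ≤ (x : ℕ) + 1 + a → (z.2 x : ℕ) = 0))
        (fun _ _ => Classical.propDecidable _) ?_]
  · rw [sum_filter]
    refine (Finset.sum_eq_single (specialPerm (k + 1) a) (fun σ _ h => if_neg h)
      fun h => absurd (mem_univ _) h).trans ?_
    rw [if_pos rfl]
    have := card_sequences (m := m) hμ (specialPerm (k + 1) a)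
      (Q' := fun σ lab => (m = 0 → ℓ = 1) ∧
        (∀ i : Fin m, (i : ℕ) + 1 = m → ∃ r s : Fin ((k + 1) * a),
          r < s ∧ (s : ℕ) + 1 + a = (k + 1) * a + ℓ ∧ σ i = Equiv.swap r s) ∧
        ∀ x : Fin ((k + 1) * a), (k + 1) * a + ℓ ≤ (x : ℕ) + 1 + a → (lab x : ℕ) = 0)
      (Q := fun L lab =>
        (L.map (Prod.map (blockOrderIso (k + 1) a).symm (blockOrderIso (k + 1) a).symm) = [] →
          ℓ = 1) ∧
        (∀ p ∈ (L.map (Prod.map (blockOrderIso (k + 1) a).symm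
          (blockOrderIso (k + 1) a).symm)).head?,
          IsTop (ofLex p.2).1 ∧ ((ofLex p.2).2 : ℕ) + 1 = ℓ) ∧
        ∀ x, IsTop x → (lab ∘ blockOrderIso (k + 1) a) x = i₀)
      fun L h1 h2 lab h3 _ => refined_iff h0 hℓ hi₀ h1 h2 h3
    refine Eq.trans ?_ (this.trans ?_)
    · congr
    refine (countWith_congr (blockOrderIso (k + 1) a) (specialPerm_apply (k + 1) a) m _
      fun L lab => ?_).symm
    have hid : Prod.map (blockOrderIso (k + 1) a).symm (blockOrderIso (k + 1) a).symm ∘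
        Prod.map (blockOrderIso (k + 1) a) (blockOrderIso (k + 1) a) = id := by
      ext z <;> simp
    rw [List.map_map, hid, List.map_id]
  · rintro σ₀ - ⟨σ, lab⟩ -
    constructor
    · intro h
      exact ⟨h.special.unique (isSpecial_specialPerm _ _), h.monotone, h.labelling, h.transitive,
        h.counter_zero, h.counter_last, h.first_cycle⟩
    · rintro ⟨rfl, h2, h3, h4, h5, h6, h7⟩
      exact ⟨⟨by rw [Nat.mul_div_cancel _ ha, partition_specialPerm ha], h2, h3, h4⟩,
        isSpecial_specialPerm _ _, h5, h6, h7⟩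

/-- The refined counts count words with special `σ₀`. -/
theorem Href_eq {ℓ : ℕ} (h0 : 0 < ℓ) (hℓ : ℓ ≤ a) (g : ℕ) {μ₁ : ℕ} {ν : List ℕ}
    (hμ : ∀ x ∈ μ₁ :: ν, 0 < x) (hs : (μ₁ :: ν).sum = (k + 1) * a) :
    Href a ℓ g μ₁ ν = countB (Fin (k + 1)) a ℓ (numTranspositions a g (μ₁ :: ν)) (μ₁ :: ν).get
      (⟨0, by simp⟩ : Fin (μ₁ :: ν).length) / (a ^ (k + 1) * (k + 1).factorial : ℚ) := by
  have h := card_refinedFactorisations (m := numTranspositions a g (μ₁ :: ν)) h0 hℓ hμ hs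
    (i₀ := (⟨0, by simp⟩ : Fin (μ₁ :: ν).length)) rfl
  rw [Href, N, Nat.card_eq_fintype_card, Fintype.card_subtype, ← h, hs,
    Nat.mul_div_cancel _ (by omega)]

end Translation

/-! ### Counts for lists of cycle lengths -/

section Shape

lemma exists_list_of_map_eq {α : Type*} (f : α → ℕ) (ρ : List ℕ) :
    ∀ s : Multiset α, s.map f = ρ → ∃ l : List α, (l : Multiset α) = s ∧ l.map f = ρ := by
  induction ρ with
  | nil =>
    intro s hs
    exact ⟨[], by simpa [eq_comm] using hs, rfl⟩
  | cons b ρ ih =>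
    intro s hs
    rw [← Multiset.cons_coe, ← Multiset.map_eq_cons] at hs
    obtain ⟨x, hx, rfl, h⟩ := hs
    obtain ⟨l, hl, h⟩ := ih _ h
    exact ⟨x :: l, by rw [← Multiset.cons_coe, hl, Multiset.cons_erase hx], by simp [h]⟩

lemma sum_singleton_eq_map {α : Type*} (s : Finset α) (f : α → ℕ) :
    ∑ i ∈ s, ({f i} : Multiset ℕ) = s.val.map f := by
  have h := Multiset.sum_map_singleton (s.val.map f)
  rw [Multiset.map_map] at h
  exact h

variable {ι : Type*} [Fintype ι]

/-- If the lengths that satisfy a condition form the entries of a list, then the list enumerates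
them. -/
lemma exists_list_of_sum_eq {len : ι → ℕ} {P : ι → Prop} [DecidablePred P] {ρ : List ℕ}
    (h : (∑ i, if P i then ({len i} : Multiset ℕ) else 0) = ρ) :
    ∃ l : List ι, l.Nodup ∧ (∀ i, i ∈ l ↔ P i) ∧ l.map len = ρ := by
  rw [← sum_filter, sum_singleton_eq_map] at h
  obtain ⟨l, hl, hl'⟩ := exists_list_of_map_eq len ρ _ h
  refine ⟨l, ?_, fun i => ?_, hl'⟩
  · rw [← Multiset.coe_nodup, hl]
    exact (univ.filter P).nodup
  · rw [← Multiset.mem_coe, hl, Finset.mem_val, mem_filter]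
    simp

variable {κ : Type*} [LinearOrder κ] [Fintype κ] {a : ℕ}

lemma get_injective_of_nodup {l : List ι} (hl : l.Nodup) (len : ι → ℕ) : Function.Injective
    (fun j : Fin (l.map len).length => l.get (j.cast (List.length_map _))) := by
  intro i j h
  have := (List.nodup_iff_injective_get.1 hl) h
  simpa [Fin.ext_iff] using this

lemma mem_range_get {l : List ι} (len : ι → ℕ) {i : ι} (hi : i ∈ l) : i ∈ Set.range
    (fun j : Fin (l.map len).length => l.get (j.cast (List.length_map _))) := by
  obtain ⟨j, rfl⟩ := List.get_of_mem hi
  exact ⟨j.cast (List.length_map _).symm, rfl⟩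

/-- The number of factorisations depends only on the multiset of the nonzero lengths. -/
lemma countA_eq_of_list {len : ι → ℕ} {ρ : List ℕ} (m : ℕ)
    (h : (∑ i, if len i ≠ 0 then ({len i} : Multiset ℕ) else 0) = ρ) :
    countA κ a m len = countA κ a m ρ.get := by
  obtain ⟨l, h1, h2, rfl⟩ := exists_list_of_sum_eq h
  refine (countWith_reindex (get_injective_of_nodup h1 len) _ m (fun j => ?_) (fun i hi => ?_)
    fun L lab => Iff.rfl).symm
  · simp
  · by_contra hne
    exact hi (mem_range_get len ((h2 i).2 hne))

/-- If the nonzero lengths, apart from that of a distinguished label, form a list, then the labels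
that are used are indexed by this list with the distinguished one in front. -/
lemma reindex_first {len : ι → ℕ} {i₀ : ι} {q : ℕ} {ρ : List ℕ} (hq : len i₀ = q)
    (h : (∑ i, if i ≠ i₀ ∧ len i ≠ 0 then ({len i} : Multiset ℕ) else 0) = ρ) :
    ∃ g : Fin (q :: ρ).length → ι, Function.Injective g ∧ (∀ j, len (g j) = (q :: ρ).get j) ∧
      (∀ i, i ∉ Set.range g → len i = 0) ∧ g ⟨0, by simp⟩ = i₀ := by
  obtain ⟨l, h1, h2, rfl⟩ := exists_list_of_sum_eq h
  subst hq
  have h3 : (i₀ :: l).Nodup := List.nodup_cons.2 ⟨fun hm => ((h2 i₀).1 hm).1 rfl, h1⟩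
  refine ⟨_, get_injective_of_nodup h3 len, fun j => ?_, fun i hi => ?_, rfl⟩
  · change len ((i₀ :: l).get _) = ((i₀ :: l).map len).get j
    simp only [List.get_eq_getElem, List.getElem_map, Fin.val_cast]
  by_contra hne
  refine hi (mem_range_get len ?_)
  rw [List.mem_cons, h2]
  by_cases h : i = i₀
  · exact Or.inl h
  · exact Or.inr ⟨h, hne⟩

lemma countC_eq_of_list {len : ι → ℕ} {i₀ : ι} {q : ℕ} {ρ : List ℕ} (ℓ m : ℕ) (hq : len i₀ = q)
    (h : (∑ i, if i ≠ i₀ ∧ len i ≠ 0 then ({len i} : Multiset ℕ) else 0) = ρ) :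
    countC κ a ℓ m len i₀ = countC κ a ℓ m (q :: ρ).get ⟨0, by simp⟩ := by
  obtain ⟨g, h1, h2, h3, rfl⟩ := reindex_first hq h
  refine (countWith_reindex h1 _ m h2 h3 fun L lab => ?_).symm
  simp only [Function.comp_apply, h1.eq_iff]

lemma countB_eq_of_list {len : ι → ℕ} {i₀ : ι} {q : ℕ} {ρ : List ℕ} (ℓ m : ℕ) (hq : len i₀ = q)
    (h : (∑ i, if i ≠ i₀ ∧ len i ≠ 0 then ({len i} : Multiset ℕ) else 0) = ρ) :
    countB κ a ℓ m len i₀ = countB κ a ℓ m (q :: ρ).get ⟨0, by simp⟩ := by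
  obtain ⟨g, h1, h2, h3, rfl⟩ := reindex_first hq h
  refine (countWith_reindex h1 _ m h2 h3 fun L lab => ?_).symm
  simp only [Function.comp_apply, h1.eq_iff]

/-- The lengths of the cycles add up to the number of points. -/
lemma countWith_eq_zero {X : Type*} [Fintype X] [LinearOrder X] {σ₀ : Perm X} {m : ℕ}
    {len : ι → ℕ} {Q : List (X × X) → (X → ι) → Prop} (h : ∑ i, len i ≠ Fintype.card X) :
    countWith σ₀ m len Q = 0 := by
  rw [countWith, card_eq_zero, filter_eq_empty_iff]
  rintro ⟨L, lab⟩ - ⟨-, hl, -⟩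
  apply h
  rw [← card_univ, Finset.card_eq_sum_card_fiberwise (f := lab) (t := univ) fun x _ => by simp]
  exact Finset.sum_congr rfl fun i _ => (hl.card_eq i).symm

lemma card_blocks (κ : Type*) [LinearOrder κ] [Fintype κ] (a : ℕ) :
    Fintype.card (κ ×ₗ Fin a) = Fintype.card κ * a := by
  rw [← Fintype.card_congr (toLex (α := κ × Fin a)), Fintype.card_prod, Fintype.card_fin]

/-- The entries of a subtuple, as a multiset. -/
lemma coe_subtuple (ν : List ℕ) (I : Finset (Fin ν.length)) :
    (subtuple ν I : Multiset ℕ) = ∑ i, if i ∈ I then ({ν.get i} : Multiset ℕ) else 0 := by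
  have h1 : (((List.finRange ν.length).filter (· ∈ I) : List (Fin ν.length)) :
      Multiset (Fin ν.length)) = I.val := by
    have : I = univ.filter (· ∈ I) := by ext; simp
    conv_rhs => rw [this]
    rfl
  rw [← sum_filter, Finset.filter_mem_eq_inter, univ_inter, subtuple, ← Multiset.map_coe]
  rw [sum_singleton_eq_map, ← h1]

lemma coe_eq_sum (ν : List ℕ) : (ν : Multiset ℕ) = ∑ i, ({ν.get i} : Multiset ℕ) := by
  have h := coe_subtuple ν univ
  have h1 : subtuple ν univ = ν := by simp [subtuple]
  rw [h1] at h
  simpa using h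

lemma coe_eraseIdx (ν : List ℕ) (i : Fin ν.length) : (ν.eraseIdx i : Multiset ℕ) =
    ∑ j, if j ≠ i then ({ν.get j} : Multiset ℕ) else 0 := by
  have h : (ν.get i ::ₘ (ν.eraseIdx i : Multiset ℕ)) = ν :=
    Multiset.coe_eq_coe.2 (List.getElem_cons_eraseIdx_perm i.2)
  rw [coe_eq_sum ν, ← Multiset.singleton_add, Fintype.sum_eq_add_sum_compl i] at h
  rw [add_left_cancel h, ← sum_filter]
  refine Finset.sum_congr ?_ fun _ _ => rfl
  ext j
  simp

lemma mem_subtuple {ν : List ℕ} {I : Finset (Fin ν.length)} {x : ℕ} (h : x ∈ subtuple ν I) :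
    x ∈ ν := by
  simp only [subtuple, List.mem_map] at h
  obtain ⟨i, -, rfl⟩ := h
  exact List.get_mem _ _

lemma sum_subtuple (ν : List ℕ) (I : Finset (Fin ν.length)) :
    (subtuple ν I).sum = ∑ i ∈ I, ν.get i := by
  have h := congrArg Multiset.sum (coe_subtuple ν I)
  rw [Multiset.sum_coe] at h
  rw [h, ← Multiset.coe_sumAddMonoidHom, map_sum, ← sum_filter_add_sum_filter_not univ (· ∈ I)]
  rw [Finset.sum_congr rfl (g := fun i => ν.get i), Finset.sum_congr rfl (g := fun i => 0)
    (s₁ := univ.filter (· ∉ I))]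
  · simp
  · intro i hi
    simp only [mem_filter] at hi
    simp [hi.2]
  · intro i hi
    simp only [mem_filter] at hi
    simp [hi.2]

lemma length_subtuple (ν : List ℕ) (I : Finset (Fin ν.length)) :
    (subtuple ν I).length = I.card := by
  have h := congrArg Multiset.card (coe_subtuple ν I)
  rw [Multiset.coe_card, ← sum_filter] at h
  simpa using h

lemma sum_get (ν : List ℕ) : ∑ i, ν.get i = ν.sum := by
  simp

lemma sum_subtuple_add_compl (ν : List ℕ) (I : Finset (Fin ν.length)) :
    (subtuple ν I).sum + (subtuple ν Iᶜ).sum = ν.sum := by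
  rw [sum_subtuple, sum_subtuple, Finset.sum_add_sum_compl, sum_get]

lemma length_subtuple_add_compl (ν : List ℕ) (I : Finset (Fin ν.length)) :
    (subtuple ν I).length + (subtuple ν Iᶜ).length = ν.length := by
  rw [length_subtuple, length_subtuple, Finset.card_add_card_compl, Fintype.card_fin]

lemma get_add_sum_eraseIdx (ν : List ℕ) (i : Fin ν.length) :
    ν.get i + (ν.eraseIdx i).sum = ν.sum := by
  simp

end Shape

/-! ### The recursion on the number of transpositions -/

section Lists

section
variable {ι : Type*} (len : ι → ℕ) {i₀ b x : ι}

lemma mergeLen_left (h : i₀ ≠ b) : mergeLen len i₀ b i₀ = len i₀ + len b := by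
  rw [mergeLen, Function.update_of_ne h, Function.update_self]

lemma mergeLen_right : mergeLen len i₀ b b = 0 := by
  rw [mergeLen, Function.update_self]

lemma mergeLen_of_ne (h : x ≠ i₀) (h' : x ≠ b) : mergeLen len i₀ b x = len x := by
  rw [mergeLen, Function.update_of_ne h', Function.update_of_ne h]

lemma splitLen_right (q : ℕ × ℕ) : splitLen len i₀ b q b = q.2 := by
  rw [splitLen, Function.update_self]

lemma splitLen_of_ne (h : x ≠ i₀) (h' : x ≠ b) (q : ℕ × ℕ) : splitLen len i₀ b q x = len x := by
  rw [splitLen, Function.update_of_ne h', Function.update_of_ne h]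

end

variable {a : ℕ}

/-- The normalised number of factorisations with `m` transpositions and cycle lengths `μ`. -/
noncomputable def numA (a m : ℕ) (μ : List ℕ) : ℚ :=
  countA (Fin (μ.sum / a)) a m μ.get / (a ^ (μ.sum / a) * (μ.sum / a).factorial)

/-- The normalised number of factorisations with `m` transpositions that do not involve the last
`a - ℓ` points, such that the last point lies in a distinguished cycle of length `μ₁`. -/
noncomputable def numC (a ℓ m μ₁ : ℕ) (ν : List ℕ) : ℚ :=
  countC (Fin ((μ₁ :: ν).sum / a)) a ℓ m (μ₁ :: ν).get ⟨0, by simp⟩ /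
    (a ^ ((μ₁ :: ν).sum / a) * ((μ₁ :: ν).sum / a).factorial)

/-- The normalised number of refined factorisations with `m` transpositions and counter `ℓ`. -/
noncomputable def numB (a ℓ m μ₁ : ℕ) (ν : List ℕ) : ℚ :=
  countB (Fin ((μ₁ :: ν).sum / a)) a ℓ m (μ₁ :: ν).get ⟨0, by simp⟩ /
    (a ^ ((μ₁ :: ν).sum / a) * ((μ₁ :: ν).sum / a).factorial)

lemma countWith_get_eq_zero {k m : ℕ} {μ : List ℕ} (h : μ.sum ≠ k * a)
    {Q : List ((Fin k ×ₗ Fin a) × (Fin k ×ₗ Fin a)) → ((Fin k ×ₗ Fin a) → Fin μ.length) → Prop} :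
    countWith (blockRot (Fin k) a) m μ.get Q = 0 := by
  apply countWith_eq_zero
  rwa [card_blocks, Fintype.card_fin, sum_get]

lemma numA_eq_zero (m : ℕ) {μ : List ℕ} (h : ¬ a ∣ μ.sum) : numA a m μ = 0 := by
  rw [numA, countA, countWith_get_eq_zero fun e => h (Dvd.intro_left _ e.symm)]
  simp

lemma numB_eq_zero (ℓ m : ℕ) {μ₁ : ℕ} {ν : List ℕ} (h : ¬ a ∣ (μ₁ :: ν).sum) :
    numB a ℓ m μ₁ ν = 0 := by
  rw [numB, countB, countWith_get_eq_zero fun e => h (Dvd.intro_left _ e.symm)]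
  simp

lemma numC_eq_zero (ℓ m : ℕ) {μ₁ : ℕ} {ν : List ℕ} (h : ¬ a ∣ (μ₁ :: ν).sum) :
    numC a ℓ m μ₁ ν = 0 := by
  rw [numC, countC, countWith_get_eq_zero fun e => h (Dvd.intro_left _ e.symm)]
  simp

lemma numA_eq (ha : 0 < a) {k : ℕ} (m : ℕ) {μ : List ℕ} (h : μ.sum = k * a) :
    numA a m μ = countA (Fin k) a m μ.get / (a ^ k * k.factorial) := by
  rw [numA, h, Nat.mul_div_cancel _ ha]

lemma numB_eq (ha : 0 < a) {k : ℕ} (ℓ m : ℕ) {μ₁ : ℕ} {ν : List ℕ} (h : (μ₁ :: ν).sum = k * a) :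
    numB a ℓ m μ₁ ν =
      countB (Fin k) a ℓ m (μ₁ :: ν).get ⟨0, by simp⟩ / (a ^ k * k.factorial) := by
  rw [numB, h, Nat.mul_div_cancel _ ha]

lemma numC_eq (ha : 0 < a) {k : ℕ} (ℓ m : ℕ) {μ₁ : ℕ} {ν : List ℕ} (h : (μ₁ :: ν).sum = k * a) :
    numC a ℓ m μ₁ ν =
      countC (Fin k) a ℓ m (μ₁ :: ν).get ⟨0, by simp⟩ / (a ^ k * k.factorial) := by
  rw [numC, h, Nat.mul_div_cancel _ ha]

lemma sum_cons_eq_of_dvd {μ₁ : ℕ} {ν : List ℕ} (h1 : 0 < μ₁) (h : a ∣ (μ₁ :: ν).sum) :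
    ∃ n, (μ₁ :: ν).sum = (n + 1) * a := by
  obtain ⟨k, hk⟩ := h
  have : k ≠ 0 := by
    rintro rfl
    simp at hk
    omega
  exact ⟨k - 1, by rw [hk, mul_comm, Nat.sub_add_cancel (Nat.pos_of_ne_zero this)]⟩

lemma sum_numB {ℓ : ℕ} (h0 : 0 < ℓ) (hℓ : ℓ ≤ a) (m : ℕ) {μ₁ : ℕ} (hμ : 0 < μ₁) (ν : List ℕ) :
    ∑ p ∈ Icc 1 ℓ, numB a p m μ₁ ν = numC a ℓ m μ₁ ν := by
  by_cases h : a ∣ (μ₁ :: ν).sum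
  · obtain ⟨n, hn⟩ := sum_cons_eq_of_dvd hμ h
    rw [numC_eq (by omega) _ _ hn, ← sum_countB (k := Fin.last n) (fun x => Fin.le_last x) h0 hℓ,
      Nat.cast_sum, Finset.sum_div]
    exact Finset.sum_congr rfl fun p _ => numB_eq (by omega) _ _ hn
  · rw [numC_eq_zero _ _ h]
    exact Finset.sum_eq_zero fun p _ => numB_eq_zero _ _ h

/-- The decomposition into refined counts, sorted by the part of `μ` that belongs to the last
point. -/
lemma numA_eq_sum (ha : 0 < a) (m : ℕ) {μ : List ℕ} (hne : μ ≠ []) (hμ : ∀ x ∈ μ, 0 < x) :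
    numA a m μ = ∑ i : Fin μ.length, numC a a m (μ.get i) (μ.eraseIdx i) := by
  have hs : ∀ i : Fin μ.length, (μ.get i :: μ.eraseIdx i).sum = μ.sum := fun i => by
    rw [List.sum_cons, get_add_sum_eraseIdx]
  by_cases h : a ∣ μ.sum
  · obtain ⟨n, hn⟩ : ∃ n, μ.sum = (n + 1) * a := by
      cases μ with
      | nil => exact absurd rfl hne
      | cons μ₁ ν => exact sum_cons_eq_of_dvd (hμ _ (by simp)) h
    rw [numA_eq ha m hn, countA_eq_sum (k := Fin.last n) (fun x => Fin.le_last x) ha,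
      Nat.cast_sum, Finset.sum_div]
    refine Finset.sum_congr rfl fun i _ => ?_
    rw [numC_eq ha _ _ ((hs i).trans hn), countC_eq_of_list a m (len := μ.get) (i₀ := i) rfl]
    rw [coe_eraseIdx]
    refine Finset.sum_congr rfl fun j _ => ?_
    have := (hμ _ (List.get_mem μ j)).ne'
    simp only [ne_eq, this, not_false_eq_true, and_true]
  · rw [numA_eq_zero m h]
    exact (Finset.sum_eq_zero fun i _ => numC_eq_zero _ _ (by rwa [hs i])).symm

/-- The lengths of a list, together with a spare label of length zero. -/
def optLen (μ₁ : ℕ) (ν : List ℕ) : Option (Fin (ν.length + 1)) → ℕ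
  | none => 0
  | some j => Fin.cons (α := fun _ => ℕ) μ₁ ν.get j

lemma sum_option_fin {M : Type*} [AddCommMonoid M] {n : ℕ} (f : Option (Fin (n + 1)) → M) :
    ∑ x, f x = f none + (f (some 0) + ∑ i : Fin n, f (some i.succ)) := by
  rw [Fintype.sum_option, Fin.sum_univ_succ]

variable {μ₁ : ℕ} {ν : List ℕ}

/-- The embedding of the labels of `ν`. -/
def optEmb (n : ℕ) : Fin n ↪ Option (Fin (n + 1)) :=
  (Fin.succEmb n).trans Function.Embedding.some

lemma optEmb_apply {n : ℕ} (i : Fin n) : optEmb n i = some i.succ := rfl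

lemma countB_optLen (hν : ∀ x ∈ ν, 0 < x) (k ℓ m : ℕ) :
    countB (Fin k) a ℓ m (optLen μ₁ ν) (some 0) =
      countB (Fin k) a ℓ m (μ₁ :: ν).get ⟨0, by simp⟩ := by
  refine countB_eq_of_list ℓ m rfl ?_
  rw [sum_option_fin, coe_eq_sum]
  have h1 : ∀ i : Fin ν.length, ν.get i ≠ 0 := fun i => (hν _ (List.get_mem ν i)).ne'
  simp [optLen, -List.get_eq_getElem, h1]

lemma countC_mergeLen (hν : ∀ x ∈ ν, 0 < x) (k ℓ m : ℕ) (i : Fin ν.length) :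
    countC (Fin k) a ℓ m (mergeLen (optLen μ₁ ν) (some 0) (some i.succ)) (some 0) =
      countC (Fin k) a ℓ m ((μ₁ + ν.get i) :: ν.eraseIdx i).get ⟨0, by simp⟩ := by
  refine countC_eq_of_list ℓ m ?_ ?_
  · rw [mergeLen_left _ (by simp [Fin.ext_iff])]
    rfl
  rw [sum_option_fin, coe_eraseIdx]
  have h1 : ∀ i : Fin ν.length, ν.get i ≠ 0 := fun i => (hν _ (List.get_mem ν i)).ne'
  have h2 : ∀ j : Fin ν.length, mergeLen (optLen μ₁ ν) (some 0) (some i.succ) (some j.succ) =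
      if j = i then 0 else ν.get j := by
    intro j
    by_cases hj : j = i
    · subst hj
      rw [mergeLen_right, if_pos rfl]
    · rw [mergeLen_of_ne _ (by simp [Fin.ext_iff]) (by simpa [Fin.ext_iff] using hj), if_neg hj]
      rfl
  have h3 : mergeLen (optLen μ₁ ν) (some 0) (some i.succ) none = 0 := by
    rw [mergeLen_of_ne _ (by simp) (by simp)]
    rfl
  simp only [h2, h3]
  simp only [ne_eq, not_true_eq_false, and_false, false_and, if_false, zero_add]
  refine Finset.sum_congr rfl fun j _ => ?_
  by_cases hj : j = i
  · simp [hj]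
  · simp [hj, -List.get_eq_getElem, h1]

lemma splitLen_optLen_none (q : ℕ × ℕ) : splitLen (optLen μ₁ ν) (some 0) none q none = q.2 :=
  splitLen_right _ q

lemma splitLen_optLen_zero (q : ℕ × ℕ) :
    splitLen (optLen μ₁ ν) (some 0) none q (some 0) = q.1 := by
  rw [splitLen_left _ (by simp)]

lemma splitLen_optLen_succ (q : ℕ × ℕ) (j : Fin ν.length) :
    splitLen (optLen μ₁ ν) (some 0) none q (some j.succ) = ν.get j := by
  rw [splitLen_of_ne _ (by simp [Fin.ext_iff]) (by simp)]
  rfl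

lemma countC_splitLen (hν : ∀ x ∈ ν, 0 < x) (k ℓ m : ℕ) {q : ℕ × ℕ} (hq : 0 < q.2) :
    countC (Fin k) a ℓ m (splitLen (optLen μ₁ ν) (some 0) none q) (some 0) =
      countC (Fin k) a ℓ m (q.1 :: (ν ++ [q.2])).get ⟨0, by simp⟩ := by
  refine countC_eq_of_list ℓ m (splitLen_optLen_zero q) ?_
  rw [sum_option_fin, ← Multiset.coe_add, coe_eq_sum]
  have h1 : ∀ i : Fin ν.length, ν.get i ≠ 0 := fun i => (hν _ (List.get_mem ν i)).ne'
  simp only [splitLen_optLen_none, splitLen_optLen_zero, splitLen_optLen_succ]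
  simp [-List.get_eq_getElem, h1, hq.ne', add_comm]

lemma countA_lenIn (hν : ∀ x ∈ ν, 0 < x) (k m : ℕ) {q : ℕ × ℕ} (hq : 0 < q.2)
    (I : Finset (Fin ν.length)) :
    countA (Fin k) a m (lenIn (splitLen (optLen μ₁ ν) (some 0) none q) none
      (I.map (optEmb _))) = countA (Fin k) a m (subtuple ν I ++ [q.2]).get := by
  refine countA_eq_of_list m ?_
  rw [sum_option_fin, ← Multiset.coe_add, coe_subtuple]
  have h1 : ∀ i : Fin ν.length, ν.get i ≠ 0 := fun i => (hν _ (List.get_mem ν i)).ne'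
  have h2 : ∀ j : Fin ν.length, some j.succ ∈ I.map (optEmb _) ↔ j ∈ I := fun j => by
    rw [← optEmb_apply, mem_map']
  have h3 : some 0 ∉ I.map (optEmb _) := by
    simp [optEmb_apply]
  simp only [lenIn, splitLen_optLen_none, splitLen_optLen_zero, splitLen_optLen_succ, h2, h3]
  simp only [or_true, if_true, reduceCtorEq, or_false, if_false, ne_eq, not_true_eq_false, hq.ne',
    not_false_eq_true, zero_add, Multiset.coe_singleton]
  rw [add_comm]
  congr 1
  refine Finset.sum_congr rfl fun j _ => ?_
  by_cases hj : j ∈ I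
  · simp [hj, -List.get_eq_getElem, h1]
  · simp [hj]

lemma countC_lenOut (hν : ∀ x ∈ ν, 0 < x) (k ℓ m : ℕ) (q : ℕ × ℕ) (I : Finset (Fin ν.length)) :
    countC (Fin k) a ℓ m (lenOut (splitLen (optLen μ₁ ν) (some 0) none q) none
      (I.map (optEmb _))) (some 0) =
        countC (Fin k) a ℓ m (q.1 :: subtuple ν Iᶜ).get ⟨0, by simp⟩ := by
  have h1 : ∀ i : Fin ν.length, ν.get i ≠ 0 := fun i => (hν _ (List.get_mem ν i)).ne'
  have h2 : ∀ j : Fin ν.length, some j.succ ∈ I.map (optEmb _) ↔ j ∈ I := fun j => by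
    rw [← optEmb_apply, mem_map']
  have h3 : some 0 ∉ I.map (optEmb _) := by
    simp [optEmb_apply]
  refine countC_eq_of_list ℓ m ?_ ?_
  · simp only [lenOut, h3, splitLen_optLen_zero]
    simp
  rw [sum_option_fin, coe_subtuple]
  simp only [lenOut, splitLen_optLen_none, splitLen_optLen_zero, splitLen_optLen_succ, h2, h3]
  simp only [or_true, if_true, reduceCtorEq, or_false, if_false, ne_eq, not_true_eq_false,
    false_and, and_false, zero_add]
  refine Finset.sum_congr rfl fun j _ => ?_
  by_cases hj : j ∈ I
  · simp [hj]
  · simp [hj, -List.get_eq_getElem, h1, Fin.ext_iff]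

lemma freeLabels_optLen (hν : ∀ x ∈ ν, 0 < x) :
    freeLabels (optLen μ₁ ν) (some 0) none = univ.map (optEmb ν.length) := by
  have h1 : ∀ i : Fin ν.length, ν.get i ≠ 0 := fun i => (hν _ (List.get_mem ν i)).ne'
  ext x
  simp only [freeLabels, mem_filter, mem_univ, true_and, mem_map]
  constructor
  · rintro ⟨h2, h3, h4⟩
    cases x with
    | none => exact absurd rfl h3
    | some j =>
      have hj : j ≠ 0 := fun h => h2 (by rw [h])
      obtain ⟨i, rfl⟩ := Fin.exists_succ_eq.2 hj
      exact ⟨i, rfl⟩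
  · rintro ⟨i, rfl⟩
    refine ⟨by simp [optEmb_apply, Fin.ext_iff], by simp [optEmb_apply], h1 i⟩

/-- The recursion for the numbers of factorisations, for lists of cycle lengths. -/
lemma countB_list_succ {n ℓ : ℕ} (h0 : 0 < ℓ) (hℓ : ℓ ≤ a) (hν : ∀ x ∈ ν, 0 < x) (m : ℕ) :
    countB (Fin (n + 1)) a ℓ (m + 1) (μ₁ :: ν).get ⟨0, by simp⟩ =
      (if a + 1 ≤ μ₁ + ℓ then ∑ i : Fin ν.length, countC (Fin (n + 1)) a ℓ m
        ((μ₁ + ν.get i) :: ν.eraseIdx i).get ⟨0, by simp⟩ else 0) +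
      ∑ c ∈ splittings μ₁, c.2 *
        (countC (Fin (n + 1)) a ℓ m (c.1 :: (ν ++ [c.2])).get ⟨0, by simp⟩ +
        ∑ d ∈ antidiagonal m, ∑ I : Finset (Fin ν.length), ∑ j ∈ range (n + 1), n.choose j *
          (countA (Fin j) a d.1 (subtuple ν I ++ [c.2]).get *
            countC (Fin (n + 1 - j)) a ℓ d.2 (c.1 :: subtuple ν Iᶜ).get ⟨0, by simp⟩)) := by
  have h1 : ∀ i : Fin ν.length, ν.get i ≠ 0 := fun i => (hν _ (List.get_mem ν i)).ne'
  rw [← countB_optLen hν, countB_succ h0 hℓ (i₀ := some 0) (b := none) (by simp) rfl]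
  have h2 : optLen μ₁ ν (some 0) = μ₁ := rfl
  rw [h2]
  congr 1
  · split_ifs with h
    · rw [sum_filter, sum_option_fin]
      have h3 : ∀ i : Fin ν.length, optLen μ₁ ν (some i.succ) = ν.get i := fun _ => rfl
      have h4 : optLen μ₁ ν none = 0 := rfl
      simp only [h3, h4, countC_mergeLen hν]
      simp [-List.get_eq_getElem, h1, Fin.ext_iff]
    · rfl
  · refine Finset.sum_congr rfl fun c hc => ?_
    have hc2 : 0 < c.2 := ((mem_splittings).1 hc).2.2
    rw [countC_splitLen hν _ _ _ hc2]
    congr 2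
    have h5 : ∀ f : Finset (Option (Fin (ν.length + 1))) → ℕ,
        ∑ I ∈ (freeLabels (optLen μ₁ ν) (some 0) none).powerset, f I =
          ∑ I : Finset (Fin ν.length), f (I.map (optEmb _)) := by
      intro f
      rw [freeLabels_optLen hν]
      symm
      refine Finset.sum_bij (fun I _ => I.map (optEmb _)) ?_ ?_ ?_ ?_
      · intro I _
        rw [mem_powerset]
        exact map_subset_map.2 (subset_univ _)
      · intro I _ J _ h
        exact map_injective _ h
      · intro J hJ
        rw [mem_powerset, subset_map_iff] at hJ
        obtain ⟨I, -, rfl⟩ := hJ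
        exact ⟨I, mem_univ _, rfl⟩
      · intro _ _
        rfl
    simp only [h5, countA_lenIn hν _ _ hc2, countC_lenOut hν, Finset.mul_sum]
    rw [Finset.sum_comm]
    refine Finset.sum_congr rfl fun d _ => ?_
    rw [Finset.sum_comm]

end Lists

/-! ### The normalised recursion -/

section Normalised

variable {a : ℕ} {μ₁ : ℕ} {ν : List ℕ}

lemma IsLab.exists_of_len_ne_zero {X ι : Type*} [Fintype X] {τ : Perm X} {len : ι → ℕ}
    {lab : X → ι} (h : IsLab τ len lab) {i : ι} (hi : len i ≠ 0) : ∃ x, lab x = i := by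
  rw [← h.card_eq, Finset.card_ne_zero] at hi
  obtain ⟨x, hx⟩ := hi
  exact ⟨x, (mem_filter.1 hx).2⟩

lemma forall_mem_append_pos {b : ℕ} (hν : ∀ x ∈ ν, 0 < x) (hb : 0 < b) :
    ∀ x ∈ ν ++ [b], 0 < x := fun x hx => by
  rw [List.mem_append, List.mem_singleton] at hx
  exact hx.elim (hν x) fun e => e ▸ hb

/-- The choice of the blocks that belong to the orbit without the last point, after
normalisation. -/
lemma sum_choose_mul_countA_mul_countC {n ℓ m m' : ℕ} (ha : 0 < a)
    (hs : (μ₁ :: ν).sum = (n + 1) * a) {c : ℕ × ℕ} (hc : c ∈ splittings μ₁)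
    (I : Finset (Fin ν.length)) :
    (∑ j ∈ range (n + 1), (n.choose j : ℚ) *
      (countA (Fin j) a m (subtuple ν I ++ [c.2]).get *
        countC (Fin (n + 1 - j)) a ℓ m' (c.1 :: subtuple ν Iᶜ).get ⟨0, by simp⟩)) /
      (a ^ (n + 1) * (n + 1).factorial) =
    ((subtuple ν Iᶜ).sum + c.1) / (μ₁ :: ν).sum *
      numA a m (subtuple ν I ++ [c.2]) * numC a ℓ m' c.1 (subtuple ν Iᶜ) := by
  obtain ⟨hc1, hc2, hc3⟩ := mem_splittings.1 hc
  have htot : (subtuple ν I ++ [c.2]).sum + (c.1 :: subtuple ν Iᶜ).sum = (n + 1) * a := by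
    have := sum_subtuple_add_compl ν I
    rw [List.sum_cons] at hs
    rw [List.sum_append, List.sum_singleton, List.sum_cons]
    omega
  by_cases hd : a ∣ (subtuple ν I ++ [c.2]).sum
  · obtain ⟨k₁, hk₁⟩ := hd
    rw [mul_comm] at hk₁
    have hd2 : a ∣ (c.1 :: subtuple ν Iᶜ).sum := by
      rw [← Nat.dvd_add_right (Dvd.intro_left _ hk₁.symm), htot]
      exact Dvd.intro_left _ rfl
    obtain ⟨k₂, hk₂⟩ := sum_cons_eq_of_dvd hc2 hd2
    have hk : k₁ + k₂ = n := by
      rw [hk₁, hk₂, ← add_mul] at htot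
      have := Nat.eq_of_mul_eq_mul_right ha htot
      omega
    rw [Finset.sum_eq_single k₁, numA_eq ha _ hk₁, numC_eq ha _ _ hk₂, hs]
    · subst hk
      rw [show k₁ + k₂ + 1 - k₁ = k₂ + 1 by omega]
      have h1 : ((subtuple ν Iᶜ).sum : ℚ) + c.1 = (k₂ + 1) * a := by
        rw [List.sum_cons] at hk₂
        have : (subtuple ν Iᶜ).sum + c.1 = (k₂ + 1) * a := by omega
        exact_mod_cast this
      have h2 : ((k₁ + k₂).choose k₁ : ℚ) * (k₁.factorial * k₂.factorial) =
          (k₁ + k₂).factorial := by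
        have := Nat.add_choose_mul_factorial_mul_factorial k₁ k₂
        rw [Nat.choose_symm_add, ← mul_assoc]
        exact_mod_cast this
      rw [h1]
      have ha' : (a : ℚ) ≠ 0 := by positivity
      have hf1 : (k₁.factorial : ℚ) ≠ 0 := by positivity
      have hf2 : (k₂.factorial : ℚ) ≠ 0 := by positivity
      have hf3 : ((k₁ + k₂).factorial : ℚ) ≠ 0 := by positivity
      have h4 : ((k₁ : ℚ) + k₂ + 1) ≠ 0 := by positivity
      have h5 : ((k₂ : ℚ) + 1) ≠ 0 := by positivity
      have h6 : ((k₁ + k₂).choose k₁ : ℚ) =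
          (k₁ + k₂).factorial / (k₁.factorial * k₂.factorial) := by
        rw [eq_div_iff (by positivity), h2]
      rw [h6, Nat.factorial_succ, Nat.factorial_succ]
      push_cast
      field_simp
      ring
    · intro j _ hj
      rw [countA, countWith_get_eq_zero]
      · simp
      · rw [hk₁]
        exact fun e => hj (Nat.eq_of_mul_eq_mul_right ha e).symm
    · intro h
      exact absurd (mem_range.2 (by omega)) h
  · rw [numA_eq_zero _ hd, Finset.sum_eq_zero]
    · simp
    · intro j _
      rw [countA, countWith_get_eq_zero fun e => hd (Dvd.intro_left _ e.symm)]
      simp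

/-- The cut-and-join recursion, organised by the number of transpositions. -/
theorem numB_succ {ℓ : ℕ} (h0 : 0 < ℓ) (hℓ : ℓ ≤ a) (hμ : 0 < μ₁) (hν : ∀ x ∈ ν, 0 < x) (m : ℕ) :
    numB a ℓ (m + 1) μ₁ ν =
      (if a + 1 ≤ μ₁ + ℓ then
        ∑ i : Fin ν.length, numC a ℓ m (μ₁ + ν.get i) (ν.eraseIdx i) else 0) +
      ∑ c ∈ splittings μ₁, (c.2 : ℚ) * (numC a ℓ m c.1 (ν ++ [c.2]) +
        ∑ d ∈ antidiagonal m, ∑ I : Finset (Fin ν.length),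
          ((subtuple ν Iᶜ).sum + c.1) / (μ₁ :: ν).sum *
            numA a d.1 (subtuple ν I ++ [c.2]) * numC a ℓ d.2 c.1 (subtuple ν Iᶜ)) := by
  have ha : 0 < a := by omega
  have hs1 : ∀ i : Fin ν.length, ((μ₁ + ν.get i) :: ν.eraseIdx i).sum = (μ₁ :: ν).sum := fun i => by
    rw [List.sum_cons, List.sum_cons, ← get_add_sum_eraseIdx ν i]
    ring
  have hs2 : ∀ c ∈ splittings μ₁, (c.1 :: (ν ++ [c.2])).sum = (μ₁ :: ν).sum := fun c hc => by
    have := (mem_splittings.1 hc).1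
    rw [List.sum_cons, List.sum_cons, List.sum_append, List.sum_singleton]
    omega
  by_cases h : a ∣ (μ₁ :: ν).sum
  · obtain ⟨n, hn⟩ := sum_cons_eq_of_dvd hμ h
    rw [numB_eq ha _ _ hn, countB_list_succ h0 hℓ hν]
    simp only [Nat.cast_add, Nat.cast_mul, Nat.cast_sum, Nat.cast_ite, Nat.cast_zero]
    rw [add_div]
    congr 1
    · split_ifs
      · rw [Finset.sum_div]
        exact Finset.sum_congr rfl fun i _ => (numC_eq ha _ _ ((hs1 i).trans hn)).symm
      · exact zero_div _
    · rw [Finset.sum_div]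
      refine Finset.sum_congr rfl fun c hc => ?_
      rw [mul_div_assoc, add_div, ← numC_eq ha _ _ ((hs2 c hc).trans hn), Finset.sum_div]
      congr 2
      refine Finset.sum_congr rfl fun d _ => ?_
      rw [Finset.sum_div]
      exact Finset.sum_congr rfl fun I _ => sum_choose_mul_countA_mul_countC ha hn hc I
  · rw [numB_eq_zero _ _ h]
    have h1 : ∀ i : Fin ν.length, numC a ℓ m (μ₁ + ν.get i) (ν.eraseIdx i) = 0 := fun i =>
      numC_eq_zero _ _ (by rwa [hs1])
    simp only [h1, Finset.sum_const_zero, ite_self, zero_add]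
    refine (Finset.sum_eq_zero fun c hc => ?_).symm
    rw [numC_eq_zero _ _ (by rwa [hs2 c hc]), zero_add]
    refine mul_eq_zero_of_right _ (Finset.sum_eq_zero fun d _ => Finset.sum_eq_zero fun I _ => ?_)
    have htot : (subtuple ν I ++ [c.2]).sum + (c.1 :: subtuple ν Iᶜ).sum = (μ₁ :: ν).sum := by
      have := sum_subtuple_add_compl ν I
      have := (mem_splittings.1 hc).1
      rw [List.sum_append, List.sum_singleton, List.sum_cons, List.sum_cons]
      omega
    by_cases hd : a ∣ (subtuple ν I ++ [c.2]).sum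
    · rw [numC_eq_zero _ _ fun h' => h (htot ▸ dvd_add hd h'), mul_zero]
    · rw [numA_eq_zero _ hd, mul_zero, zero_mul]

/-- Without transpositions there is a single cycle of length `a`. -/
lemma countB_zero_ne_zero {k ℓ : ℕ} (hμ : ∀ x ∈ μ₁ :: ν, 0 < x)
    (h : countB (Fin (k + 1)) a ℓ 0 (μ₁ :: ν).get ⟨0, by simp⟩ ≠ 0) (ha : 0 < a) :
    k = 0 ∧ ν = [] := by
  rw [countB, countWith, card_ne_zero] at h
  obtain ⟨⟨L, lab⟩, hL⟩ := h
  simp only [mem_filter, mem_product, mem_monoWords, List.length_eq_zero_iff, mem_univ,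
    and_true] at hL
  obtain ⟨⟨rfl, -⟩, hc, hl, -⟩ := hL
  have hsame : ∀ x y, SameCycle (wordPerm [] * blockRot (Fin (k + 1)) a) x y := by
    intro x y
    refine (hc x y {z | SameCycle (wordPerm [] * blockRot (Fin (k + 1)) a) x z} ⟨fun z => ?_,
      by simp⟩).1 (SameCycle.refl _ _)
    rw [wordPerm_nil, one_mul]
    exact sameCycle_apply_right
  constructor
  · by_contra hk
    have h1 := hc (toLex (0, ⟨0, ha⟩)) (toLex (Fin.last k, ⟨0, ha⟩)) {z | (ofLex z).1 = 0}
      ⟨fun z => Iff.rfl, by simp⟩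
    have h2 := h1.1 rfl
    simp only [Set.mem_ofPred_eq, ofLex_toLex, Fin.ext_iff, Fin.val_last, Fin.val_zero] at h2
    exact hk h2
  · cases ν with
    | nil => rfl
    | cons b ν =>
      have hx : ∀ i, ∃ x, lab x = i := by
        exact fun i => hl.exists_of_len_ne_zero (hμ _ (List.get_mem (μ₁ :: b :: ν) i)).ne'
      obtain ⟨x, hx'⟩ := hx ⟨0, by simp⟩
      obtain ⟨y, hy⟩ := hx ⟨1, by simp⟩
      have := (hl.same_iff x y).2 (hsame x y)
      rw [hx', hy] at this
      simp at this

lemma length_get_cons_eraseIdx (μ : List ℕ) (i : Fin μ.length) :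
    (μ.get i :: μ.eraseIdx i).length = μ.length := by
  have := i.2
  rw [List.length_cons, List.length_eraseIdx_of_lt i.2]
  omega

/-- The existence of a genus `g` for the given number of transpositions. -/
def HasGenus (a m : ℕ) (μ : List ℕ) : Prop := ∃ g, m + 2 = 2 * g + μ.length + μ.sum / a

lemma sum_div_add {x y z : ℕ} (h : x + y = z) (hx : a ∣ x) : x / a + y / a = z / a := by
  rw [← h, Nat.add_div_of_dvd_right hx]

/-- Refined factorisations exist only if the number of transpositions is given by a genus. -/
lemma hasGenus_of_numB_ne_zero (m : ℕ) : ∀ {ℓ μ₁ : ℕ} {ν : List ℕ}, 0 < ℓ → ℓ ≤ a → 0 < μ₁ →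
    (∀ x ∈ ν, 0 < x) → numB a ℓ m μ₁ ν ≠ 0 → HasGenus a m (μ₁ :: ν) := by
  induction m using Nat.strong_induction_on with
  | _ m ih =>
    intro ℓ μ₁ ν h0 hℓ hμ hν h
    have ha : 0 < a := by omega
    have hdvd : a ∣ (μ₁ :: ν).sum := by
      by_contra hd
      exact h (numB_eq_zero _ _ hd)
    have hC : ∀ m' < m, ∀ {ℓ μ₁ : ℕ} {ν : List ℕ}, 0 < ℓ → ℓ ≤ a → 0 < μ₁ →
        (∀ x ∈ ν, 0 < x) → numC a ℓ m' μ₁ ν ≠ 0 → HasGenus a m' (μ₁ :: ν) := by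
      intro m' hm' ℓ μ₁ ν h0 hℓ hμ hν h
      rw [← sum_numB h0 hℓ m' hμ] at h
      obtain ⟨p, hp, h⟩ := Finset.exists_ne_zero_of_sum_ne_zero h
      rw [mem_Icc] at hp
      exact ih m' hm' hp.1 (hp.2.trans hℓ) hμ hν h
    have hA : ∀ m' < m, ∀ {μ : List ℕ}, μ ≠ [] → (∀ x ∈ μ, 0 < x) → numA a m' μ ≠ 0 →
        HasGenus a m' μ := by
      intro m' hm' μ hne hμ h
      rw [numA_eq_sum ha m' hne hμ] at h
      obtain ⟨i, -, h⟩ := Finset.exists_ne_zero_of_sum_ne_zero h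
      obtain ⟨g, hg⟩ := hC m' hm' ha le_rfl (hμ _ (List.get_mem μ i))
        (fun x hx => hμ x (List.mem_of_mem_eraseIdx hx)) h
      refine ⟨g, ?_⟩
      rwa [length_get_cons_eraseIdx, List.sum_cons, get_add_sum_eraseIdx] at hg
    cases m with
    | zero =>
      obtain ⟨n, hn⟩ := sum_cons_eq_of_dvd hμ hdvd
      rw [numB_eq ha _ _ hn] at h
      have h1 : countB (Fin (n + 1)) a ℓ 0 (μ₁ :: ν).get ⟨0, by simp⟩ ≠ 0 := fun e =>
        h (by rw [e, Nat.cast_zero, zero_div])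
      obtain ⟨rfl, rfl⟩ := countB_zero_ne_zero
        (fun x hx => (List.mem_cons.1 hx).elim (fun e => e ▸ hμ) (hν x)) h1 ha
      exact ⟨0, by rw [hn, Nat.mul_div_cancel _ ha]; simp⟩
    | succ m =>
      rw [numB_succ h0 hℓ hμ hν] at h
      by_cases h1 : (if a + 1 ≤ μ₁ + ℓ then
        ∑ i : Fin ν.length, numC a ℓ m (μ₁ + ν.get i) (ν.eraseIdx i) else 0) = 0
      · rw [h1, zero_add] at h
        obtain ⟨c, hc, h⟩ := Finset.exists_ne_zero_of_sum_ne_zero h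
        have h := right_ne_zero_of_mul h
        obtain ⟨hc1, hc2, hc3⟩ := mem_splittings.1 hc
        by_cases h2 : numC a ℓ m c.1 (ν ++ [c.2]) = 0
        · rw [h2, zero_add] at h
          obtain ⟨d, hd, h⟩ := Finset.exists_ne_zero_of_sum_ne_zero h
          obtain ⟨I, -, h⟩ := Finset.exists_ne_zero_of_sum_ne_zero h
          rw [HasAntidiagonal.mem_antidiagonal] at hd
          have hA' := right_ne_zero_of_mul (left_ne_zero_of_mul h)
          obtain ⟨g₁, hg₁⟩ := hA d.1 (by omega) (by simp)
            (forall_mem_append_pos (fun x hx => hν x (mem_subtuple hx)) hc3) hA'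
          obtain ⟨g₂, hg₂⟩ := hC d.2 (by omega) h0 hℓ hc2
            (fun x hx => hν x (mem_subtuple hx)) (right_ne_zero_of_mul h)
          have hdA : a ∣ (subtuple ν I ++ [c.2]).sum := by
            by_contra hdA
            exact hA' (numA_eq_zero _ hdA)
          have hlen := length_subtuple_add_compl ν I
          have hsum := sum_subtuple_add_compl ν I
          have htot : (subtuple ν I ++ [c.2]).sum + (c.1 :: subtuple ν Iᶜ).sum =
              (μ₁ :: ν).sum := by
            rw [List.sum_append, List.sum_singleton, List.sum_cons, List.sum_cons]
            omega
          have hdiv := sum_div_add htot hdA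
          refine ⟨g₁ + g₂, ?_⟩
          rw [List.length_append, List.length_singleton] at hg₁
          rw [List.length_cons] at hg₂ ⊢
          omega
        · obtain ⟨g, hg⟩ := hC m (by omega) h0 hℓ hc2 (fun x hx => by
            rw [List.mem_append, List.mem_singleton] at hx
            exact hx.elim (hν x) fun e => e ▸ hc3) h2
          have hs : (c.1 :: (ν ++ [c.2])).sum = (μ₁ :: ν).sum := by
            rw [List.sum_cons, List.sum_cons, List.sum_append, List.sum_singleton]
            omega
          rw [hs, List.length_cons, List.length_append, List.length_singleton] at hg
          refine ⟨g + 1, ?_⟩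
          rw [List.length_cons]
          omega
      · split_ifs at h1 with h3
        · obtain ⟨i, -, h⟩ := Finset.exists_ne_zero_of_sum_ne_zero h1
          obtain ⟨g, hg⟩ := hC m (by omega) h0 hℓ (by omega)
            (fun x hx => hν x (List.mem_of_mem_eraseIdx hx)) h
          have hs : ((μ₁ + ν.get i) :: ν.eraseIdx i).sum = (μ₁ :: ν).sum := by
            rw [List.sum_cons, List.sum_cons, ← get_add_sum_eraseIdx ν i]
            ring
          have hi := i.2
          rw [hs, List.length_cons, List.length_eraseIdx_of_lt i.2] at hg
          refine ⟨g, ?_⟩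
          rw [List.length_cons]
          omega
        · exact absurd rfl h1

lemma hasGenus_of_numC_ne_zero {m ℓ : ℕ} (h0 : 0 < ℓ) (hℓ : ℓ ≤ a) (hμ : 0 < μ₁)
    (hν : ∀ x ∈ ν, 0 < x) (h : numC a ℓ m μ₁ ν ≠ 0) : HasGenus a m (μ₁ :: ν) := by
  rw [← sum_numB h0 hℓ m hμ] at h
  obtain ⟨p, hp, h⟩ := Finset.exists_ne_zero_of_sum_ne_zero h
  rw [mem_Icc] at hp
  exact hasGenus_of_numB_ne_zero m hp.1 (hp.2.trans hℓ) hμ hν h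

lemma hasGenus_of_numA_ne_zero {m : ℕ} (ha : 0 < a) {μ : List ℕ} (hne : μ ≠ [])
    (hμ : ∀ x ∈ μ, 0 < x) (h : numA a m μ ≠ 0) : HasGenus a m μ := by
  rw [numA_eq_sum ha m hne hμ] at h
  obtain ⟨i, -, h⟩ := Finset.exists_ne_zero_of_sum_ne_zero h
  obtain ⟨g, hg⟩ := hasGenus_of_numC_ne_zero ha le_rfl (hμ _ (List.get_mem μ i))
    (fun x hx => hμ x (List.mem_of_mem_eraseIdx hx)) h
  refine ⟨g, ?_⟩
  rwa [length_get_cons_eraseIdx, List.sum_cons, get_add_sum_eraseIdx] at hg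

end Normalised

/-! ### The cut-and-join system of the Hurwitz numbers -/

section Existence

variable {a : ℕ} {μ₁ : ℕ} {ν : List ℕ}

lemma forall_mem_cons_pos (hμ : 0 < μ₁) (hν : ∀ x ∈ ν, 0 < x) : ∀ x ∈ μ₁ :: ν, 0 < x :=
  fun x hx => (List.mem_cons.1 hx).elim (fun e => e ▸ hμ) (hν x)

lemma H_eq_numA (ha : 0 < a) (g : ℕ) {μ : List ℕ} (hμ : ∀ x ∈ μ, 0 < x) :
    H a g μ = numA a (numTranspositions a g μ) μ := by
  by_cases h : a ∣ μ.sum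
  · obtain ⟨k, hk⟩ := h
    rw [mul_comm] at hk
    rw [H_eq ha g hμ hk, numA_eq ha _ hk]
  · rw [H_eq_zero g h, numA_eq_zero _ h]

lemma Href_eq_numB {ℓ : ℕ} (h0 : 0 < ℓ) (hℓ : ℓ ≤ a) (g : ℕ) (hμ : 0 < μ₁)
    (hν : ∀ x ∈ ν, 0 < x) :
    Href a ℓ g μ₁ ν = numB a ℓ (numTranspositions a g (μ₁ :: ν)) μ₁ ν := by
  by_cases h : a ∣ (μ₁ :: ν).sum
  · obtain ⟨n, hn⟩ := sum_cons_eq_of_dvd hμ h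
    rw [Href_eq h0 hℓ g (forall_mem_cons_pos hμ hν) hn, numB_eq (by omega) _ _ hn]
  · rw [Href_eq_zero ℓ g μ₁ h, numB_eq_zero _ _ h]

lemma sum_Href {ℓ : ℕ} (h0 : 0 < ℓ) (hℓ : ℓ ≤ a) (g : ℕ) (hμ : 0 < μ₁) (hν : ∀ x ∈ ν, 0 < x) :
    ∑ p ∈ Icc 1 ℓ, Href a p g μ₁ ν = numC a ℓ (numTranspositions a g (μ₁ :: ν)) μ₁ ν := by
  rw [← sum_numB h0 hℓ _ hμ]
  refine Finset.sum_congr rfl fun p hp => ?_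
  rw [mem_Icc] at hp
  exact Href_eq_numB hp.1 (hp.2.trans hℓ) g hμ hν

lemma H_eq_sum_Href (ha : 0 < a) (g : ℕ) {μ : List ℕ} (hne : μ ≠ []) (hμ : ∀ x ∈ μ, 0 < x) :
    H a g μ = ∑ i : Fin μ.length, ∑ ℓ ∈ Icc 1 a, Href a ℓ g (μ.get i) (μ.eraseIdx i) := by
  rw [H_eq_numA ha g hμ, numA_eq_sum ha _ hne hμ]
  refine Finset.sum_congr rfl fun i _ => ?_
  rw [sum_Href ha le_rfl g (hμ _ (List.get_mem μ i))
    (fun x hx => hμ x (List.mem_of_mem_eraseIdx hx)), numTranspositions, numTranspositions,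
    length_get_cons_eraseIdx, List.sum_cons, get_add_sum_eraseIdx]

lemma isLab_const {X ι : Type*} [Fintype X] {τ : Perm X} {len : ι → ℕ} {i₀ : ι}
    (hτ : ∀ x y, SameCycle τ x y) (hi : ∀ i, i = i₀) (hlen : len i₀ = Fintype.card X) :
    IsLab τ len (fun _ => i₀) := by
  refine ⟨fun x y => ⟨fun _ => hτ x y, fun _ => rfl⟩, fun i => ?_⟩
  rw [hi i, filter_true_of_mem fun x _ => rfl, card_univ, hlen]

lemma countB_base (ha : 0 < a) (ℓ : ℕ) :
    countB (Fin 1) a ℓ 0 [a].get ⟨0, by simp⟩ = if ℓ = 1 then 1 else 0 := by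
  have hsame : ∀ x y, SameCycle (wordPerm [] * blockRot (Fin 1) a) x y := by
    have h1 : ∀ x, SameCycle (wordPerm [] * blockRot (Fin 1) a) (toLex (0, ⟨0, ha⟩)) x := by
      intro x
      obtain ⟨⟨i, j⟩, rfl⟩ := toLex.surjective x
      have := blockRot_pow (a := a) i (j := 0) (i := j) (by have := j.2; omega)
      simp only [zero_add, Fin.eta] at this
      rw [Subsingleton.elim i 0] at this ⊢
      rw [wordPerm_nil, one_mul, ← this]
      exact sameCycle_pow_right.2 (SameCycle.refl _ _)
    exact fun x y => (h1 x).symm.trans (h1 y)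
  rw [countB, countWith]
  split_ifs with hℓ
  · rw [card_eq_one]
    refine ⟨([], fun _ => ⟨0, by simp⟩), ?_⟩
    ext ⟨L, lab⟩
    simp only [mem_filter, mem_product, mem_monoWords, List.length_eq_zero_iff, mem_univ,
      and_true, mem_singleton, Prod.mk.injEq]
    constructor
    · rintro ⟨⟨rfl, -⟩, -⟩
      exact ⟨rfl, funext fun x => Subsingleton.elim (α := Fin 1) _ _⟩
    · rintro ⟨rfl, rfl⟩
      refine ⟨⟨rfl, isMonoWord_nil⟩, fun x y => linked_of_sameCycle (hsame x y),
        isLab_const hsame (fun i => Subsingleton.elim (α := Fin 1) _ _) ?_, fun _ => hℓ, by simp,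
        fun _ _ => rfl⟩
      rw [card_blocks]
      simp
  · by_contra hne
    obtain ⟨⟨L, lab⟩, hL⟩ := card_ne_zero.1 hne
    simp only [mem_filter, mem_product, mem_monoWords, List.length_eq_zero_iff] at hL
    exact hℓ (hL.2.2.2.1 hL.1.1.1)

lemma Href_base {ℓ : ℕ} (h0 : 0 < ℓ) (hℓ : ℓ ≤ a) :
    Href a ℓ 0 a [] = if ℓ = 1 then 1 / (a : ℚ) else 0 := by
  have ha : 0 < a := by omega
  have hs : (a :: ([] : List ℕ)).sum = (0 + 1) * a := by simp
  have hT : numTranspositions a 0 [a] = 0 := by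
    rw [numTranspositions, hs, Nat.mul_div_cancel _ ha]
    simp
  rw [Href_eq_numB h0 hℓ 0 ha (by simp), hT, numB_eq ha _ _ hs, countB_base ha]
  split_ifs <;> simp

/-- The sum over the distributions of the genus agrees with the sum over the distributions of the
transpositions. -/
lemma sum_genus {ℓ g m : ℕ} (h0 : 0 < ℓ) (hℓ : ℓ ≤ a) (hν : ∀ x ∈ ν, 0 < x)
    (hdvd : a ∣ (μ₁ :: ν).sum)
    (hm : m + 3 = 2 * g + (μ₁ :: ν).length + (μ₁ :: ν).sum / a) {q : ℕ × ℕ}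
    (hq : q ∈ splittings μ₁) (I : Finset (Fin ν.length)) :
    ∑ h ∈ antidiagonal g, H a h.1 (subtuple ν I ++ [q.2]) *
      ∑ p ∈ Icc 1 ℓ, Href a p h.2 q.1 (subtuple ν Iᶜ) =
    ∑ d ∈ antidiagonal m, numA a d.1 (subtuple ν I ++ [q.2]) *
      numC a ℓ d.2 q.1 (subtuple ν Iᶜ) := by
  have ha : 0 < a := by omega
  obtain ⟨hq1, hq2, hq3⟩ := mem_splittings.1 hq
  have hI : ∀ J : Finset (Fin ν.length), ∀ x ∈ subtuple ν J, 0 < x := fun J x hx =>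
    hν x (mem_subtuple hx)
  have hpos := forall_mem_append_pos (hI I) hq3
  have hterm : ∀ h : ℕ × ℕ, H a h.1 (subtuple ν I ++ [q.2]) *
      ∑ p ∈ Icc 1 ℓ, Href a p h.2 q.1 (subtuple ν Iᶜ) =
      numA a (numTranspositions a h.1 (subtuple ν I ++ [q.2])) (subtuple ν I ++ [q.2]) *
      numC a ℓ (numTranspositions a h.2 (q.1 :: subtuple ν Iᶜ)) q.1 (subtuple ν Iᶜ) := fun h => by
    rw [sum_Href h0 hℓ _ hq2 (hI _), H_eq_numA ha _ hpos]
  by_cases hd : a ∣ (subtuple ν I ++ [q.2]).sum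
  · have hlen := length_subtuple_add_compl ν I
    have hsum := sum_subtuple_add_compl ν I
    have htot : (subtuple ν I ++ [q.2]).sum + (q.1 :: subtuple ν Iᶜ).sum = (μ₁ :: ν).sum := by
      rw [List.sum_append, List.sum_singleton, List.sum_cons, List.sum_cons]
      omega
    have hdiv := sum_div_add htot hd
    have hk1 : 0 < (subtuple ν I ++ [q.2]).sum / a := by
      refine Nat.div_pos (Nat.le_of_dvd ?_ hd) ha
      rw [List.sum_append, List.sum_singleton]
      omega
    have hk2 : 0 < (q.1 :: subtuple ν Iᶜ).sum / a := by
      refine Nat.div_pos (Nat.le_of_dvd ?_ ?_) ha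
      · rw [List.sum_cons]
        omega
      · rwa [← Nat.dvd_add_right hd, htot]
    have hl1 : (subtuple ν I ++ [q.2]).length = (subtuple ν I).length + 1 := by simp
    have hl2 : (q.1 :: subtuple ν Iᶜ).length = (subtuple ν Iᶜ).length + 1 := by simp
    have hl3 : (μ₁ :: ν).length = ν.length + 1 := by simp
    refine Finset.sum_of_injOn (fun h => (numTranspositions a h.1 (subtuple ν I ++ [q.2]),
      numTranspositions a h.2 (q.1 :: subtuple ν Iᶜ))) ?_ ?_ ?_ ?_
    · rintro ⟨g₁, g₂⟩ - ⟨g₁', g₂'⟩ - h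
      simp only [numTranspositions, Prod.mk.injEq] at h ⊢
      omega
    · rintro ⟨g₁, g₂⟩ h
      simp only [mem_coe, HasAntidiagonal.mem_antidiagonal] at h ⊢
      simp only [numTranspositions]
      omega
    · rintro ⟨d₁, d₂⟩ h hne
      rw [HasAntidiagonal.mem_antidiagonal] at h
      by_contra hmul
      obtain ⟨g₁, hg₁⟩ := hasGenus_of_numA_ne_zero ha (by simp) hpos (left_ne_zero_of_mul hmul)
      obtain ⟨g₂, hg₂⟩ := hasGenus_of_numC_ne_zero h0 hℓ hq2 (hI _) (right_ne_zero_of_mul hmul)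
      apply hne
      refine ⟨(g₁, g₂), ?_, ?_⟩
      · simp only [mem_coe, HasAntidiagonal.mem_antidiagonal]
        simp only at h hg₁ hg₂
        omega
      · simp only [numTranspositions, Prod.mk.injEq]
        simp only at hg₁ hg₂
        omega
    · exact fun h _ => hterm h
  · simp only [hterm, numA_eq_zero _ hd, zero_mul, Finset.sum_const_zero]

/-- In the recursion on the number of transpositions, the counts for a given genus have one
transposition less on the right-hand side. If `a` does not divide `|μ|`, both sides vanish. -/
lemma Href_recursion {ℓ : ℕ} (h0 : 0 < ℓ) (hℓ : ℓ ≤ a) (g : ℕ) (hμ : 0 < μ₁)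
    (hν : ∀ x ∈ ν, 0 < x) (hne : ¬ (g = 0 ∧ μ₁ = a ∧ ν = [])) :
    Href a ℓ g μ₁ ν =
      cutJoinRHS a (fun g μ => H a g μ) (fun ℓ g μ₁ ν => Href a ℓ g μ₁ ν) ℓ g μ₁ ν := by
  have ha : 0 < a := by omega
  have hs1 : ∀ i : Fin ν.length, ((μ₁ + ν.get i) :: ν.eraseIdx i).sum = (μ₁ :: ν).sum := fun i => by
    rw [List.sum_cons, List.sum_cons, ← get_add_sum_eraseIdx ν i]
    ring
  have hs2 : ∀ c ∈ splittings μ₁, (c.1 :: (ν ++ [c.2])).sum = (μ₁ :: ν).sum := fun c hc => by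
    have := (mem_splittings.1 hc).1
    rw [List.sum_cons, List.sum_cons, List.sum_append, List.sum_singleton]
    omega
  by_cases h : a ∣ (μ₁ :: ν).sum
  swap
  · -- all the terms vanish unless `a` divides `|μ|`
    have h1 : ∀ p, ∀ i : Fin ν.length, Href a p g (μ₁ + ν.get i) (ν.eraseIdx i) = 0 := fun p i =>
      Href_eq_zero _ _ _ (by rwa [hs1])
    have h2 : ∀ c ∈ splittings μ₁, ∀ p, Href a p (g - 1) c.1 (ν ++ [c.2]) = 0 := fun c hc p =>
      Href_eq_zero _ _ _ (by rwa [hs2 c hc])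
    have h3 : ∀ c ∈ splittings μ₁, ∀ (d : ℕ × ℕ) (I : Finset (Fin ν.length)) (p : ℕ),
        H a d.1 (subtuple ν I ++ [c.2]) * Href a p d.2 c.1 (subtuple ν Iᶜ) = 0 := by
      intro c hc d I p
      have htot : (subtuple ν I ++ [c.2]).sum + (c.1 :: subtuple ν Iᶜ).sum = (μ₁ :: ν).sum := by
        have := sum_subtuple_add_compl ν I
        have := (mem_splittings.1 hc).1
        rw [List.sum_append, List.sum_singleton, List.sum_cons, List.sum_cons]
        omega
      by_cases hd : a ∣ (subtuple ν I ++ [c.2]).sum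
      · rw [Href_eq_zero _ _ _ fun h' => h (htot ▸ dvd_add hd h'), mul_zero]
      · rw [H_eq_zero _ hd, zero_mul]
    rw [Href_eq_zero _ _ _ h, cutJoinRHS]
    simp only [h1, Finset.sum_const_zero, mul_zero, zero_add]
    rw [Finset.sum_congr rfl fun c hc => Finset.sum_congr rfl fun p _ => by
      rw [h2 c hc p, mul_zero]]
    simp only [mul_assoc]
    rw [Finset.sum_eq_zero (s := splittings μ₁) fun c hc => Finset.sum_eq_zero fun d _ =>
      Finset.sum_eq_zero fun I _ => Finset.sum_eq_zero fun p _ => by rw [h3 c hc d I p]; simp]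
    simp
  obtain ⟨n, hn⟩ := sum_cons_eq_of_dvd hμ h
  have hk : (μ₁ :: ν).sum / a = n + 1 := by rw [hn, Nat.mul_div_cancel _ ha]
  have hl : (μ₁ :: ν).length = ν.length + 1 := by simp
  obtain ⟨m, hm⟩ : ∃ m, numTranspositions a g (μ₁ :: ν) = m + 1 := by
    refine ⟨numTranspositions a g (μ₁ :: ν) - 1, ?_⟩
    have : numTranspositions a g (μ₁ :: ν) ≠ 0 := by
      intro h0
      rw [numTranspositions, hk, hl] at h0
      have hν0 : ν = [] := List.length_eq_zero_iff.1 (by omega)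
      refine hne ⟨by omega, ?_, hν0⟩
      have hn0 : n = 0 := by omega
      rw [hν0, hn0] at hn
      simpa using hn
    omega
  have hm3 : m + 3 = 2 * g + (μ₁ :: ν).length + (μ₁ :: ν).sum / a := by
    rw [numTranspositions] at hm
    omega
  rw [Href_eq_numB h0 hℓ g hμ hν, hm, numB_succ h0 hℓ hμ hν, cutJoinRHS]
  simp only [mul_add, Finset.sum_add_distrib, ← add_assoc]
  congr 1
  congr 1
  · rw [heaviside, ite_mul, one_mul, zero_mul]
    by_cases hh : a + 1 ≤ μ₁ + ℓ
    · rw [if_pos hh, if_pos (by omega), Finset.sum_comm]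
      refine Finset.sum_congr rfl fun i _ => ?_
      rw [sum_Href h0 hℓ g (by omega) fun x hx => hν x (List.mem_of_mem_eraseIdx hx)]
      congr 1
      have hi := i.2
      rw [numTranspositions, hs1, List.length_cons, List.length_eraseIdx_of_lt i.2]
      omega
    · rw [if_neg hh, if_neg (by omega)]
  · split_ifs with hg
    · refine Finset.sum_eq_zero fun c hc => ?_
      obtain ⟨-, hc2, hc3⟩ := mem_splittings.1 hc
      by_contra hne
      obtain ⟨g', hg'⟩ := hasGenus_of_numC_ne_zero h0 hℓ hc2 (forall_mem_append_pos hν hc3)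
        (right_ne_zero_of_mul hne)
      rw [hs2 c hc, List.length_cons, List.length_append, List.length_singleton] at hg'
      omega
    · refine Finset.sum_congr rfl fun c hc => ?_
      obtain ⟨-, hc2, hc3⟩ := mem_splittings.1 hc
      rw [← Finset.mul_sum, sum_Href h0 hℓ _ hc2 (forall_mem_append_pos hν hc3)]
      congr 2
      rw [numTranspositions, hs2 c hc, List.length_cons, List.length_append, List.length_singleton]
      omega
  · refine Finset.sum_congr rfl fun c hc => ?_
    rw [Finset.sum_comm, Finset.sum_comm (s := antidiagonal g), Finset.mul_sum]
    refine Finset.sum_congr rfl fun I _ => ?_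
    have := sum_genus h0 hℓ hν h hm3 hc I
    simp only [← Finset.mul_sum, mul_assoc]
    rw [← this]
    ring

theorem cutJoinSystem_H (ha : 0 < a) :
    CutJoinSystem a (fun g μ => H a g μ) (fun ℓ g μ₁ ν => Href a ℓ g μ₁ ν) where
  decomposition g _ hne hμ := H_eq_sum_Href ha g hne hμ
  base _ hℓ := Href_base (mem_Icc.1 hℓ).1 (mem_Icc.1 hℓ).2
  recursion _ hℓ g _ _ hμ hν hne :=
    Href_recursion (mem_Icc.1 hℓ).1 (mem_Icc.1 hℓ).2 g hμ hν hne

end Existence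

/-! ### Uniqueness -/

section Uniqueness

variable {a : ℕ} {F F' : ℕ → List ℕ → ℚ} {R R' : ℕ → ℕ → ℕ → List ℕ → ℚ}

/-- The refined numbers for tuples of a given size determine the unrefined ones. -/
lemma CutJoinSystem.eq_of_refined (h : CutJoinSystem a F R) (h' : CutJoinSystem a F' R') {d : ℕ}
    (hR : ∀ ℓ ∈ Icc 1 a, ∀ (g μ₁ : ℕ) (ν : List ℕ), 0 < μ₁ → (∀ x ∈ ν, 0 < x) →
      (μ₁ :: ν).sum = d → R ℓ g μ₁ ν = R' ℓ g μ₁ ν) (g : ℕ) {μ : List ℕ} (hne : μ ≠ [])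
    (hμ : ∀ x ∈ μ, 0 < x) (hd : μ.sum = d) : F g μ = F' g μ := by
  rw [h.decomposition g μ hne hμ, h'.decomposition g μ hne hμ]
  refine Finset.sum_congr rfl fun i _ => Finset.sum_congr rfl fun ℓ hℓ => ?_
  refine hR ℓ hℓ g _ _ (hμ _ (List.get_mem μ i))
    (fun x hx => hμ x (List.mem_of_mem_eraseIdx hx)) ?_
  rw [List.sum_cons, get_add_sum_eraseIdx, hd]

/-- The recursion expresses the refined numbers through those with smaller `|μ|`, and those with the
same `|μ|` and smaller `2 g + n`. -/
lemma CutJoinSystem.refined_unique (h : CutJoinSystem a F R) (h' : CutJoinSystem a F' R') (d : ℕ) :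
    ∀ t, ∀ ℓ ∈ Icc 1 a, ∀ (g μ₁ : ℕ) (ν : List ℕ), 0 < μ₁ → (∀ x ∈ ν, 0 < x) →
      (μ₁ :: ν).sum = d → 2 * g + ν.length = t → R ℓ g μ₁ ν = R' ℓ g μ₁ ν := by
  induction d using Nat.strong_induction_on with
  | _ d ihd =>
    intro t
    induction t using Nat.strong_induction_on with
    | _ t iht =>
      intro ℓ hℓ g μ₁ ν hμ hν hd ht
      by_cases hbase : g = 0 ∧ μ₁ = a ∧ ν = []
      · obtain ⟨rfl, rfl, rfl⟩ := hbase
        rw [h.base ℓ hℓ, h'.base ℓ hℓ]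
      have hIcc : ∀ p ∈ Icc 1 ℓ, p ∈ Icc 1 a := fun p hp => by
        rw [mem_Icc] at hℓ hp ⊢
        omega
      rw [h.recursion _ hℓ g _ _ hμ hν hbase, h'.recursion _ hℓ g _ _ hμ hν hbase, cutJoinRHS,
        cutJoinRHS]
      rw [List.sum_cons] at hd
      congr 1
      · congr 1
        · congr 1
          refine Finset.sum_congr rfl fun p hp => Finset.sum_congr rfl fun i _ => ?_
          have hi := i.2
          refine iht (t - 1) (by omega) p (hIcc p hp) g _ _ (by omega)
            (fun x hx => hν x (List.mem_of_mem_eraseIdx hx)) ?_ ?_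
          · rw [List.sum_cons, ← hd, ← get_add_sum_eraseIdx ν i]
            ring
          · rw [List.length_eraseIdx_of_lt i.2]
            omega
        · split_ifs with hg
          · rfl
          · refine Finset.sum_congr rfl fun q hq => Finset.sum_congr rfl fun p hp => ?_
            obtain ⟨hq1, hq2, hq3⟩ := mem_splittings.1 hq
            rw [iht (t - 1) (by omega) p (hIcc p hp) (g - 1) q.1 (ν ++ [q.2]) hq2
              (forall_mem_append_pos hν hq3)]
            · rw [List.sum_cons, List.sum_append, List.sum_singleton]
              omega
            · rw [List.length_append, List.length_singleton]
              omega
      · refine Finset.sum_congr rfl fun q hq => Finset.sum_congr rfl fun c _ =>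
          Finset.sum_congr rfl fun I _ => Finset.sum_congr rfl fun p hp => ?_
        obtain ⟨hq1, hq2, hq3⟩ := mem_splittings.1 hq
        have hsum := sum_subtuple_add_compl ν I
        have hI : ∀ J : Finset (Fin ν.length), ∀ x ∈ subtuple ν J, 0 < x := fun J x hx =>
          hν x (mem_subtuple hx)
        have hF : F c.1 (subtuple ν I ++ [q.2]) = F' c.1 (subtuple ν I ++ [q.2]) := by
          refine h.eq_of_refined h' (d := (subtuple ν I ++ [q.2]).sum) ?_ c.1 (by simp)
            (forall_mem_append_pos (hI I) hq3) rfl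
          intro ℓ hℓ g μ₁ ν hμ hν hd
          refine ihd _ ?_ _ ℓ hℓ g μ₁ ν hμ hν hd rfl
          rw [List.sum_append, List.sum_singleton]
          omega
        have hR : R p c.2 q.1 (subtuple ν Iᶜ) = R' p c.2 q.1 (subtuple ν Iᶜ) := by
          refine ihd _ ?_ _ p (hIcc p hp) c.2 q.1 _ hq2 (hI _) rfl rfl
          rw [List.sum_cons]
          omega
        rw [hF, hR]

theorem CutJoinSystem.unique (h : CutJoinSystem a F R) (h' : CutJoinSystem a F' R') :
    (∀ (g : ℕ) (μ : List ℕ), μ ≠ [] → (∀ x ∈ μ, 0 < x) → F g μ = F' g μ) ∧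
      ∀ ℓ ∈ Icc 1 a, ∀ (g μ₁ : ℕ) (ν : List ℕ), 0 < μ₁ → (∀ x ∈ ν, 0 < x) →
        R ℓ g μ₁ ν = R' ℓ g μ₁ ν :=
  ⟨fun g _ hne hμ => h.eq_of_refined h' (fun ℓ hℓ g μ₁ ν hμ hν hd =>
    h.refined_unique h' _ _ ℓ hℓ g μ₁ ν hμ hν hd rfl) g hne hμ rfl,
  fun ℓ hℓ g μ₁ ν hμ hν => h.refined_unique h' _ _ ℓ hℓ g μ₁ ν hμ hν rfl rfl⟩

end Uniqueness
end MonotoneOrbifold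

theorem theorem1 (a : ℕ) (ha : 0 < a) :
    MonotoneOrbifold.CutJoinSystem a
        (fun g μ => MonotoneOrbifold.H a g μ)
        (fun ℓ g μ₁ ν => MonotoneOrbifold.Href a ℓ g μ₁ ν) ∧
      ∀ (F : ℕ → List ℕ → ℚ) (R : ℕ → ℕ → ℕ → List ℕ → ℚ),
        MonotoneOrbifold.CutJoinSystem a F R →
          (∀ (g : ℕ) (μ : List ℕ), μ ≠ [] → (∀ x ∈ μ, 0 < x) →
            F g μ = MonotoneOrbifold.H a g μ) ∧
          (∀ ℓ ∈ Finset.Icc 1 a, ∀ (g μ₁ : ℕ) (ν : List ℕ), 0 < μ₁ → (∀ x ∈ ν, 0 < x) →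
            R ℓ g μ₁ ν = MonotoneOrbifold.Href a ℓ g μ₁ ν) :=
  ⟨MonotoneOrbifold.cutJoinSystem_H ha,
    fun _ _ h => h.unique (MonotoneOrbifold.cutJoinSystem_H ha)⟩
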